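/- Let $\sigma_1,\sigma_2,\sigma_3$ be the Pauli matrices, $\sigma\cdot\nabla=\sum_j\sigma_j\partial_j$, $L=-i\,x\wedge\nabla$, and let $P_\pm$ be the orthogonal projectors of $L^2(\mathbb R^3,\mathbb C^2)$ onto the positive and negative spectral subspaces of $1+\sigma\cdot L$ (whose spectrum is $\{\pm1,\pm2,\dots\}$). For $R>0$ let $\mu_R$ be the surface measure on $S_R=\{x\in\mathbb R^3:|x|=R\}$; restrictions of $H^1$ functions to $S_R$ are traces. Let $W:(0,\infty)\to(0,\infty)$ be measurable, let $R>0$, and let $m_+,m_-$ be real functions on $(0,\infty)$, nonnegative off $R$, such that $s\mapsto m_\pm(s)/s$ is locally absolutely continuous on $(0,R)$ and on $(R,\infty)$ (so that $m_\pm$ is continuous off $R$ and differentiable a.e., with its a.e. derivative being its weak derivative off $R$) and such that $m_\pm$ has finite one-sided limits at $R$. Write $[m_\pm]_R=m_\pm(R_+)-m_\pm(R_-)$. (i) For every $\varphi\in H^1(\mathbb R^3,\mathbb C^2)$, the functions $P_\pm\varphi$ are in $H^1(\mathbb R^3,\mathbb C^2)$, hence have traces on $S_R$, and $$\int_{\mathbb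 R^3}\frac{|\sigma\cdot\nabla\varphi|^2}{1+\frac{W(|x|)}{|x|}}\,dx-[m_+]_R\int_{S_R}|P_+\varphi|^2\,d\mu_R+[m_-]_R\int_{S_R}|P_-\varphi|^2\,d\mu_R\ \ge\ \sum_{\pm}\int_{\mathbb R^3}\frac1s\Big(2m_\pm\pm s\,m_\pm'-(s+W)\,m_\pm^2\Big)_{|s=|x|}|P_\pm\varphi|^2\,dx .$$ Each integral on the right is the integral of the positive part minus that of the negative part, with the value $-\infty$ if the negative part has infinite integral; in particular, it is part of the claim that the right-hand side is not $+\infty$. (ii) Consequently, if for a.e. $s>0$ $$W(s)\le W^{\pm,m_\pm}(s):=\frac{2m_\pm\pm s\,m_\pm'-s\,m_\pm^2+s}{1+m_\pm^2}\quad\text{for both signs},$$ then for every $\varphi\in H^1(\mathbb R^3,\mathbb C^2)$ the function $\frac{W(|x|)}{|x|}|\varphi|^2$ is integrable and $$\int_{\mathbb R^3}\left(\frac{|\sigma\cdot\nabla\varphi|^2}{1+\frac{W(|x|)}{|x|}}+|\varphi|^2\right)dx\ \ge\ \int_{\mathbb R^3}\frac{W(|x|)}{|x|}|\varphi|^2\,dx+C(R)\int_{S_R}|\varphi|^2\,d\mu_R,\qquad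 C(R)=\min\big([m_+]_R,\,-[m_-]_R\big)=-\max\big(-[m_+]_R,\,[m_-]_R\big).$$ -/

import Mathlib

open MeasureTheory Set Filter Topology
open scoped ContDiff ENNReal

noncomputable section

namespace DiracHardy

/-- Physical space `ℝ³` with its Euclidean norm. -/
abbrev Space : Type := EuclideanSpace ℝ (Fin 3)

/-- The value space `ℂ²` of two-spinors, with its Hermitian norm. -/
abbrev Spinor : Type := EuclideanSpace ℂ (Fin 2)

/-- The Hilbert space `L²(ℝ³, ℂ²)`. -/
abbrev L2Spinor : Type := Lp Spinor 2 (volume : Measure Space)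

/-- The Pauli matrices. -/
def pauli : Fin 3 → Matrix (Fin 2) (Fin 2) ℂ :=
  ![!![0, 1; 1, 0], !![0, -Complex.I; Complex.I, 0], !![1, 0; 0, -1]]

/-- The expression `∑ⱼ σⱼ aⱼ` for a triple of spinors `a`. -/
def pauliDot (a : Fin 3 → Spinor) : Spinor :=
  ∑ j, Matrix.toEuclideanLin (pauli j) (a j)

/-- The classical partial derivative `∂ⱼ Φ` of a spinor field. -/
def partialDeriv (j : Fin 3) (Φ : Space → Spinor) (x : Space) : Spinor :=
  fderiv ℝ Φ x (EuclideanSpace.single j 1)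

/-- The components of the orbital angular momentum `L = -i x ∧ ∇`
(indices are read modulo `3`). -/
def orbitalL (Φ : Space → Spinor) (x : Space) (j : Fin 3) : Spinor :=
  (-Complex.I) • ((x (j + 1)) • partialDeriv (j + 2) Φ x - (x (j + 2)) • partialDeriv (j + 1) Φ x)

/-- The operator `1 + σ · L` on differentiable spinor fields. -/
def spinOrbit (Φ : Space → Spinor) (x : Space) : Spinor :=
  Φ x + pauliDot (orbitalL Φ x)

/-- The eigenfunctions of `1 + σ · L` in `C_c^∞(ℝ³, ℂ²)` with eigenvalue in `I`, as elements
of `L²`. -/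
def spinOrbitEigenfunctions (I : Set ℝ) : Set L2Spinor :=
  {f | ∃ Φ : Space → Spinor, ContDiff ℝ ∞ Φ ∧ HasCompactSupport Φ ∧ f =ᵐ[volume] Φ ∧
    ∃ l ∈ I, ∀ x, spinOrbit Φ x = l • Φ x}

/-- The spectral subspace of `1 + σ · L` for the set `I` of spectral values. The operator has pure
point spectrum `{±1, ±2, …}`, and test functions are dense in each of its eigenspaces, so this is
the closed span of the eigenfunctions with eigenvalue in `I`. -/
def spectralSpace (I : Set ℝ) : Submodule ℂ L2Spinor :=
  (Submodule.span ℂ (spinOrbitEigenfunctions I)).topologicalClosure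

instance (I : Set ℝ) : (spectralSpace I).HasOrthogonalProjection := by
  unfold spectralSpace
  infer_instance

/-- The projector `P₊` on the positive spectral space of `1 + σ · L`. -/
def projPos : L2Spinor →L[ℂ] L2Spinor := (spectralSpace (Ioi 0)).starProjection

/-- The projector `P₋` on the negative spectral space of `1 + σ · L`. -/
def projNeg : L2Spinor →L[ℂ] L2Spinor := (spectralSpace (Iio 0)).starProjection

/-- `φ ∈ H¹(ℝ³, ℂ²)` with weak gradient `D = (∂₁φ, ∂₂φ, ∂₃φ)` in `L²`. -/
def IsWeakGradient (φ : L2Spinor) (D : Fin 3 → L2Spinor) : Prop :=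
  ∀ (j : Fin 3) (η : Space → ℝ), ContDiff ℝ ∞ η → HasCompactSupport η →
    ∫ x : Space, (fderiv ℝ η x (EuclideanSpace.single j 1)) • φ x = - ∫ x : Space, η x • D j x

/-- The surface measure `μ_R` on the sphere `S_R`: the image of `R²` times the surface measure of
the unit sphere. -/
def surfaceMeasure (R : ℝ) : Measure Space :=
  ENNReal.ofReal (R ^ 2) •
    ((volume : Measure Space).toSphere.map (fun y : Metric.sphere (0 : Space) 1 => R • (y : Space)))

/-- `T ∈ L²(S_R, μ_R)` is the trace on `S_R` of the `H¹` spinor `u`: there are test functions which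
converge to `u` in `H¹(ℝ³)` and whose restrictions to `S_R` converge to `T` in `L²(S_R)`.
Such a `T` is unique up to `μ_R`-null sets. -/
def IsSphereTrace (R : ℝ) (u : L2Spinor) (T : Space → Spinor) : Prop :=
  MemLp T 2 (surfaceMeasure R) ∧
  ∃ (Φ : ℕ → Space → Spinor) (D : Fin 3 → L2Spinor),
    IsWeakGradient u D ∧
    (∀ n, ContDiff ℝ ∞ (Φ n) ∧ HasCompactSupport (Φ n)) ∧
    Tendsto (fun n => eLpNorm (fun x => Φ n x - u x) 2 volume) atTop (𝓝 0) ∧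
    (∀ j, Tendsto (fun n => eLpNorm (fun x => partialDeriv j (Φ n) x - D j x) 2 volume)
      atTop (𝓝 0)) ∧
    Tendsto (fun n => eLpNorm (fun x => Φ n x - T x) 2 (surfaceMeasure R)) atTop (𝓝 0)

/-- The assumptions on each of the functions `m₊`, `m₋`, as functions of `s ∈ (0, ∞)`: `m` is
nonnegative off `R`, `s ↦ m s / s` is locally absolutely continuous on `(0, R)` and on `(R, ∞)`, and
`m` has finite one-sided limits at `R`. -/
structure IsProfile (R : ℝ) (m : ℝ → ℝ) : Prop where
  nonneg : ∀ s, 0 < s → s ≠ R → 0 ≤ m s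
  absCont : ∀ a b, 0 < a → a ≤ b → R ∉ Icc a b →
    AbsolutelyContinuousOnInterval (fun s => m s / s) a b
  leftLimit : ∃ l, Tendsto m (𝓝[<] R) (𝓝 l)
  rightLimit : ∃ l, Tendsto m (𝓝[>] R) (𝓝 l)

/-- The jump `[m]_R = m(R₊) - m(R₋)`. -/
def jump (R : ℝ) (m : ℝ → ℝ) : ℝ := Function.rightLim m R - Function.leftLim m R

/-- The density `(1/s) (2 m + ε s m' - (s + W) m²)`, with `ε = ±1`. -/
def profileDensity (ε : ℝ) (W m : ℝ → ℝ) (s : ℝ) : ℝ :=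
  (1 / s) * (2 * m s + ε * s * deriv m s - (s + W s) * m s ^ 2)

/-- The function `W^{±,m} = (2 m ± s m' - s m² + s) / (1 + m²)`, with `ε = ±1`. -/
def profileBound (ε : ℝ) (m : ℝ → ℝ) (s : ℝ) : ℝ :=
  (2 * m s + ε * s * deriv m s - s * m s ^ 2 + s) / (1 + m s ^ 2)

/-- The integral over `ℝ³` of a real function, as the difference of the integrals of its positive
and its negative part. It is `-∞` as soon as the negative part has infinite integral, it is `+∞` if
only the positive part has, and it is the Lebesgue integral for integrable functions. -/
def extIntegral (f : Space → ℝ) : EReal :=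
  ((∫⁻ x, ENNReal.ofReal (f x) : ℝ≥0∞) : EReal) - ((∫⁻ x, ENNReal.ofReal (-f x) : ℝ≥0∞) : EReal)

end DiracHardy

end

/-!
Write `K = 1 + σ · L`, `r = |x|` and `w = 1 + W / r`. In polar form the Dirac operator satisfies
`(σ · x) (σ · ∇) u = r ∂ᵣ u + u - K u` (`sigmaMul_dirac`), and `σ · x` multiplies norms by `r`. So
on a spinor all of whose `K`-eigenvalues are at least `1`, expanding the square
`|(σ · ∇) u + w t (σ · x / r) u|² ≥ 0` on the sphere of radius `r` gives, with `A(r) = ∫ |u(r θ)|²`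
and any `t ≥ 0`, the bound `∫ |σ · ∇ u|² / w ≥ - t A' - w t² A` (`radial_ineq_posSpan`); with
eigenvalues at most `-1`, the square with `-t` instead of `t` gives
`∫ |σ · ∇ u|² / w ≥ t A' + 4 t A / r - w t² A` (`radial_ineq_negSpan`). The spectral gap of `K`
enters only here, as a sign. Spinors with different `K`-eigenvalues are orthogonal on every sphere,
and so are their images under `σ · ∇`; hence the two bounds add up for a sum of eigenfunctions
(`sphereInt_norm_sq_dirac_channels`).

These pointwise-in-`r` bounds pass to `H¹` by density. Finite sums of smooth, compactly supported
eigenfunctions of `K` are dense in `H¹(ℝ³, ℂ²)` (`exists_eigenSpan_approx`), for two reasons. Each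
homogeneous polynomial spinor is a sum of terms `(σ · x)ʲ m` with `m` homogeneous and `σ · ∇ m = 0`,
all of which are eigenfunctions of `K` with nonzero integer eigenvalue, by a Fischer decomposition
for `σ · ∇` (`homPoly_le_fischerSpan`, `spinOrbit_sigmaPow`), and they stay so after multiplication
by radial cutoffs. And convolution with the Landau kernels `(1 - |z|² / ρ²)ⁿ` turns a compactly
supported `H¹` spinor into one which is a polynomial on a large ball
(`integral_pow_smul_mem_polySpan`, `tendsto_landau`). Since `‖σ · ∇ u‖ = ‖∇ u‖` in `L²`, and `σ · ∇`
respects the orthogonality of the two channels, the positive and negative parts of the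
approximations converge in `H¹` as well, and their limits are `P₊ φ` and `P₋ φ`
(`exists_channel_approx`); traces follow from a trace inequality for test spinors. All that the rest
of the proof uses about `φ` is collected in `RadialData`: the spherical masses `A₊`, `A₋`,
continuous on `(0, ∞)` with weak derivatives `B₊`, `B₋`, and the bound, for a.e. `r`, on the
spherical energy.

It remains to integrate in `r`, with `t = m₊` in one channel and `m₋` in the other, and to integrate
by parts: the boundary terms at `R` are the jumps, and what is left is the stated density. Neither
`m₊` nor `m₋` is controlled at `0` and `∞`, so each is first replaced by its truncation
`m / (1 + δ m / s)`, whose quotient by `s` is bounded by `1 / δ`. This truncation changes the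
density `d` into something at least `d / (1 + δ m / s)²` (`truncFactor_sq_mul_profileDensity_le`),
so that negative parts are not enlarged, and the boundary terms at `0` and `∞` vanish along a
sequence (`exists_mul_le_of_integrableOn`). Fatou's lemma for the positive part, as `δ → 0`, gives
`RadialData.lintegral_le`, which includes the finiteness of the positive part once the negative
parts are finite. The Hardy-type inequality follows, since `W ≤ W^{±,m}` says exactly that the
density is at least `W / s - 1`.
-/

noncomputable section

namespace DiracHardy

/-! ### Algebra of the Pauli matrices -/

/-- Multiplication by `σ · x`. -/
def sigmaMul (x : Space) (ψ : Spinor) : Spinor := pauliDot fun j => x j • ψ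

/-- The Dirac operator `σ · ∇` on differentiable spinor fields. -/
def dirac (Φ : Space → Spinor) (x : Space) : Spinor := pauliDot fun j => partialDeriv j Φ x

/-- The Euler derivative `x · ∇Φ`. -/
def euler (Φ : Space → Spinor) (x : Space) : Spinor := fderiv ℝ Φ x x

lemma pauliDot_apply_zero (a : Fin 3 → Spinor) :
    pauliDot a 0 = a 0 1 - Complex.I * a 1 1 + a 2 0 := by
  simp [pauliDot, pauli, Fin.sum_univ_three, Matrix.toLpLin_apply]
  ring

lemma pauliDot_apply_one (a : Fin 3 → Spinor) :
    pauliDot a 1 = a 0 0 + Complex.I * a 1 0 - a 2 1 := by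
  simp [pauliDot, pauli, Fin.sum_univ_three, Matrix.toLpLin_apply]
  ring

lemma spinor_ext {a b : Spinor} (h0 : a 0 = b 0) (h1 : a 1 = b 1) : a = b := by
  ext i; fin_cases i
  · exact h0
  · exact h1

lemma pauliDot_add (a b : Fin 3 → Spinor) :
    pauliDot (fun j => a j + b j) = pauliDot a + pauliDot b := by
  simp [pauliDot, Finset.sum_add_distrib]

lemma pauliDot_sub (a b : Fin 3 → Spinor) :
    pauliDot (fun j => a j - b j) = pauliDot a - pauliDot b := by
  simp [pauliDot, Finset.sum_sub_distrib]

lemma pauliDot_smul (c : ℂ) (a : Fin 3 → Spinor) :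
    pauliDot (fun j => c • a j) = c • pauliDot a := by
  simp [pauliDot, Finset.smul_sum]

lemma pauliDot_smul_real (c : ℝ) (a : Fin 3 → Spinor) :
    pauliDot (fun j => c • a j) = c • pauliDot a := by
  have := pauliDot_smul (c : ℂ) a
  simpa only [Complex.coe_smul] using this

lemma pauliDot_zero : pauliDot (fun _ => 0) = 0 := by simp [pauliDot]

/-- `pauliDot` as a continuous linear map. -/
def pauliDotL : (Fin 3 → Spinor) →L[ℂ] Spinor :=
  LinearMap.toContinuousLinearMap
    { toFun := pauliDot, map_add' := pauliDot_add, map_smul' := pauliDot_smul }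

lemma sigmaMul_add (x : Space) (a b : Spinor) :
    sigmaMul x (a + b) = sigmaMul x a + sigmaMul x b := by
  simp only [sigmaMul, smul_add, pauliDot_add]

lemma sigmaMul_smul (x : Space) (c : ℂ) (a : Spinor) :
    sigmaMul x (c • a) = c • sigmaMul x a := by
  simp only [sigmaMul, smul_comm _ c, pauliDot_smul]

lemma sigmaMul_smul_real (x : Space) (c : ℝ) (a : Spinor) :
    sigmaMul x (c • a) = c • sigmaMul x a := by
  simp only [sigmaMul, smul_comm _ c, pauliDot_smul_real]

lemma norm_sq_spinor (ψ : Spinor) :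
    ‖ψ‖ ^ 2 = ((ψ 0).re ^ 2 + (ψ 0).im ^ 2) + ((ψ 1).re ^ 2 + (ψ 1).im ^ 2) := by
  rw [EuclideanSpace.norm_sq_eq]
  simp [Fin.sum_univ_two, Complex.sq_norm, Complex.normSq_apply]
  ring

lemma norm_sq_space (x : Space) : ‖x‖ ^ 2 = x 0 ^ 2 + x 1 ^ 2 + x 2 ^ 2 := by
  rw [EuclideanSpace.norm_sq_eq]
  simp [Fin.sum_univ_three]

lemma sigmaMul_sigmaMul (x : Space) (ψ : Spinor) :
    sigmaMul x (sigmaMul x ψ) = (‖x‖ ^ 2) • ψ := by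
  rw [norm_sq_space]
  apply spinor_ext
  · simp only [sigmaMul, pauliDot_apply_zero, pauliDot_apply_one, PiLp.smul_apply,
      Complex.real_smul]
    push_cast
    linear_combination (-(x 1 : ℂ) ^ 2 * ψ 0) * Complex.I_sq
  · simp only [sigmaMul, pauliDot_apply_zero, pauliDot_apply_one, PiLp.smul_apply,
      Complex.real_smul]
    push_cast
    linear_combination (-(x 1 : ℂ) ^ 2 * ψ 1) * Complex.I_sq

lemma norm_sq_sigmaMul (x : Space) (ψ : Spinor) :
    ‖sigmaMul x ψ‖ ^ 2 = ‖x‖ ^ 2 * ‖ψ‖ ^ 2 := by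
  simp only [norm_sq_spinor, norm_sq_space, sigmaMul, pauliDot_apply_zero, pauliDot_apply_one,
    PiLp.smul_apply, Complex.real_smul]
  simp
  ring

lemma euler_eq_sum (Φ : Space → Spinor) (x : Space) :
    euler Φ x = ∑ j, x j • partialDeriv j Φ x := by
  have hx : x = ∑ j, x j • EuclideanSpace.single j (1 : ℝ) := by
    ext i
    fin_cases i <;> simp [Fin.sum_univ_three]
  conv_lhs => rw [euler]
  conv_lhs => arg 2; rw [hx]
  simp [partialDeriv]

/-- The radial decomposition `(σ · x)(σ · ∇) = x · ∇ + 1 - (1 + σ · L)` of the Dirac operator. -/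
lemma sigmaMul_dirac (Φ : Space → Spinor) (x : Space) :
    sigmaMul x (dirac Φ x) = euler Φ x + Φ x - spinOrbit Φ x := by
  rw [euler_eq_sum]
  unfold spinOrbit dirac sigmaMul
  generalize Φ x = ψ
  apply spinor_ext
  · simp only [pauliDot_apply_zero, pauliDot_apply_one, PiLp.smul_apply, PiLp.add_apply,
      PiLp.sub_apply, orbitalL, Fin.sum_univ_three, Complex.real_smul, smul_eq_mul,
      Fin.isValue, zero_add, Fin.reduceAdd, show (1 : Fin 3) + 1 = 2 from rfl]
    linear_combination (x 2 * partialDeriv 0 Φ x 1 - x 0 * partialDeriv 2 Φ x 1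
        - x 1 * partialDeriv 1 Φ x 0) * Complex.I_sq
  · simp only [pauliDot_apply_zero, pauliDot_apply_one, PiLp.smul_apply, PiLp.add_apply,
      PiLp.sub_apply, orbitalL, Fin.sum_univ_three, Complex.real_smul, smul_eq_mul,
      Fin.isValue, zero_add, Fin.reduceAdd, show (1 : Fin 3) + 1 = 2 from rfl]
    linear_combination (x 0 * partialDeriv 2 Φ x 0 - x 2 * partialDeriv 0 Φ x 0
        - x 1 * partialDeriv 1 Φ x 1) * Complex.I_sq

lemma norm_sq_mul_norm_sq_dirac (Φ : Space → Spinor) (x : Space) :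
    ‖x‖ ^ 2 * ‖dirac Φ x‖ ^ 2 = ‖euler Φ x + Φ x - spinOrbit Φ x‖ ^ 2 := by
  rw [← sigmaMul_dirac, norm_sq_sigmaMul]

/-! ### Differentiation rules -/

lemma partialDeriv_add {j : Fin 3} {f g : Space → Spinor} {x : Space}
    (hf : DifferentiableAt ℝ f x) (hg : DifferentiableAt ℝ g x) :
    partialDeriv j (f + g) x = partialDeriv j f x + partialDeriv j g x := by
  simp [partialDeriv, fderiv_add hf hg]

lemma partialDeriv_const_smul (j : Fin 3) (c : ℂ) {f : Space → Spinor} {x : Space}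
    (hf : DifferentiableAt ℝ f x) :
    partialDeriv j (c • f) x = c • partialDeriv j f x := by
  simp [partialDeriv, fderiv_const_smul hf]

lemma partialDeriv_smul {j : Fin 3} {h : Space → ℝ} {f : Space → Spinor} {x : Space}
    (hh : DifferentiableAt ℝ h x) (hf : DifferentiableAt ℝ f x) :
    partialDeriv j (fun y => h y • f y) x
      = h x • partialDeriv j f x + (fderiv ℝ h x (EuclideanSpace.single j 1)) • f x := by
  simp [partialDeriv, fderiv_fun_smul hh hf]

lemma hasFDerivAt_coord (k : Fin 3) (x : Space) :
    HasFDerivAt (fun y : Space => y k) (EuclideanSpace.proj k : Space →L[ℝ] ℝ) x :=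
  (EuclideanSpace.proj k : Space →L[ℝ] ℝ).hasFDerivAt

lemma partialDeriv_coord_smul {j k : Fin 3} {f : Space → Spinor} {x : Space}
    (hf : DifferentiableAt ℝ f x) :
    partialDeriv j (fun y => y k • f y) x
      = x k • partialDeriv j f x + (if k = j then (1 : ℝ) else 0) • f x := by
  rw [partialDeriv_smul (hasFDerivAt_coord k x).differentiableAt hf, (hasFDerivAt_coord k x).fderiv]
  simp

lemma partialDeriv_clm (j : Fin 3) (A : Spinor →L[ℂ] Spinor) {f : Space → Spinor} {x : Space}
    (hf : DifferentiableAt ℝ f x) :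
    partialDeriv j (fun y => A (f y)) x = A (partialDeriv j f x) := by
  have := ((A.restrictScalars ℝ).hasFDerivAt.comp x hf.hasFDerivAt).fderiv
  simp only [partialDeriv]
  change (fderiv ℝ (⇑(A.restrictScalars ℝ) ∘ f) x) _ = _
  rw [this]; rfl

lemma partialDeriv_pauliDot (j : Fin 3) {a : Fin 3 → Space → Spinor} {x : Space}
    (ha : ∀ k, DifferentiableAt ℝ (a k) x) :
    partialDeriv j (fun y => pauliDot fun k => a k y) x = pauliDot fun k => partialDeriv j
      (a k) x := by
  have h : HasFDerivAt (fun y k => a k y) (ContinuousLinearMap.pi fun k => fderiv ℝ (a k) x) x :=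
    hasFDerivAt_pi.2 fun k => (ha k).hasFDerivAt
  have := ((pauliDotL.restrictScalars ℝ).hasFDerivAt.comp x h).fderiv
  simp only [partialDeriv]
  change (fderiv ℝ (⇑(pauliDotL.restrictScalars ℝ) ∘ fun y k => a k y) x) _ = _
  rw [this]; rfl

lemma partialDeriv_sigmaMul (j : Fin 3) {f : Space → Spinor} {x : Space}
    (hf : DifferentiableAt ℝ f x) :
    partialDeriv j (fun y => sigmaMul y (f y)) x
      = sigmaMul x (partialDeriv j f x)
        + pauliDot fun k => (if k = j then (1 : ℝ) else 0) • f x := by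
  unfold sigmaMul
  rw [partialDeriv_pauliDot (a := fun k y => y k • f y) j
    (fun k => (hasFDerivAt_coord k x).differentiableAt.smul hf)]
  simp_rw [partialDeriv_coord_smul hf]
  rw [pauliDot_add]

/-- The anticommutator `{σ · ∇, σ · x} = 3 + 2 x · ∇`. -/
lemma dirac_sigmaMul {f : Space → Spinor} {x : Space} (hf : DifferentiableAt ℝ f x) :
    dirac (fun y => sigmaMul y (f y)) x
      = (3 : ℝ) • f x + (2 : ℝ) • euler f x - sigmaMul x (dirac f x) := by
  rw [euler_eq_sum]
  unfold dirac
  simp_rw [partialDeriv_sigmaMul _ hf]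
  unfold sigmaMul
  generalize f x = ψ
  apply spinor_ext
  · simp only [pauliDot_apply_zero, pauliDot_apply_one, PiLp.smul_apply, PiLp.add_apply,
      PiLp.sub_apply, Fin.sum_univ_three, Complex.real_smul, Fin.isValue, Fin.reduceEq, if_true,
      if_false]
    push_cast
    linear_combination (-ψ 0 - 2 * x 1 * partialDeriv 1 f x 0) * Complex.I_sq
  · simp only [pauliDot_apply_zero, pauliDot_apply_one, PiLp.smul_apply, PiLp.add_apply,
      PiLp.sub_apply, Fin.sum_univ_three, Complex.real_smul, Fin.isValue, Fin.reduceEq, if_true,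
      if_false]
    push_cast
    linear_combination (-ψ 1 - 2 * x 1 * partialDeriv 1 f x 1) * Complex.I_sq

lemma dirac_add {f g : Space → Spinor} {x : Space}
    (hf : DifferentiableAt ℝ f x) (hg : DifferentiableAt ℝ g x) :
    dirac (f + g) x = dirac f x + dirac g x := by
  simp_rw [dirac, partialDeriv_add hf hg, pauliDot_add]

lemma dirac_const_smul (c : ℂ) {f : Space → Spinor} {x : Space} (hf : DifferentiableAt ℝ f x) :
    dirac (c • f) x = c • dirac f x := by
  simp_rw [dirac, partialDeriv_const_smul _ c hf, pauliDot_smul]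

lemma euler_add {f g : Space → Spinor} {x : Space}
    (hf : DifferentiableAt ℝ f x) (hg : DifferentiableAt ℝ g x) :
    euler (f + g) x = euler f x + euler g x := by
  simp [euler, fderiv_add hf hg]

lemma euler_const_smul (c : ℂ) {f : Space → Spinor} {x : Space} (hf : DifferentiableAt ℝ f x) :
    euler (c • f) x = c • euler f x := by
  simp [euler, fderiv_const_smul hf]

/-- `1 + σ · L = 1 + x · ∇ - (σ · x)(σ · ∇)`. -/
lemma spinOrbit_eq (Φ : Space → Spinor) (x : Space) :
    spinOrbit Φ x = euler Φ x + Φ x - sigmaMul x (dirac Φ x) := by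
  rw [sigmaMul_dirac]; abel

lemma spinOrbit_add {f g : Space → Spinor} {x : Space}
    (hf : DifferentiableAt ℝ f x) (hg : DifferentiableAt ℝ g x) :
    spinOrbit (f + g) x = spinOrbit f x + spinOrbit g x := by
  simp only [spinOrbit_eq, euler_add hf hg, dirac_add hf hg, sigmaMul_add, Pi.add_apply]
  abel

lemma spinOrbit_const_smul (c : ℂ) {f : Space → Spinor} {x : Space}
    (hf : DifferentiableAt ℝ f x) :
    spinOrbit (c • f) x = c • spinOrbit f x := by
  simp only [spinOrbit_eq, euler_const_smul c hf, dirac_const_smul c hf, sigmaMul_smul,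
    Pi.smul_apply, smul_sub, smul_add]

/-- `1 + σ · L` commutes with the multiplication by radial functions. -/
lemma spinOrbit_radial_smul {h : ℝ → ℝ} (hh : Differentiable ℝ h) {f : Space → Spinor} {x : Space}
    (hf : DifferentiableAt ℝ f x) :
    spinOrbit (fun y => h (‖y‖ ^ 2) • f y) x = h (‖x‖ ^ 2) • spinOrbit f x := by
  have hN : HasFDerivAt (fun y : Space => h (‖y‖ ^ 2))
      ((deriv h (‖x‖ ^ 2)) • ((2 : ℝ) • innerSL ℝ x)) x := by
    have h1 : HasFDerivAt (fun y : Space => ‖y‖ ^ 2) ((2 : ℝ) • innerSL ℝ x) x := by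
      simpa [ofNat_smul_eq_nsmul] using (hasStrictFDerivAt_norm_sq x).hasFDerivAt
    exact (hh _).hasDerivAt.comp_hasFDerivAt x h1
  have hp : ∀ j, partialDeriv j (fun y => h (‖y‖ ^ 2) • f y) x
      = h (‖x‖ ^ 2) • partialDeriv j f x + (deriv h (‖x‖ ^ 2) * (2 * x j)) • f x := by
    intro j
    rw [partialDeriv_smul hN.differentiableAt hf, hN.fderiv]
    simp [EuclideanSpace.inner_single_right]
  have hL : orbitalL (fun y => h (‖y‖ ^ 2) • f y) x = fun j => h (‖x‖ ^ 2) • orbitalL f x j := by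
    funext j
    simp only [orbitalL, hp, smul_comm (h _) (-Complex.I)]
    congr 1
    module
  simp only [spinOrbit, hL, pauliDot_smul_real, smul_add]

lemma euler_radial_smul {h : ℝ → ℝ} (hh : Differentiable ℝ h) {f : Space → Spinor} {x : Space}
    (hf : DifferentiableAt ℝ f x) :
    euler (fun y => h (‖y‖ ^ 2) • f y) x
      = h (‖x‖ ^ 2) • euler f x + (deriv h (‖x‖ ^ 2) * (2 * ‖x‖ ^ 2)) • f x := by
  have hN : HasFDerivAt (fun y : Space => h (‖y‖ ^ 2))
      ((deriv h (‖x‖ ^ 2)) • ((2 : ℝ) • innerSL ℝ x)) x := by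
    have h1 : HasFDerivAt (fun y : Space => ‖y‖ ^ 2) ((2 : ℝ) • innerSL ℝ x) x := by
      simpa [ofNat_smul_eq_nsmul] using (hasStrictFDerivAt_norm_sq x).hasFDerivAt
    exact (hh _).hasDerivAt.comp_hasFDerivAt x h1
  simp [euler, fderiv_fun_smul hN.differentiableAt hf, hN.fderiv]

/-! ### Homogeneous polynomial spinors -/

/-- The space of homogeneous polynomial spinor fields of degree `n`. -/
def homPoly : ℕ → Submodule ℂ (Space → Spinor)
  | 0 => Submodule.span ℂ (range fun (ψ : Spinor) (_ : Space) => ψ)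
  | n + 1 => Submodule.span ℂ {f | ∃ k : Fin 3, ∃ p ∈ homPoly n, f = fun x => x k • p x}

lemma coord_smul_mem_homPoly {n : ℕ} {p : Space → Spinor} (hp : p ∈ homPoly n) (k : Fin 3) :
    (fun x => x k • p x) ∈ homPoly (n + 1) :=
  Submodule.subset_span ⟨k, p, hp, rfl⟩

/-- Induction on the generators `x_k p` of the homogeneous polynomials of positive degree. -/
lemma homPoly_induction {P : ℕ → (Space → Spinor) → Prop}
    (const : ∀ ψ, P 0 fun _ => ψ)
    (coord : ∀ n k p, p ∈ homPoly n → P n p → P (n + 1) fun x => x k • p x)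
    (zero : ∀ n, P n 0)
    (add : ∀ n f g, f ∈ homPoly n → g ∈ homPoly n → P n f → P n g → P n (f + g))
    (smul : ∀ n (c : ℂ) f, f ∈ homPoly n → P n f → P n (c • f)) :
    ∀ n f, f ∈ homPoly n → P n f := by
  intro n
  induction n with
  | zero =>
    intro f hf
    refine Submodule.span_induction (p := fun f _ => P 0 f) ?_ (zero 0)
      (fun f g hf hg => add 0 f g hf hg) (fun c f hf => smul 0 c f hf) hf
    rintro _ ⟨ψ, rfl⟩
    exact const ψ
  | succ n ih =>
    intro f hf
    refine Submodule.span_induction (p := fun f _ => P (n + 1) f) ?_ (zero _)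
      (fun f g hf hg => add _ f g hf hg) (fun c f hf => smul _ c f hf) hf
    rintro _ ⟨k, p, hp, rfl⟩
    exact coord n k p hp (ih p hp)

lemma contDiff_coord (k : Fin 3) : ContDiff ℝ ∞ (fun y : Space => y k) :=
  (EuclideanSpace.proj k : Space →L[ℝ] ℝ).contDiff

lemma contDiff_of_mem_homPoly {n : ℕ} {f : Space → Spinor} (hf : f ∈ homPoly n) :
    ContDiff ℝ ∞ f :=
  homPoly_induction (P := fun _ f => ContDiff ℝ ∞ f) (fun _ => contDiff_const)
    (fun _ k _ _ hp => (contDiff_coord k).smul hp) (fun _ => contDiff_const)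
    (fun _ _ _ _ _ => ContDiff.add) (fun _ _ _ _ hf => contDiff_const.smul hf) n f hf

lemma differentiable_of_mem_homPoly {n : ℕ} {f : Space → Spinor} (hf : f ∈ homPoly n) :
    Differentiable ℝ f :=
  (contDiff_of_mem_homPoly hf).differentiable (by simp)

/-- Euler's identity for homogeneous polynomials. -/
lemma euler_of_mem_homPoly {n : ℕ} {f : Space → Spinor} (hf : f ∈ homPoly n) (x : Space) :
    euler f x = (n : ℝ) • f x := by
  revert x
  refine homPoly_induction (P := fun n f => ∀ x, euler f x = (n : ℝ) • f x)
    (fun ψ x => by simp [euler]) ?_ (fun n x => by simp [euler]) ?_ ?_ n f hf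
  · intro n k p hp ih x
    have h1 := (hasFDerivAt_coord k x)
    have h2 : euler (fun y => y k • p y) x = x k • euler p x + x k • p x := by
      simp [euler, fderiv_fun_smul h1.differentiableAt (differentiable_of_mem_homPoly hp x),
        h1.fderiv]
    rw [h2, ih]
    push_cast
    module
  · intro n f g hf hg ihf ihg x
    rw [euler_add (differentiable_of_mem_homPoly hf x) (differentiable_of_mem_homPoly hg x),
      ihf, ihg, Pi.add_apply, smul_add]
  · intro n c f hf ihf x
    rw [euler_const_smul c (differentiable_of_mem_homPoly hf x), ihf, Pi.smul_apply, smul_comm]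

lemma clm_comp_mem_homPoly {n : ℕ} {f : Space → Spinor} (hf : f ∈ homPoly n)
    (A : Spinor →L[ℂ] Spinor) : (fun x => A (f x)) ∈ homPoly n := by
  refine homPoly_induction (P := fun n f => (fun x => A (f x)) ∈ homPoly n)
    (fun ψ => Submodule.subset_span ⟨A ψ, rfl⟩) ?_ (fun n => ?_) ?_ ?_ n f hf
  · intro n k p hp ih
    have : (fun x : Space => A (x k • p x)) = fun x => x k • A (p x) := by
      funext x
      exact (A.restrictScalars ℝ).map_smul _ _
    rw [this]
    exact coord_smul_mem_homPoly ih k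
  · have : (fun x => A ((0 : Space → Spinor) x)) = 0 := by funext x; simp
    rw [this]
    exact Submodule.zero_mem _
  · intro n f g _ _ hf hg
    have : (fun x => A ((f + g) x)) = (fun x => A (f x)) + fun x => A (g x) := by funext x; simp
    rw [this]
    exact Submodule.add_mem _ hf hg
  · intro n c f _ hf
    have : (fun x => A ((c • f) x)) = c • fun x => A (f x) := by funext x; simp
    rw [this]
    exact Submodule.smul_mem _ c hf

lemma pauliDot_mem_homPoly {n : ℕ} {a : Fin 3 → Space → Spinor} (ha : ∀ k, a k ∈ homPoly n) :
    (fun x => pauliDot fun k => a k x) ∈ homPoly n := by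
  have : (fun x => pauliDot fun k => a k x)
      = ∑ k, fun x => LinearMap.toContinuousLinearMap (Matrix.toEuclideanLin (pauli k))
        (a k x) := by
    funext x
    simp [pauliDot]
  rw [this]
  exact Submodule.sum_mem _ fun k _ => clm_comp_mem_homPoly (ha k) _

lemma sigmaMul_mem_homPoly {n : ℕ} {f : Space → Spinor} (hf : f ∈ homPoly n) :
    (fun x => sigmaMul x (f x)) ∈ homPoly (n + 1) :=
  pauliDot_mem_homPoly fun k => coord_smul_mem_homPoly hf k

lemma partialDeriv_of_mem_homPoly_zero {f : Space → Spinor} (hf : f ∈ homPoly 0) (j : Fin 3) :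
    partialDeriv j f = 0 := by
  refine Submodule.span_induction (p := fun f _ => partialDeriv j f = 0) ?_ ?_ ?_ ?_ hf
  · rintro _ ⟨ψ, rfl⟩
    funext x
    simp [partialDeriv]
  · funext x
    simp [partialDeriv]
  · intro f g hf hg ihf ihg
    funext x
    rw [partialDeriv_add (differentiable_of_mem_homPoly (n := 0) hf x)
      (differentiable_of_mem_homPoly (n := 0) hg x), ihf, ihg]
    simp
  · intro c f hf ihf
    funext x
    rw [partialDeriv_const_smul j c (differentiable_of_mem_homPoly (n := 0) hf x), ihf]
    simp

lemma partialDeriv_mem_homPoly {n : ℕ} {f : Space → Spinor} (hf : f ∈ homPoly (n + 1))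
    (j : Fin 3) : partialDeriv j f ∈ homPoly n := by
  suffices H : ∀ n f, f ∈ homPoly n → ∀ m, n = m + 1 → partialDeriv j f ∈ homPoly m from
    H _ f hf n rfl
  refine homPoly_induction (P := fun n f => ∀ m, n = m + 1 → partialDeriv j f ∈ homPoly m)
    (by simp) ?_ ?_ ?_ ?_
  · intro n k p hp ih m hm
    obtain rfl : n = m := by omega
    have h : partialDeriv j (fun x => x k • p x)
        = (fun x => x k • partialDeriv j p x) + ((if k = j then (1 : ℝ) else 0) : ℂ) • p := by
      funext x
      rw [partialDeriv_coord_smul (differentiable_of_mem_homPoly hp x)]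
      split_ifs <;> simp
    rw [h]
    refine Submodule.add_mem _ ?_ (Submodule.smul_mem _ _ hp)
    cases n with
    | zero =>
      have h0 : (fun x : Space => x k • partialDeriv j p x) = 0 := by
        funext x
        simp [partialDeriv_of_mem_homPoly_zero hp]
      rw [h0]
      exact Submodule.zero_mem _
    | succ n => exact coord_smul_mem_homPoly (ih n rfl) k
  · intro n m _
    have : partialDeriv j (0 : Space → Spinor) = 0 := by funext x; simp [partialDeriv]
    rw [this]; exact Submodule.zero_mem _
  · intro n f g hf hg ihf ihg m hm
    have : partialDeriv j (f + g) = partialDeriv j f + partialDeriv j g := by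
      funext x
      exact partialDeriv_add (differentiable_of_mem_homPoly hf x)
        (differentiable_of_mem_homPoly hg x)
    rw [this]; exact Submodule.add_mem _ (ihf m hm) (ihg m hm)
  · intro n c f hf ihf m hm
    have : partialDeriv j (c • f) = c • partialDeriv j f := by
      funext x
      exact partialDeriv_const_smul j c (differentiable_of_mem_homPoly hf x)
    rw [this]; exact Submodule.smul_mem _ _ (ihf m hm)

lemma dirac_mem_homPoly {n : ℕ} {f : Space → Spinor} (hf : f ∈ homPoly (n + 1)) :
    dirac f ∈ homPoly n :=
  pauliDot_mem_homPoly fun k => partialDeriv_mem_homPoly hf k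

/-! ### The Fischer decomposition -/

/-- Iterated multiplication `(σ · x)^j f`. -/
def sigmaPow : ℕ → (Space → Spinor) → Space → Spinor
  | 0, f => f
  | j + 1, f => fun x => sigmaMul x (sigmaPow j f x)

lemma sigmaPow_mem_homPoly {k : ℕ} {m : Space → Spinor} (hm : m ∈ homPoly k) (j : ℕ) :
    sigmaPow j m ∈ homPoly (k + j) := by
  induction j with
  | zero => exact hm
  | succ j ih => exact sigmaMul_mem_homPoly ih

/-- The constant `c` in `(σ · ∇)(σ · x)^(j+1) m = c (σ · x)^j m`, for a homogeneous polynomial `m`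
of degree `k` with `σ · ∇ m = 0`. -/
def fischerConst (k j : ℕ) : ℝ := if Even j then 2 * k + 3 + j else j + 1

lemma fischerConst_pos (k j : ℕ) : 0 < fischerConst k j := by
  unfold fischerConst
  split_ifs <;> positivity

lemma fischerConst_succ (k j : ℕ) :
    fischerConst k (j + 1) = 2 * (k + j + 1) + 3 - fischerConst k j := by
  unfold fischerConst
  rcases Nat.even_or_odd j with h | h
  · rw [if_neg (by simpa [Nat.even_add_one] using h), if_pos h]
    push_cast; ring
  · rw [if_pos (by simpa [Nat.even_add_one] using h), if_neg (by simpa using h)]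
    push_cast; ring

lemma dirac_sigmaPow_succ {k : ℕ} {m : Space → Spinor} (hm : m ∈ homPoly k) (hd : dirac m = 0)
    (j : ℕ) (x : Space) :
    dirac (sigmaPow (j + 1) m) x = fischerConst k j • sigmaPow j m x := by
  induction j generalizing x with
  | zero =>
    change dirac (fun y => sigmaMul y (m y)) x = fischerConst k 0 • m x
    rw [dirac_sigmaMul (differentiable_of_mem_homPoly hm x), hd, euler_of_mem_homPoly hm]
    simp only [fischerConst, Even.zero, if_true, Pi.zero_apply]
    have : sigmaMul x 0 = 0 := by simpa using sigmaMul_smul x 0 0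
    rw [this]
    push_cast
    module
  | succ j ih =>
    have hj := sigmaPow_mem_homPoly hm (j + 1)
    change dirac (fun y => sigmaMul y (sigmaPow (j + 1) m y)) x = _
    rw [dirac_sigmaMul (differentiable_of_mem_homPoly hj x), euler_of_mem_homPoly hj, ih,
      sigmaMul_smul_real, fischerConst_succ]
    change _ - fischerConst k j • sigmaPow (j + 1) m x = _
    push_cast
    module

/-- The fields `(σ · x)^j m` are eigenfunctions of `1 + σ · L`, with the eigenvalue `k + 1` if `j`
is even and `-(k + 1)` if `j` is odd. -/
lemma spinOrbit_sigmaPow {k : ℕ} {m : Space → Spinor} (hm : m ∈ homPoly k) (hd : dirac m = 0)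
    (j : ℕ) (x : Space) :
    spinOrbit (sigmaPow j m) x
      = ((if Even j then (k : ℤ) + 1 else -((k : ℤ) + 1) : ℤ) : ℝ) • sigmaPow j m x := by
  rw [spinOrbit_eq, euler_of_mem_homPoly (sigmaPow_mem_homPoly hm j)]
  cases j with
  | zero =>
    have : sigmaMul x 0 = 0 := by simpa using sigmaMul_smul x 0 0
    change _ + _ - sigmaMul x (dirac m x) = _
    rw [hd, Pi.zero_apply, this]
    simp
    module
  | succ j =>
    rw [dirac_sigmaPow_succ hm hd, sigmaMul_smul_real]
    change _ - fischerConst k j • sigmaPow (j + 1) m x = _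
    unfold fischerConst
    rcases Nat.even_or_odd j with h | h
    · rw [if_pos h, if_neg (by simpa [Nat.even_add_one] using h)]
      push_cast
      module
    · rw [if_neg (by simpa using h), if_pos (by simpa [Nat.even_add_one] using h)]
      push_cast
      module

/-- The span of the fields `(σ · x)^j m` of degree `n`, where `m` is a homogeneous polynomial with
`σ · ∇ m = 0`. -/
def fischerSpan (n : ℕ) : Submodule ℂ (Space → Spinor) :=
  Submodule.span ℂ {f | ∃ k j m, k + j = n ∧ m ∈ homPoly k ∧ dirac m = 0 ∧ f = sigmaPow j m}

lemma fischerSpan_le (n : ℕ) : fischerSpan n ≤ homPoly n := by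
  refine Submodule.span_le.2 ?_
  rintro _ ⟨k, j, m, rfl, hm, -, rfl⟩
  exact sigmaPow_mem_homPoly hm j

/-- `σ · ∇` maps `fischerSpan (n + 1)` onto `fischerSpan n`, because the constants `fischerConst`
do not vanish. -/
lemma exists_dirac_eq_of_mem_fischerSpan {n : ℕ} {q : Space → Spinor} (hq : q ∈ fischerSpan n) :
    ∃ p ∈ fischerSpan (n + 1), dirac p = q := by
  refine Submodule.span_induction
    (p := fun q _ => ∃ p ∈ fischerSpan (n + 1), dirac p = q) ?_ ?_ ?_ ?_ hq
  · rintro _ ⟨k, j, m, rfl, hm, hd, rfl⟩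
    refine ⟨(((fischerConst k j)⁻¹ : ℝ) : ℂ) • sigmaPow (j + 1) m, Submodule.smul_mem _ _
      (Submodule.subset_span ⟨k, j + 1, m, rfl, hm, hd, rfl⟩), ?_⟩
    funext x
    rw [dirac_const_smul _ (differentiable_of_mem_homPoly (sigmaPow_mem_homPoly hm _) x),
      dirac_sigmaPow_succ hm hd, Complex.coe_smul, smul_smul,
      inv_mul_cancel₀ (fischerConst_pos k j).ne', one_smul]
  · refine ⟨0, Submodule.zero_mem _, ?_⟩
    funext x
    simp [dirac, partialDeriv, pauliDot_zero]
  · rintro q q' - - ⟨p, hp, rfl⟩ ⟨p', hp', rfl⟩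
    refine ⟨p + p', Submodule.add_mem _ hp hp', ?_⟩
    funext x
    exact dirac_add (differentiable_of_mem_homPoly (fischerSpan_le _ hp) x)
      (differentiable_of_mem_homPoly (fischerSpan_le _ hp') x)
  · rintro c q - ⟨p, hp, rfl⟩
    refine ⟨c • p, Submodule.smul_mem _ _ hp, ?_⟩
    funext x
    exact dirac_const_smul c (differentiable_of_mem_homPoly (fischerSpan_le _ hp) x)

/-- The Fischer decomposition: every homogeneous polynomial spinor is a sum of fields
`(σ · x)^j m` with `σ · ∇ m = 0`. -/
lemma homPoly_le_fischerSpan (n : ℕ) : homPoly n ≤ fischerSpan n := by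
  induction n with
  | zero =>
    intro p hp
    refine Submodule.subset_span ⟨0, 0, p, rfl, hp, ?_, rfl⟩
    funext x
    simp [dirac, partialDeriv_of_mem_homPoly_zero hp, pauliDot_zero]
  | succ n ih =>
    intro p hp
    -- By induction `σ · ∇ p` lies in the span, hence is `σ · ∇ p'` with `p'` in the span, and
    -- `p - p'` is annihilated by `σ · ∇`.
    obtain ⟨p', hp', hd⟩ := exists_dirac_eq_of_mem_fischerSpan (ih (dirac_mem_homPoly hp))
    have hp'' := fischerSpan_le _ hp'
    have hsub : p - p' ∈ fischerSpan (n + 1) := by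
      refine Submodule.subset_span ⟨n + 1, 0, p - p', rfl, Submodule.sub_mem _ hp hp'', ?_, rfl⟩
      have h1 : p - p' = p + (-1 : ℂ) • p' := by simp [sub_eq_add_neg]
      funext x
      rw [h1, dirac_add (differentiable_of_mem_homPoly hp x)
        (differentiable_of_mem_homPoly (Submodule.smul_mem _ _ hp'') x),
        dirac_const_smul _ (differentiable_of_mem_homPoly hp'' x), hd]
      simp
    simpa using Submodule.add_mem _ hsub hp'

/-! ### Test spinors -/

/-- `C_c^∞` spinor fields. -/
def IsTest (Φ : Space → Spinor) : Prop := ContDiff ℝ ∞ Φ ∧ HasCompactSupport Φ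

namespace IsTest

variable {u v : Space → Spinor}

lemma differentiable (hu : IsTest u) : Differentiable ℝ u := hu.1.differentiable (by simp)

lemma continuous (hu : IsTest u) : Continuous u := hu.1.continuous

lemma zero : IsTest 0 := ⟨contDiff_const, HasCompactSupport.zero⟩

lemma add (hu : IsTest u) (hv : IsTest v) : IsTest (u + v) :=
  ⟨hu.1.add hv.1, hu.2.add hv.2⟩

lemma sum {ι : Type*} {s : Finset ι} {u : ι → Space → Spinor} (hu : ∀ i ∈ s, IsTest (u i)) :
    IsTest (∑ i ∈ s, u i) :=
  Finset.sum_induction _ IsTest (fun _ _ => add) zero hu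

lemma const_smul (hu : IsTest u) (c : ℂ) : IsTest (c • u) := by
  refine ⟨contDiff_const.smul hu.1, hu.2.mono fun x hx => ?_⟩
  simp only [Function.mem_support, Pi.smul_apply] at hx ⊢
  exact fun h => hx (by simp [h])

lemma sub (hu : IsTest u) (hv : IsTest v) : IsTest (u - v) := by
  have := hu.add (hv.const_smul (-1))
  simpa [sub_eq_add_neg] using this

lemma smul (hu : IsTest u) {h : Space → ℝ} (hh : ContDiff ℝ ∞ h) : IsTest fun x => h x • u x := by
  refine ⟨hh.smul hu.1, hu.2.mono fun x hx => ?_⟩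
  simp only [Function.mem_support] at hx ⊢
  exact fun h => hx (by simp [h])

lemma partialDeriv (hu : IsTest u) (j : Fin 3) : IsTest (partialDeriv j u) := by
  refine ⟨(hu.1.fderiv_right (m := ∞) (by simp)).clm_apply contDiff_const, ?_⟩
  refine (hu.2.fderiv (𝕜 := ℝ)).mono fun x hx => ?_
  intro h
  apply hx
  simp [DiracHardy.partialDeriv, h]

lemma clm (hu : IsTest u) (A : Spinor →L[ℂ] Spinor) : IsTest fun x => A (u x) :=
  ⟨(A.restrictScalars ℝ).contDiff.comp hu.1, hu.2.comp_left (g := fun ψ => A ψ) (map_zero A)⟩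

lemma pauliDot {a : Fin 3 → Space → Spinor} (ha : ∀ k, IsTest (a k)) :
    IsTest fun x => pauliDot fun k => a k x := by
  have : (fun x => DiracHardy.pauliDot fun k => a k x)
      = ∑ k, fun x => LinearMap.toContinuousLinearMap (Matrix.toEuclideanLin (pauli k))
        (a k x) := by
    funext x
    simp [DiracHardy.pauliDot]
  rw [this]
  exact sum fun k _ => (ha k).clm _

lemma dirac (hu : IsTest u) : IsTest (dirac u) := pauliDot fun k => hu.partialDeriv k

lemma coord_smul (hu : IsTest u) (k : Fin 3) : IsTest fun x => x k • u x :=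
  hu.smul (contDiff_coord k)

lemma sigmaMul (hu : IsTest u) : IsTest fun x => sigmaMul x (u x) :=
  pauliDot fun k => hu.coord_smul k

lemma euler (hu : IsTest u) : IsTest (euler u) := by
  have : DiracHardy.euler u = ∑ j, fun x : Space => x j • DiracHardy.partialDeriv j u x := by
    funext x
    simp [euler_eq_sum]
  rw [this]
  exact sum fun j _ => (hu.partialDeriv j).coord_smul j

lemma radial_smul (hu : IsTest u) {h : ℝ → ℝ} (hh : ContDiff ℝ ∞ h) :
    IsTest fun x => h (‖x‖ ^ 2) • u x :=
  hu.smul (hh.comp (contDiff_norm_sq ℝ))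

lemma integrable_inner (hu : IsTest u) (hv : IsTest v) :
    Integrable (fun x => inner ℝ (u x) (v x)) := by
  refine (hu.continuous.inner hv.continuous).integrable_of_hasCompactSupport ?_
  refine hu.2.mono fun x hx => ?_
  simp only [Function.mem_support] at hx ⊢
  exact fun h => hx (by simp [h])

lemma memLp (hu : IsTest u) (μ : Measure Space) [IsFiniteMeasureOnCompacts μ] : MemLp u 2 μ :=
  hu.continuous.memLp_of_hasCompactSupport hu.2

end IsTest

/-! ### Integration by parts -/

lemma integral_inner_partialDeriv {u v : Space → Spinor} (hu : IsTest u) (hv : IsTest v)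
    (j : Fin 3) :
    ∫ x, inner ℝ (partialDeriv j u x) (v x) = - ∫ x, inner ℝ (u x) (partialDeriv j v x) := by
  have : ∫ x, inner ℝ (u x) (partialDeriv j v x) = - ∫ x, inner ℝ (partialDeriv j u x) (v x) :=
    integral_bilinear_fderiv_right_eq_neg_left_of_integrable (μ := (volume : Measure Space))
    (f := u) (g := v) (v := EuclideanSpace.single j 1) (B := innerSL ℝ)
    ((hu.partialDeriv j).integrable_inner hv) (hu.integrable_inner (hv.partialDeriv j))
    (hu.integrable_inner hv) (fun x _ => hu.differentiable x) (fun x _ => hv.differentiable x)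
  rw [this, neg_neg]

lemma inner_pauli (j : Fin 3) (a b : Spinor) :
    inner ℝ (Matrix.toEuclideanLin (pauli j) a) b
      = inner ℝ a (Matrix.toEuclideanLin (pauli j) b) := by
  fin_cases j <;>
  · simp [pauli, PiLp.inner_apply, Matrix.toLpLin_apply, Matrix.vecHead, Matrix.vecTail]
    try ring

lemma inner_pauliDot (a : Fin 3 → Spinor) (b : Spinor) :
    inner ℝ (pauliDot a) b = ∑ j, inner ℝ (a j) (Matrix.toEuclideanLin (pauli j) b) := by
  simp [pauliDot, sum_inner, inner_pauli]

lemma inner_sigmaMul (x : Space) (a b : Spinor) :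
    inner ℝ (sigmaMul x a) b = inner ℝ a (sigmaMul x b) := by
  rw [real_inner_comm _ a]
  simp only [sigmaMul, inner_pauliDot, real_inner_smul_left, real_inner_comm _ a, ← inner_pauli]

lemma integral_inner_dirac {u v : Space → Spinor} (hu : IsTest u) (hv : IsTest v) :
    ∫ x, inner ℝ (dirac u x) (v x) = - ∫ x, inner ℝ (u x) (dirac v x) := by
  have hA : ∀ j, IsTest fun x => Matrix.toEuclideanLin (pauli j) (v x) := fun j =>
    hv.clm (LinearMap.toContinuousLinearMap (Matrix.toEuclideanLin (pauli j)))
  have hpd : ∀ j x, partialDeriv j (fun x => Matrix.toEuclideanLin (pauli j) (v x)) x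
      = Matrix.toEuclideanLin (pauli j) (partialDeriv j v x) := fun j x =>
    partialDeriv_clm j (LinearMap.toContinuousLinearMap (Matrix.toEuclideanLin (pauli j)))
      (hv.differentiable x)
  have hA' : ∀ j, IsTest fun x => Matrix.toEuclideanLin (pauli j) (partialDeriv j v x) :=
      fun j => by
    have := (hA j).partialDeriv j
    rwa [show partialDeriv j (fun x => Matrix.toEuclideanLin (pauli j) (v x)) = _ from
      funext (hpd j)] at this
  simp only [dirac, inner_pauliDot]
  rw [integral_finsetSum _ fun j _ => (hu.partialDeriv j).integrable_inner (hA j)]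
  simp_rw [integral_inner_partialDeriv hu (hA _), hpd]
  rw [Finset.sum_neg_distrib, ← integral_finsetSum _ fun j _ => hu.integrable_inner (hA' j)]
  simp [pauliDot, inner_sum]

lemma integral_inner_euler {u v : Space → Spinor} (hu : IsTest u) (hv : IsTest v) :
    ∫ x, inner ℝ (euler u x) (v x)
      = - ∫ x, inner ℝ (u x) ((3 : ℝ) • v x + euler v x) := by
  have h1 : ∀ x, inner ℝ (euler u x) (v x)
      = ∑ j, inner ℝ (partialDeriv j u x) (x j • v x) := fun x => by
    rw [euler_eq_sum, sum_inner]
    simp [real_inner_smul_left, real_inner_smul_right]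
  have h2 : ∀ x, (3 : ℝ) • v x + euler v x = ∑ j, partialDeriv j (fun x => x j • v x) x :=
      fun x => by
    simp only [partialDeriv_coord_smul (hv.differentiable x), if_true, one_smul,
      Finset.sum_add_distrib, euler_eq_sum, Finset.sum_const, Finset.card_univ, Fintype.card_fin]
    rw [add_comm, ← Nat.cast_smul_eq_nsmul ℝ]
    norm_num
  simp_rw [h1, h2, inner_sum]
  rw [integral_finsetSum _ fun j _ => (hu.partialDeriv j).integrable_inner (hv.coord_smul j),
    integral_finsetSum _ fun j _ => hu.integrable_inner ((hv.coord_smul j).partialDeriv j),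
    ← Finset.sum_neg_distrib]
  exact Finset.sum_congr rfl fun j _ => integral_inner_partialDeriv hu (hv.coord_smul j) j

/-- `1 + σ · L` is symmetric on test spinors. -/
lemma integral_inner_spinOrbit {u v : Space → Spinor} (hu : IsTest u) (hv : IsTest v) :
    ∫ x, inner ℝ (spinOrbit u x) (v x) = ∫ x, inner ℝ (u x) (spinOrbit v x) := by
  have hsd : ∀ {w}, IsTest w → IsTest fun x => sigmaMul x (dirac w x) := fun hw => hw.dirac.sigmaMul
  have e1 := integral_inner_euler hu hv
  have e2 : ∫ x, inner ℝ (sigmaMul x (dirac u x)) (v x)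
      = - ∫ x, inner ℝ (u x) ((3 : ℝ) • v x + (2 : ℝ) • euler v x - sigmaMul x (dirac v x)) := by
    simp_rw [inner_sigmaMul, integral_inner_dirac hu hv.sigmaMul,
      dirac_sigmaMul (hv.differentiable _)]
  simp only [inner_add_right, inner_sub_right, real_inner_smul_right] at e1 e2
  have i1 := hu.integrable_inner hv
  have i2 := hu.integrable_inner hv.euler
  have i3 := hu.integrable_inner (hsd hv)
  rw [integral_add (i1.const_mul 3) i2, integral_const_mul] at e1
  have i12 : Integrable fun x => 3 * inner ℝ (u x) (v x) + 2 * inner ℝ (u x) (euler v x) :=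
    (i1.const_mul 3).add (i2.const_mul 2)
  rw [integral_sub i12 i3,
    integral_add (i1.const_mul 3) (i2.const_mul 2), integral_const_mul, integral_const_mul] at e2
  simp only [spinOrbit_eq, inner_add_left, inner_sub_left, inner_add_right, inner_sub_right]
  have i0 := hu.euler.integrable_inner hv
  have i01 : Integrable fun x => inner ℝ (euler u x) (v x) + inner ℝ (u x) (v x) := i0.add i1
  have i21 : Integrable fun x => inner ℝ (u x) (euler v x) + inner ℝ (u x) (v x) := i2.add i1
  rw [integral_sub i01 ((hsd hu).integrable_inner hv), integral_add i0 i1, integral_sub i21 i3,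
    integral_add i2 i1]
  linarith

lemma partialDeriv_comm {u : Space → Spinor} (hu : ContDiff ℝ ∞ u) (j k : Fin 3) (x : Space) :
    partialDeriv j (partialDeriv k u) x = partialDeriv k (partialDeriv j u) x := by
  have hd : DifferentiableAt ℝ (fderiv ℝ u) x :=
    ((hu.fderiv_right (m := ∞) (by simp)).differentiable (by simp)) x
  have h : ∀ i l, partialDeriv i (partialDeriv l u) x
      = fderiv ℝ (fderiv ℝ u) x (EuclideanSpace.single i 1) (EuclideanSpace.single l 1) := by
    intro i l
    change fderiv ℝ (fun y => fderiv ℝ u y (EuclideanSpace.single l 1)) x _ = _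
    rw [fderiv_clm_apply hd (differentiableAt_const _)]
    simp
  rw [h, h]
  exact (hu.contDiffAt.isSymmSndFDerivAt
      (by simpa using WithTop.coe_le_coe.2 (le_top : (2 : ℕ∞) ≤ ⊤))) _ _

lemma dirac_dirac {u : Space → Spinor} (hu : IsTest u) (x : Space) :
    dirac (dirac u) x = ∑ j, partialDeriv j (partialDeriv j u) x := by
  have h : ∀ j, partialDeriv j (dirac u) x
      = pauliDot fun k => partialDeriv j (partialDeriv k u) x := fun j =>
    partialDeriv_pauliDot j fun k => (hu.partialDeriv k).differentiable x
  rw [dirac]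
  simp_rw [h]
  have h01 := partialDeriv_comm hu.1 0 1 x
  have h02 := partialDeriv_comm hu.1 0 2 x
  have h12 := partialDeriv_comm hu.1 1 2 x
  apply spinor_ext
  · simp only [pauliDot_apply_zero, pauliDot_apply_one, Fin.sum_univ_three, PiLp.add_apply, h01,
      h02, h12]
    linear_combination (-partialDeriv 1 (partialDeriv 1 u) x 0) * Complex.I_sq
  · simp only [pauliDot_apply_zero, pauliDot_apply_one, Fin.sum_univ_three, PiLp.add_apply, h01,
      h02, h12]
    linear_combination (-partialDeriv 1 (partialDeriv 1 u) x 1) * Complex.I_sq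

/-- `‖σ · ∇u‖ = ‖∇u‖` in `L²`. -/
lemma integral_norm_sq_dirac {u : Space → Spinor} (hu : IsTest u) :
    ∫ x, ‖dirac u x‖ ^ 2 = ∑ j, ∫ x, ‖partialDeriv j u x‖ ^ 2 := by
  simp_rw [← real_inner_self_eq_norm_sq]
  rw [integral_inner_dirac hu hu.dirac]
  simp_rw [dirac_dirac hu, inner_sum]
  rw [integral_finsetSum _ fun j _ => hu.integrable_inner ((hu.partialDeriv j).partialDeriv j),
    ← Finset.sum_neg_distrib]
  exact Finset.sum_congr rfl fun j _ => (integral_inner_partialDeriv hu (hu.partialDeriv j) j).symm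

/-! ### Eigenfunctions of `1 + σ · L` -/

/-- The test spinors `v` such that `v` and `x · ∇v` are eigenfunctions of `1 + σ · L` with
eigenvalue `l`. (The second condition follows from the first, since `1 + σ · L` commutes with
`x · ∇`; having it in the definition spares this commutation.) -/
def eigenTest (l : ℤ) : Submodule ℂ (Space → Spinor) where
  carrier := {v | IsTest v ∧ (∀ x, spinOrbit v x = (l : ℝ) • v x) ∧
    ∀ x, spinOrbit (euler v) x = (l : ℝ) • euler v x}
  zero_mem' := by
    have h0 : ∀ x, spinOrbit (0 : Space → Spinor) x = 0 := fun x => by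
      simpa using spinOrbit_const_smul 0 (f := 0) (x := x) (differentiableAt_const _)
    have h1 : euler (0 : Space → Spinor) = 0 := by funext x; simp [euler]
    exact ⟨IsTest.zero, fun x => by simp [h0], fun x => by rw [h1]; simp [h0]⟩
  add_mem' := by
    rintro u v ⟨hu, hu1, hu2⟩ ⟨hv, hv1, hv2⟩
    refine ⟨hu.add hv, fun x => ?_, fun x => ?_⟩
    · rw [spinOrbit_add (hu.differentiable x) (hv.differentiable x), hu1, hv1, Pi.add_apply,
        smul_add]
    · have : euler (u + v) = euler u + euler v := by
        funext x
        exact euler_add (hu.differentiable x) (hv.differentiable x)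
      rw [this, spinOrbit_add (hu.euler.differentiable x) (hv.euler.differentiable x), hu2, hv2,
        Pi.add_apply, smul_add]
  smul_mem' := by
    rintro c u ⟨hu, hu1, hu2⟩
    refine ⟨hu.const_smul c, fun x => ?_, fun x => ?_⟩
    · rw [spinOrbit_const_smul c (hu.differentiable x), hu1, Pi.smul_apply, smul_comm]
    · have : euler (c • u) = c • euler u := by
        funext x
        exact euler_const_smul c (hu.differentiable x)
      rw [this, spinOrbit_const_smul c (hu.euler.differentiable x), hu2, Pi.smul_apply, smul_comm]

lemma radial_smul_mem_eigenTest {n : ℕ} {l : ℤ} {f : Space → Spinor} (hf : f ∈ homPoly n)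
    (hl : ∀ x, spinOrbit f x = (l : ℝ) • f x) {h : ℝ → ℝ} (hh : ContDiff ℝ ∞ h)
    (hc : HasCompactSupport h) : (fun x => h (‖x‖ ^ 2) • f x) ∈ eigenTest l := by
  have hd : ∀ x, DifferentiableAt ℝ f x := fun x => differentiable_of_mem_homPoly hf x
  have hsupp : HasCompactSupport fun x : Space => h (‖x‖ ^ 2) • f x := by
    obtain ⟨M, hM⟩ := hc.isCompact.isBounded.subset_closedBall 0
    refine HasCompactSupport.intro (isCompact_closedBall (0 : Space) (M + 1)) fun x hx => ?_
    have hx' : M + 1 < ‖x‖ := by simpa using hx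
    have : h (‖x‖ ^ 2) = 0 := by
      refine image_eq_zero_of_notMem_tsupport fun hm => ?_
      have h3 := hM hm
      simp only [mem_closedBall_zero_iff, norm_pow, norm_norm] at h3
      nlinarith [norm_nonneg x]
    simp [this]
  have hh1 : Differentiable ℝ h := hh.differentiable (by simp)
  have hh2 : ContDiff ℝ ∞ (deriv h) := ((contDiff_infty_iff_deriv).1 hh).2
  refine ⟨⟨(hh.comp (contDiff_norm_sq ℝ)).smul (contDiff_of_mem_homPoly hf), hsupp⟩,
    fun x => ?_, fun x => ?_⟩
  · rw [spinOrbit_radial_smul hh1 (hd x), hl, smul_comm]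
  · have : euler (fun y => h (‖y‖ ^ 2) • f y)
        = fun y => (fun s => h s * n + deriv h s * (2 * s)) (‖y‖ ^ 2) • f y := by
      funext y
      rw [euler_radial_smul hh1 (hd y), euler_of_mem_homPoly hf, smul_smul, ← add_smul]
    have hh3 : Differentiable ℝ fun s => h s * n + deriv h s * (2 * s) := by
      have := hh2.differentiable (by simp)
      fun_prop
    rw [this, spinOrbit_radial_smul hh3 (hd x), hl, smul_comm]

/-- The span of the test spinors which are eigenfunctions of `1 + σ · L` for a nonzero integer. -/
def eigenSpan : Submodule ℂ (Space → Spinor) := ⨆ l : {l : ℤ // l ≠ 0}, eigenTest l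

lemma radial_smul_homPoly_mem_eigenSpan {n : ℕ} {f : Space → Spinor} (hf : f ∈ homPoly n)
    {h : ℝ → ℝ} (hh : ContDiff ℝ ∞ h) (hc : HasCompactSupport h) :
    (fun x => h (‖x‖ ^ 2) • f x) ∈ eigenSpan := by
  refine Submodule.span_induction (p := fun f _ => (fun x => h (‖x‖ ^ 2) • f x) ∈ eigenSpan)
    ?_ ?_ ?_ ?_ (homPoly_le_fischerSpan n hf)
  · rintro _ ⟨k, j, m, rfl, hm, hd, rfl⟩
    refine Submodule.mem_iSup_of_mem (p := fun l : {l : ℤ // l ≠ 0} => eigenTest l)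
      ⟨if Even j then (k : ℤ) + 1 else -((k : ℤ) + 1), ?_⟩
      (radial_smul_mem_eigenTest (sigmaPow_mem_homPoly hm j) (spinOrbit_sigmaPow hm hd j) hh hc)
    split_ifs <;> omega
  · have : (fun x : Space => h (‖x‖ ^ 2) • (0 : Space → Spinor) x) = 0 := by funext x; simp
    rw [this]; exact Submodule.zero_mem _
  · intro f g _ _ hf hg
    have : (fun x : Space => h (‖x‖ ^ 2) • (f + g) x)
        = (fun x => h (‖x‖ ^ 2) • f x) + fun x => h (‖x‖ ^ 2) • g x := by funext x; simp
    rw [this]; exact Submodule.add_mem _ hf hg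
  · intro c f _ hf
    have : (fun x : Space => h (‖x‖ ^ 2) • (c • f) x) = c • fun x => h (‖x‖ ^ 2) • f x := by
      funext x; simp only [Pi.smul_apply, smul_comm _ c]
    rw [this]; exact Submodule.smul_mem _ c hf

/-- Test eigenfunctions for different eigenvalues are orthogonal. -/
lemma integral_inner_eq_zero {u v : Space → Spinor} (hu : IsTest u) (hv : IsTest v) {l l' : ℝ}
    (hul : ∀ x, spinOrbit u x = l • u x) (hvl : ∀ x, spinOrbit v x = l' • v x) (hne : l ≠ l') :
    ∫ x, inner ℝ (u x) (v x) = 0 := by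
  have := integral_inner_spinOrbit hu hv
  simp only [hul, hvl, real_inner_smul_left, real_inner_smul_right, integral_const_mul] at this
  have h2 : (l - l') * ∫ x, inner ℝ (u x) (v x) = 0 := by linarith
  exact (mul_eq_zero.1 h2).resolve_left (sub_ne_zero.2 hne)

/-! ### Polar coordinates -/

/-- The unit sphere of `ℝ³`. -/
abbrev UnitSphere : Type := Metric.sphere (0 : Space) 1

/-- The surface measure of the unit sphere. -/
abbrev sphereMeasure : Measure UnitSphere := (volume : Measure Space).toSphere

/-- The radial measure `r² dr` on `(0, ∞)`. -/
def radialMeasure : Measure ℝ :=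
  ((volume : Measure ℝ).restrict (Ioi 0)).withDensity fun r => ENNReal.ofReal (r ^ 2)

instance : SFinite radialMeasure := by unfold radialMeasure; infer_instance

lemma norm_unitSphere (θ : UnitSphere) : ‖(θ : Space)‖ = 1 := mem_sphere_zero_iff_norm.1 θ.2

lemma continuous_polar : Continuous fun p : ℝ × UnitSphere => p.1 • (p.2 : Space) := by fun_prop

lemma radialMeasure_eq_map : radialMeasure = (Measure.volumeIoiPow 2).map Subtype.val := by
  have hemb : MeasurableEmbedding (Subtype.val : Ioi (0 : ℝ) → ℝ) :=
    MeasurableEmbedding.subtype_coe measurableSet_Ioi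
  have h := hemb.map_comap (volume : Measure ℝ)
  rw [Subtype.range_coe] at h
  ext s hs
  rw [hemb.map_apply, Measure.volumeIoiPow, radialMeasure, withDensity_apply _ hs,
    withDensity_apply _ (hemb.measurable hs), ← h,
    setLIntegral_map hs (by fun_prop) hemb.measurable]

/-- Integration in polar coordinates. -/
lemma measurePreserving_polar :
    MeasurePreserving (fun p : ℝ × UnitSphere => p.1 • (p.2 : Space))
      (radialMeasure.prod sphereMeasure) volume := by
  refine ⟨continuous_polar.measurable, ?_⟩
  have h0 := (volume : Measure Space).measurePreserving_homeomorphUnitSphereProd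
  have hdim : Module.finrank ℝ Space - 1 = 2 := by simp
  rw [hdim] at h0
  have hemb : MeasurableEmbedding (Subtype.val : Ioi (0 : ℝ) → ℝ) :=
    MeasurableEmbedding.subtype_coe measurableSet_Ioi
  have hemb2 : MeasurableEmbedding (Subtype.val : ({0}ᶜ : Set Space) → Space) :=
    MeasurableEmbedding.subtype_coe (measurableSet_singleton _).compl
  have h1 : (sphereMeasure.prod (Measure.volumeIoiPow 2)).map
      (homeomorphUnitSphereProd Space).symm = (volume : Measure Space).comap Subtype.val := by
    rw [← h0.map_eq, Measure.map_map (homeomorphUnitSphereProd Space).symm.measurable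
      (homeomorphUnitSphereProd Space).measurable]
    simp
  have h2 : ((sphereMeasure.prod (Measure.volumeIoiPow 2)).map
      (homeomorphUnitSphereProd Space).symm).map Subtype.val = (volume : Measure Space) := by
    rw [h1, hemb2.map_comap, Subtype.range_coe, restrict_compl_singleton]
  rw [Measure.map_map hemb2.measurable (homeomorphUnitSphereProd Space).symm.measurable] at h2
  have h3 : radialMeasure.prod sphereMeasure
      = (sphereMeasure.prod (Measure.volumeIoiPow 2)).map
        (fun p : UnitSphere × Ioi (0 : ℝ) => ((p.2 : ℝ), p.1)) := by
    rw [← Measure.prod_swap, radialMeasure_eq_map]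
    have := Measure.map_prod_map sphereMeasure (Measure.volumeIoiPow 2) measurable_id
      hemb.measurable
    rw [Measure.map_id] at this
    rw [this, Measure.map_map measurable_swap (by fun_prop)]
    rfl
  rw [h3, Measure.map_map continuous_polar.measurable (by fun_prop)]
  exact h2

lemma quasiMeasurePreserving_norm_aux {p : ℝ → Prop} (h : ∀ᵐ r ∂radialMeasure, p r) :
    ∀ᵐ x : Space, p ‖x‖ := by
  have hn : ∀ᵐ r ∂radialMeasure, 0 < r := by
    refine (withDensity_absolutelyContinuous _ _).ae_le ?_
    exact ae_restrict_mem measurableSet_Ioi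
  rw [← measurePreserving_polar.map_eq]
  obtain ⟨s, hs, hsm, hs0⟩ := exists_measurable_superset_of_null (ae_iff.1 h)
  have h2 : ∀ᵐ q ∂(radialMeasure.prod sphereMeasure), ‖q.1 • (q.2 : Space)‖ ∉ s := by
    have hs' : ∀ᵐ r ∂radialMeasure, r ∉ s := by simpa [ae_iff] using hs0
    have := Measure.quasiMeasurePreserving_fst (μ := radialMeasure) (ν := sphereMeasure)
    filter_upwards [this.ae hs', this.ae hn] with q hq hq0
    rw [norm_smul, norm_unitSphere, mul_one, Real.norm_of_nonneg hq0.le]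
    exact hq
  have h3 : ∀ᵐ x ∂((radialMeasure.prod sphereMeasure).map
      fun p : ℝ × UnitSphere => p.1 • (p.2 : Space)), ‖x‖ ∉ s := by
    rw [ae_map_iff continuous_polar.aemeasurable]
    · exact h2
    · exact (measurable_norm hsm).compl
  filter_upwards [h3] with x hx
  by_contra hc
  exact hx (hs hc)

lemma ae_radialMeasure_iff {p : ℝ → Prop} :
    (∀ᵐ r ∂radialMeasure, p r) ↔ ∀ᵐ r ∂(volume.restrict (Ioi (0 : ℝ))), p r := by
  rw [radialMeasure, ae_withDensity_iff (by fun_prop)]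
  refine eventually_congr ?_
  filter_upwards [ae_restrict_mem measurableSet_Ioi] with r hr
  have : ENNReal.ofReal (r ^ 2) ≠ 0 := by
    have := mem_Ioi.1 hr
    simp only [ne_eq, ENNReal.ofReal_eq_zero, not_le]
    positivity
  simp [this]

/-- A property of almost every radius holds for the norm of almost every point. -/
lemma ae_norm_of_ae {p : ℝ → Prop} (h : ∀ᵐ r ∂(volume.restrict (Ioi (0 : ℝ))), p r) :
    ∀ᵐ x : Space, p ‖x‖ :=
  quasiMeasurePreserving_norm_aux (ae_radialMeasure_iff.2 h)

lemma lintegral_polar {f : Space → ℝ≥0∞} (hf : AEMeasurable f) :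
    ∫⁻ x, f x = ∫⁻ r, ∫⁻ θ, f (r • (θ : Space)) ∂sphereMeasure ∂radialMeasure := by
  have hf' := hf
  rw [← measurePreserving_polar.map_eq] at hf'
  conv_lhs => rw [← measurePreserving_polar.map_eq]
  rw [lintegral_map' hf' continuous_polar.aemeasurable, lintegral_prod]
  exact hf'.comp_aemeasurable continuous_polar.aemeasurable

/-- The integral of `f` over the unit sphere after scaling by `r`, that is, `r⁻²` times the integral
over the sphere of radius `r`. -/
def sphereInt (f : Space → ℝ) (r : ℝ) : ℝ := ∫ θ : UnitSphere, f (r • (θ : Space)) ∂sphereMeasure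

lemma integrable_polar {f : Space → ℝ} (hf : Integrable f) :
    Integrable (fun p : ℝ × UnitSphere => f (p.1 • (p.2 : Space)))
      (radialMeasure.prod sphereMeasure) :=
  (measurePreserving_polar.integrable_comp hf.aestronglyMeasurable).2 hf

lemma integrable_sphereInt {f : Space → ℝ} (hf : Integrable f) :
    Integrable (sphereInt f) radialMeasure :=
  (integrable_polar hf).integral_prod_left

lemma integral_sphereInt {f : Space → ℝ} (hf : Integrable f) :
    ∫ r, sphereInt f r ∂radialMeasure = ∫ x, f x := by
  have h1 := integral_prod _ (integrable_polar hf)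
  have h2 : ∫ x, f x = ∫ p, f (p.1 • (p.2 : Space)) ∂(radialMeasure.prod sphereMeasure) := by
    conv_lhs => rw [← measurePreserving_polar.map_eq]
    rw [integral_map continuous_polar.aemeasurable]
    rw [measurePreserving_polar.map_eq]
    exact hf.aestronglyMeasurable
  rw [h2, h1]
  rfl

lemma ae_integrable_sphere {f : Space → ℝ} (hf : Integrable f) :
    ∀ᵐ r ∂radialMeasure, Integrable (fun θ : UnitSphere => f (r • (θ : Space))) sphereMeasure :=
  (integrable_polar hf).prod_right_ae

lemma lintegral_enorm_sphereInt_sub_le {f g : Space → ℝ} (hf : Integrable f) (hg : Integrable g) :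
    ∫⁻ r, ‖sphereInt f r - sphereInt g r‖ₑ ∂radialMeasure ≤ ∫⁻ x, ‖f x - g x‖ₑ := by
  rw [lintegral_polar (f := fun x => ‖f x - g x‖ₑ) (hf.sub hg).aestronglyMeasurable.enorm]
  refine lintegral_mono_ae ?_
  filter_upwards [ae_integrable_sphere hf, ae_integrable_sphere hg] with r h1 h2
  rw [sphereInt, sphereInt, ← integral_sub h1 h2]
  exact enorm_integral_le_lintegral_enorm _

lemma lintegral_radialMeasure {f : ℝ → ℝ≥0∞} :
    ∫⁻ r, f r ∂radialMeasure = ∫⁻ r in Ioi 0, ENNReal.ofReal (r ^ 2) * f r := by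
  rw [radialMeasure, lintegral_withDensity_eq_lintegral_mul_non_measurable _ (by fun_prop)]
  · rfl
  · exact ae_of_all _ fun r => ENNReal.ofReal_lt_top

lemma integral_radialMeasure {f : ℝ → ℝ} :
    ∫ r, f r ∂radialMeasure = ∫ r in Ioi 0, r ^ 2 * f r := by
  rw [radialMeasure, integral_withDensity_eq_integral_toReal_smul (by fun_prop)
    (ae_of_all _ fun r => ENNReal.ofReal_lt_top)]
  simp [ENNReal.toReal_ofReal, sq_nonneg]

lemma integrable_radialMeasure_iff {f : ℝ → ℝ} :
    Integrable f radialMeasure ↔ IntegrableOn (fun r => r ^ 2 * f r) (Ioi 0) := by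
  rw [radialMeasure, integrable_withDensity_iff_integrable_smul' (by fun_prop)
    (ae_of_all _ fun r => ENNReal.ofReal_lt_top)]
  simp [ENNReal.toReal_ofReal, sq_nonneg, IntegrableOn]

lemma measurableEmbedding_smul_sphere {R : ℝ} (hR : R ≠ 0) :
    MeasurableEmbedding fun y : UnitSphere => R • (y : Space) :=
  ((Homeomorph.smulOfNeZero R hR).measurableEmbedding).comp
    (MeasurableEmbedding.subtype_coe Metric.isClosed_sphere.measurableSet)

lemma integral_surfaceMeasure {R : ℝ} (hR : R ≠ 0) (f : Space → ℝ) :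
    ∫ x, f x ∂surfaceMeasure R = R ^ 2 * sphereInt f R := by
  rw [surfaceMeasure, integral_smul_measure, (measurableEmbedding_smul_sphere hR).integral_map,
    ENNReal.toReal_ofReal (sq_nonneg R)]
  rfl

instance (R : ℝ) : IsFiniteMeasure (surfaceMeasure R) := by
  unfold surfaceMeasure
  exact Measure.smul_finite _ ENNReal.ofReal_ne_top

/-! ### Spherical integrals of continuous functions -/

lemma integrable_sphere {f : UnitSphere → ℝ} (hf : Continuous f) : Integrable f sphereMeasure :=
  hf.integrable_of_hasCompactSupport (HasCompactSupport.of_compactSpace f)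

lemma continuous_sphereInt {f : Space → ℝ} (hf : Continuous f) : Continuous (sphereInt f) := by
  have := continuous_parametric_integral_of_continuous (μ := sphereMeasure)
    (f := fun (r : ℝ) (θ : UnitSphere) => f (r • (θ : Space))) (by fun_prop) isCompact_univ
  simp only [Measure.restrict_univ] at this
  exact this

/-- The radial derivative `∂_r u`. -/
def radialDeriv (u : Space → Spinor) (x : Space) : Spinor := ‖x‖⁻¹ • euler u x

lemma radialDeriv_smul (u : Space → Spinor) {r : ℝ} (hr : 0 < r) (θ : UnitSphere) :
    radialDeriv u (r • (θ : Space)) = fderiv ℝ u (r • (θ : Space)) (θ : Space) := by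
  rw [radialDeriv, euler, norm_smul, norm_unitSphere, mul_one, Real.norm_of_nonneg hr.le, map_smul,
    smul_smul, inv_mul_cancel₀ hr.ne', one_smul]

lemma hasDerivAt_sphereInt_norm_sq {u : Space → Spinor} (hu : IsTest u) (r : ℝ) :
    HasDerivAt (sphereInt fun x => ‖u x‖ ^ 2)
      (∫ θ : UnitSphere, 2 * inner ℝ (u (r • (θ : Space)))
        (fderiv ℝ u (r • (θ : Space)) (θ : Space)) ∂sphereMeasure) r := by
  have hfd : Continuous (fderiv ℝ u) := hu.1.continuous_fderiv (by simp)
  obtain ⟨C1, hC1⟩ := hu.2.exists_bound_of_continuous hu.continuous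
  obtain ⟨C2, hC2⟩ := (hu.2.fderiv (𝕜 := ℝ)).exists_bound_of_continuous hfd
  have hu' := hu.continuous
  refine (hasDerivAt_integral_of_dominated_loc_of_deriv_le (s := univ)
    (F' := fun r (θ : UnitSphere) => 2 * inner ℝ (u (r • (θ : Space)))
        (fderiv ℝ u (r • (θ : Space)) (θ : Space))) (bound := fun _ => 2 * (C1 * C2)) univ_mem
    (Eventually.of_forall fun s => ?_) ?_ ?_ ?_ (integrable_const _) ?_).2
  · exact Continuous.aestronglyMeasurable (by fun_prop)
  · exact integrable_sphere (by fun_prop)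
  · refine Continuous.aestronglyMeasurable ?_
    have : Continuous fun θ : UnitSphere => fderiv ℝ u (r • (θ : Space)) (θ : Space) :=
      (hfd.comp (by fun_prop)).clm_apply continuous_subtype_val
    fun_prop
  · refine ae_of_all _ fun θ s _ => ?_
    rw [norm_mul, Real.norm_of_nonneg zero_le_two]
    refine mul_le_mul_of_nonneg_left ?_ zero_le_two
    refine (norm_inner_le_norm _ _).trans (mul_le_mul (hC1 _) ?_ (norm_nonneg _)
      ((norm_nonneg _).trans (hC1 0)))
    refine (ContinuousLinearMap.le_opNorm _ _).trans ?_
    rw [norm_unitSphere, mul_one]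
    exact hC2 _
  · refine ae_of_all _ fun θ s _ => ?_
    have h1 : HasDerivAt (fun s : ℝ => s • (θ : Space)) (θ : Space) s := by
      simpa using (hasDerivAt_id s).smul_const (θ : Space)
    have h2 := (hu.differentiable (s • (θ : Space))).hasFDerivAt.comp_hasDerivAt s h1
    exact h2.norm_sq

/-- The fundamental theorem of calculus for the spherical integrals of `|u|²`. -/
lemma sphereInt_norm_sq_sub {u : Space → Spinor} (hu : IsTest u) {a b : ℝ} (ha : 0 < a)
    (hb : 0 < b) :
    sphereInt (fun x => ‖u x‖ ^ 2) b - sphereInt (fun x => ‖u x‖ ^ 2) a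
      = ∫ r in a..b, sphereInt (fun x => 2 * inner ℝ (u x) (radialDeriv u x)) r := by
  have hfd : Continuous (fderiv ℝ u) := hu.1.continuous_fderiv (by simp)
  have hu' := hu.continuous
  have hc : Continuous fun r : ℝ => ∫ θ : UnitSphere, 2 * inner ℝ (u (r • (θ : Space)))
        (fderiv ℝ u (r • (θ : Space)) (θ : Space)) ∂sphereMeasure := by
    have h2 : Continuous fun p : ℝ × UnitSphere =>
        fderiv ℝ u (p.1 • (p.2 : Space)) (p.2 : Space) :=
      (hfd.comp (by fun_prop)).clm_apply (by fun_prop)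
    have := continuous_parametric_integral_of_continuous (μ := sphereMeasure)
      (f := fun (r : ℝ) (θ : UnitSphere) => 2 * inner ℝ (u (r • (θ : Space)))
        (fderiv ℝ u (r • (θ : Space)) (θ : Space))) (by
          have h3 : Continuous fun p : ℝ × UnitSphere => u (p.1 • (p.2 : Space)) := by fun_prop
          exact continuous_const.mul (h3.inner h2)) isCompact_univ
    simpa only [Measure.restrict_univ] using this
  rw [← intervalIntegral.integral_eq_sub_of_hasDerivAt
    (fun r _ => hasDerivAt_sphereInt_norm_sq hu r) (hc.intervalIntegrable _ _)]
  refine intervalIntegral.integral_congr fun r hr => ?_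
  have hr0 : 0 < r := lt_of_lt_of_le (lt_min ha hb) hr.1
  simp only [sphereInt, radialDeriv_smul u hr0]

/-! ### Orthogonality on spheres -/

lemma sphereInt_inner_eq_zero {u v : Space → Spinor} (hu : IsTest u) (hv : IsTest v) {l l' : ℝ}
    (hul : ∀ x, spinOrbit u x = l • u x) (hvl : ∀ x, spinOrbit v x = l' • v x) (hne : l ≠ l')
    {r : ℝ} (hr : 0 < r) : sphereInt (fun x => inner ℝ (u x) (v x)) r = 0 := by
  set c := sphereInt fun x => inner ℝ (u x) (v x) with hc
  have hcc : Continuous c := continuous_sphereInt (hu.continuous.inner hv.continuous)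
  have key : ∀ g : ℝ → ℝ, ContDiff ℝ ∞ g → HasCompactSupport g → tsupport g ⊆ Ioi 0 →
      ∫ s, g s • (s ^ 2 * c s) = 0 := by
    intro g hg hgc hgs
    have hh : ContDiff ℝ ∞ fun s => g (Real.sqrt s) := by
      rw [contDiff_iff_contDiffAt]
      intro s
      rcases lt_or_ge 0 s with hs | hs
      · exact hg.contDiffAt.comp s (Real.contDiffAt_sqrt hs.ne')
      · have h0 : Real.sqrt s ∉ tsupport g := by
          rw [Real.sqrt_eq_zero_of_nonpos hs]
          exact fun h => lt_irrefl (0 : ℝ) (hgs h)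
        have h1 : g =ᶠ[𝓝 (Real.sqrt s)] 0 := notMem_tsupport_iff_eventuallyEq.1 h0
        have h2 : (fun s => g (Real.sqrt s)) =ᶠ[𝓝 s] fun _ => 0 :=
          (Real.continuous_sqrt.tendsto s).eventually h1
        exact contDiffAt_const.congr_of_eventuallyEq h2
    have h3 := integral_inner_eq_zero (hu.radial_smul hh) hv
      (fun x => by
        rw [spinOrbit_radial_smul (hh.differentiable (by simp)) (hu.differentiable x), hul,
          smul_comm]) hvl hne
    rw [← integral_sphereInt ((hu.radial_smul hh).integrable_inner hv), integral_radialMeasure]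
      at h3
    have h4 : ∫ s, g s • (s ^ 2 * c s) = ∫ s in Ioi 0, g s • (s ^ 2 * c s) := by
      refine (setIntegral_eq_integral_of_forall_compl_eq_zero fun s hs => ?_).symm
      have : g s = 0 := image_eq_zero_of_notMem_tsupport fun h => hs (hgs h)
      simp [this]
    rw [h4]
    refine Eq.trans ?_ h3
    refine setIntegral_congr_fun measurableSet_Ioi fun s hs => ?_
    have hs' : 0 < s := hs
    simp only [sphereInt, norm_smul, norm_unitSphere, mul_one, Real.norm_of_nonneg hs'.le,
      Real.sqrt_sq hs'.le, real_inner_smul_left, integral_const_mul, hc, smul_eq_mul]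
    ring
  have hloc : LocallyIntegrableOn (fun s => s ^ 2 * c s) (Ioi 0) volume :=
    ((by fun_prop : Continuous fun s => s ^ 2 * c s).locallyIntegrable).locallyIntegrableOn _
  have hae := isOpen_Ioi.ae_eq_zero_of_integral_contDiff_smul_eq_zero hloc key
  have hae' : (fun s => s ^ 2 * c s) =ᵐ[volume.restrict (Ioi 0)] fun _ => 0 :=
    (ae_restrict_iff' measurableSet_Ioi).2 hae
  have := Measure.eqOn_open_of_ae_eq hae' isOpen_Ioi (by fun_prop) (by fun_prop) hr
  simpa [hr.ne'] using this

/-! ### Positive and negative channels of test spinors -/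

/-- Finite sums of test eigenfunctions of `1 + σ · L` with positive integer eigenvalues. -/
def posSpan : Submodule ℂ (Space → Spinor) := ⨆ l : {l : ℤ // 0 < l}, eigenTest l

/-- Finite sums of test eigenfunctions of `1 + σ · L` with negative integer eigenvalues. -/
def negSpan : Submodule ℂ (Space → Spinor) := ⨆ l : {l : ℤ // l < 0}, eigenTest l

lemma eigenSpan_le : eigenSpan ≤ posSpan ⊔ negSpan := by
  refine iSup_le fun l => ?_
  rcases lt_or_gt_of_ne l.2 with h | h
  · exact (le_iSup (fun l : {l : ℤ // l < 0} => eigenTest l) ⟨l, h⟩).trans le_sup_right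
  · exact (le_iSup (fun l : {l : ℤ // 0 < l} => eigenTest l) ⟨l, h⟩).trans le_sup_left

lemma isTest_of_mem_iSup {q : ℤ → Prop} {v : Space → Spinor}
    (hv : v ∈ ⨆ l : {l : ℤ // q l}, eigenTest l) : IsTest v :=
  Submodule.iSup_induction (fun l : {l : ℤ // q l} => eigenTest l) (motive := IsTest) hv
    (fun _ _ h => h.1) IsTest.zero fun _ _ => IsTest.add

lemma isTest_of_mem_posSpan {v : Space → Spinor} (hv : v ∈ posSpan) : IsTest v :=
  isTest_of_mem_iSup hv

lemma isTest_of_mem_negSpan {v : Space → Spinor} (hv : v ∈ negSpan) : IsTest v :=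
  isTest_of_mem_iSup hv

lemma sphereInt_inner_add_left {u v w : Space → Spinor} (hu : Continuous u) (hv : Continuous v)
    (hw : Continuous w) (r : ℝ) :
    sphereInt (fun x => inner ℝ ((u + v) x) (w x)) r
      = sphereInt (fun x => inner ℝ (u x) (w x)) r + sphereInt
        (fun x => inner ℝ (v x) (w x)) r := by
  simp only [sphereInt, Pi.add_apply, inner_add_left]
  exact integral_add (integrable_sphere (by fun_prop)) (integrable_sphere (by fun_prop))

lemma sphereInt_inner_comm (u v : Space → Spinor) (r : ℝ) :
    sphereInt (fun x => inner ℝ (u x) (v x)) r = sphereInt (fun x => inner ℝ (v x) (u x)) r := by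
  simp only [real_inner_comm]

lemma sphereInt_norm_sq_add {u v : Space → Spinor} (hu : Continuous u) (hv : Continuous v) (r : ℝ)
    (h : sphereInt (fun x => inner ℝ (u x) (v x)) r = 0) :
    sphereInt (fun x => ‖(u + v) x‖ ^ 2) r
      = sphereInt (fun x => ‖u x‖ ^ 2) r + sphereInt (fun x => ‖v x‖ ^ 2) r := by
  unfold sphereInt at h ⊢
  simp only [Pi.add_apply, norm_add_sq_real]
  have i1 : Integrable (fun θ : UnitSphere => ‖u (r • (θ : Space))‖ ^ 2) sphereMeasure :=
    integrable_sphere (by fun_prop)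
  have i2 : Integrable (fun θ : UnitSphere =>
      2 * inner ℝ (u (r • (θ : Space))) (v (r • (θ : Space)))) sphereMeasure :=
    integrable_sphere (by fun_prop)
  have i3 : Integrable (fun θ : UnitSphere => ‖v (r • (θ : Space))‖ ^ 2) sphereMeasure :=
    integrable_sphere (by fun_prop)
  have i12 : Integrable (fun θ : UnitSphere => ‖u (r • (θ : Space))‖ ^ 2
      + 2 * inner ℝ (u (r • (θ : Space))) (v (r • (θ : Space)))) sphereMeasure := i1.add i2
  rw [integral_add i12 i3, integral_add i1 i2, integral_const_mul, h]
  ring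

/-- Two eigenfunctions for different eigenvalues remain orthogonal on spheres under `σ · ∇`. -/
lemma sphereInt_inner_dirac_eigenTest {u v : Space → Spinor} {l l' : ℤ} (hu : u ∈ eigenTest l)
    (hv : v ∈ eigenTest l') (hne : l ≠ l') {r : ℝ} (hr : 0 < r) :
    sphereInt (fun x => inner ℝ (dirac u x) (dirac v x)) r = 0 := by
  obtain ⟨hu, hu1, hu2⟩ := hu
  obtain ⟨hv, hv1, hv2⟩ := hv
  have hne' : (l : ℝ) ≠ l' := by exact_mod_cast hne
  -- On the sphere of radius `r`, `σ · x` is `r` times an isometry, so that `dirac` may be replaced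
  -- by `(σ · x)(σ · ∇) u = x · ∇u + (1 - l) u`, which is again an eigenfunction.
  have hpt : ∀ x, ‖x‖ ^ 2 * inner ℝ (dirac u x) (dirac v x)
      = inner ℝ (euler u x + (1 - l : ℝ) • u x) (euler v x + (1 - l' : ℝ) • v x) := by
    intro x
    have e1 : sigmaMul x (dirac u x) = euler u x + (1 - l : ℝ) • u x := by
      rw [sigmaMul_dirac, hu1]; module
    have e2 : sigmaMul x (dirac v x) = euler v x + (1 - l' : ℝ) • v x := by
      rw [sigmaMul_dirac, hv1]; module
    rw [← e1, ← e2, inner_sigmaMul, sigmaMul_sigmaMul, real_inner_smul_right]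
  have hu3 := (hu.const_smul ((1 - l : ℝ) : ℂ))
  have hv3 := (hv.const_smul ((1 - l' : ℝ) : ℂ))
  have key := sphereInt_inner_eq_zero (hu.euler.add hu3) (hv.euler.add hv3) (l := l) (l' := l')
    (fun x => by
      rw [spinOrbit_add (hu.euler.differentiable x) (hu3.differentiable x), hu2,
        spinOrbit_const_smul _ (hu.differentiable x), hu1, Pi.add_apply, smul_add, Pi.smul_apply,
        smul_comm])
    (fun x => by
      rw [spinOrbit_add (hv.euler.differentiable x) (hv3.differentiable x), hv2,
        spinOrbit_const_smul _ (hv.differentiable x), hv1, Pi.add_apply, smul_add, Pi.smul_apply,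
        smul_comm]) hne' hr
  have h2 : r ^ 2 * sphereInt (fun x => inner ℝ (dirac u x) (dirac v x)) r = 0 := by
    rw [← key]
    simp only [sphereInt, ← integral_const_mul]
    refine integral_congr_ae (ae_of_all _ fun θ => ?_)
    have := hpt (r • (θ : Space))
    rw [norm_smul, norm_unitSphere, mul_one, Real.norm_of_nonneg hr.le] at this
    simp only [this, Pi.add_apply, Pi.smul_apply, Complex.coe_smul]
  exact (mul_eq_zero.1 h2).resolve_left (by positivity)

/-- A relation which is additive in both arguments and holds for pairs of eigenfunctions of
opposite sign holds between the two channels. -/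
lemma posSpan_negSpan_induction {P : (Space → Spinor) → (Space → Spinor) → Prop}
    (h : ∀ (l l' : ℤ) u v, 0 < l → l' < 0 → u ∈ eigenTest l → v ∈ eigenTest l' → P u v)
    (zl : ∀ v, IsTest v → P 0 v) (zr : ∀ u, IsTest u → P u 0)
    (al : ∀ u u' v, IsTest u → IsTest u' → IsTest v → P u v → P u' v → P (u + u') v)
    (ar : ∀ u v v', IsTest u → IsTest v → IsTest v' → P u v → P u v' → P u (v + v'))
    {u v : Space → Spinor} (hu : u ∈ posSpan) (hv : v ∈ negSpan) : P u v := by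
  have hvt := isTest_of_mem_negSpan hv
  refine (Submodule.iSup_induction (fun l : {l : ℤ // 0 < l} => eigenTest l)
    (motive := fun u => IsTest u ∧ P u v) hu ?_ ⟨IsTest.zero, zl v hvt⟩
    fun a b ha hb => ⟨ha.1.add hb.1, al a b v ha.1 hb.1 hvt ha.2 hb.2⟩).2
  intro l u hul
  refine ⟨hul.1, ?_⟩
  refine (Submodule.iSup_induction (fun l : {l : ℤ // l < 0} => eigenTest l)
    (motive := fun v => IsTest v ∧ P u v) hv ?_ ⟨IsTest.zero, zr u hul.1⟩
    fun a b ha hb => ⟨ha.1.add hb.1, ar u a b hul.1 ha.1 hb.1 ha.2 hb.2⟩).2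
  exact fun l' v hvl => ⟨hvl.1, h l l' u v l.2 l'.2 hul hvl⟩

lemma dirac_add_eq {u v : Space → Spinor} (hu : IsTest u) (hv : IsTest v) :
    dirac (u + v) = dirac u + dirac v := by
  funext x
  exact dirac_add (hu.differentiable x) (hv.differentiable x)

lemma dirac_zero : dirac (0 : Space → Spinor) = 0 := by
  funext x
  simp [dirac, partialDeriv, pauliDot_zero]

lemma sphereInt_inner_posSpan_negSpan {u v : Space → Spinor} (hu : u ∈ posSpan) (hv : v ∈ negSpan)
    {r : ℝ} (hr : 0 < r) : sphereInt (fun x => inner ℝ (u x) (v x)) r = 0 := by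
  refine posSpan_negSpan_induction
    (P := fun u v => sphereInt (fun x => inner ℝ (u x) (v x)) r = 0) ?_ ?_ ?_ ?_ ?_ hu hv
  · intro l l' u v hl hl' hu hv
    have : (l : ℝ) ≠ l' := by exact_mod_cast (hl'.trans hl).ne'
    exact sphereInt_inner_eq_zero hu.1 hv.1 hu.2.1 hv.2.1 this hr
  · intro v _; simp [sphereInt]
  · intro v _; simp [sphereInt]
  · intro u u' v hu hu' hv h1 h2
    rw [sphereInt_inner_add_left hu.continuous hu'.continuous hv.continuous, h1, h2, add_zero]
  · intro u v v' hu hv hv' h1 h2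
    rw [sphereInt_inner_comm] at h1 h2 ⊢
    rw [sphereInt_inner_add_left hv.continuous hv'.continuous hu.continuous, h1, h2, add_zero]

lemma sphereInt_inner_dirac_posSpan_negSpan {u v : Space → Spinor} (hu : u ∈ posSpan)
    (hv : v ∈ negSpan) {r : ℝ} (hr : 0 < r) :
    sphereInt (fun x => inner ℝ (dirac u x) (dirac v x)) r = 0 := by
  refine posSpan_negSpan_induction
    (P := fun u v => sphereInt (fun x => inner ℝ (dirac u x) (dirac v x)) r = 0)
    ?_ ?_ ?_ ?_ ?_ hu hv
  · exact fun l l' u v hl hl' hu hv =>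
      sphereInt_inner_dirac_eigenTest hu hv (hl'.trans hl).ne' hr
  · intro v _; simp [sphereInt, dirac_zero]
  · intro v _; simp [sphereInt, dirac_zero]
  · intro u u' v hu hu' hv h1 h2
    rw [dirac_add_eq hu hu', sphereInt_inner_add_left hu.dirac.continuous hu'.dirac.continuous
      hv.dirac.continuous, h1, h2, add_zero]
  · intro u v v' hu hv hv' h1 h2
    rw [sphereInt_inner_comm] at h1 h2 ⊢
    rw [dirac_add_eq hv hv', sphereInt_inner_add_left hv.dirac.continuous hv'.dirac.continuous
      hu.dirac.continuous, h1, h2, add_zero]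

lemma sphereInt_norm_sq_channels {u v : Space → Spinor} (hu : u ∈ posSpan) (hv : v ∈ negSpan)
    {r : ℝ} (hr : 0 < r) :
    sphereInt (fun x => ‖(u + v) x‖ ^ 2) r
      = sphereInt (fun x => ‖u x‖ ^ 2) r + sphereInt (fun x => ‖v x‖ ^ 2) r :=
  sphereInt_norm_sq_add (isTest_of_mem_posSpan hu).continuous
    (isTest_of_mem_negSpan hv).continuous r
    (sphereInt_inner_posSpan_negSpan hu hv hr)

lemma sphereInt_norm_sq_dirac_channels {u v : Space → Spinor} (hu : u ∈ posSpan) (hv : v ∈ negSpan)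
    {r : ℝ} (hr : 0 < r) :
    sphereInt (fun x => ‖dirac (u + v) x‖ ^ 2) r
      = sphereInt (fun x => ‖dirac u x‖ ^ 2) r + sphereInt (fun x => ‖dirac v x‖ ^ 2) r := by
  rw [dirac_add_eq (isTest_of_mem_posSpan hu) (isTest_of_mem_negSpan hv)]
  exact sphereInt_norm_sq_add (isTest_of_mem_posSpan hu).dirac.continuous
    (isTest_of_mem_negSpan hv).dirac.continuous r (sphereInt_inner_dirac_posSpan_negSpan hu hv hr)

/-! ### The spectral gap of `1 + σ · L` on spheres -/

lemma isTest_spinOrbit {u : Space → Spinor} (hu : IsTest u) : IsTest (spinOrbit u) := by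
  have : spinOrbit u = euler u + u - fun x => sigmaMul x (dirac u x) := by
    funext x
    simp [spinOrbit_eq]
  rw [this]
  exact (hu.euler.add hu).sub hu.dirac.sigmaMul

/-- On a finite sum of eigenfunctions, the quadratic form of `1 + σ · L` on a sphere is the sum of
the contributions of the eigenvalues. -/
lemma exists_sphereInt_spinOrbit {q : ℤ → Prop} {v : Space → Spinor}
    (hv : v ∈ ⨆ l : {l : ℤ // q l}, eigenTest l) {r : ℝ} (hr : 0 < r) :
    ∃ (s : Finset {l : ℤ // q l}) (a : {l : ℤ // q l} → ℝ), (∀ l, 0 ≤ a l) ∧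
      sphereInt (fun x => ‖v x‖ ^ 2) r = ∑ l ∈ s, a l ∧
      sphereInt (fun x => inner ℝ (spinOrbit v x) (v x)) r = ∑ l ∈ s, (l : ℝ) * a l := by
  obtain ⟨f, hf, rfl⟩ := (Submodule.mem_iSup_iff_exists_finsupp _ _).1 hv
  have hft : ∀ l, IsTest (f l) := fun l => (hf l).1
  have hK : ∀ x, spinOrbit (f.sum fun _ y => y) x = ∑ l ∈ f.support, (l : ℝ) • f l x := by
    intro x
    have h : ∀ s : Finset {l : ℤ // q l},
        spinOrbit (∑ l ∈ s, f l) x = ∑ l ∈ s, (l : ℝ) • f l x := by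
      intro s
      induction s using Finset.induction_on with
      | empty => simpa using spinOrbit_const_smul 0 (f := 0) (x := x) (differentiableAt_const _)
      | insert a s ha ih =>
        rw [Finset.sum_insert ha, Finset.sum_insert ha, spinOrbit_add
          ((hft a).differentiable x) ((IsTest.sum fun l _ => hft l).differentiable x), ih,
          (hf a).2.1]
    exact h _
  have hsum : ∀ x, (f.sum fun _ y => y) x = ∑ l ∈ f.support, f l x := fun x => by
    simp [Finsupp.sum]
  have hi : ∀ l l', Integrable (fun θ : UnitSphere =>
      inner ℝ (f l (r • (θ : Space))) (f l' (r • (θ : Space)))) sphereMeasure := fun l l' => by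
    have h1 := (hft l).continuous
    have h2 := (hft l').continuous
    exact integrable_sphere (by fun_prop)
  have horth : ∀ l l', l ≠ l' → ∫ θ : UnitSphere,
      inner ℝ (f l (r • (θ : Space))) (f l' (r • (θ : Space))) ∂sphereMeasure = 0 :=
    fun l l' hne => sphereInt_inner_eq_zero (hft l) (hft l') (hf l).2.1 (hf l').2.1
      (by exact_mod_cast fun h => hne (Subtype.ext h)) hr
  have hdouble : ∀ c : {l : ℤ // q l} → ℝ, sphereInt (fun x =>
      inner ℝ (∑ l ∈ f.support, c l • f l x) (∑ l ∈ f.support, f l x)) r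
      = ∑ l ∈ f.support, c l * sphereInt (fun x => ‖f l x‖ ^ 2) r := by
    intro c
    have hexp : ∀ x, inner ℝ (∑ l ∈ f.support, c l • f l x) (∑ l ∈ f.support, f l x)
        = ∑ l ∈ f.support, ∑ l' ∈ f.support, c l * inner ℝ (f l x) (f l' x) := fun x => by
      rw [sum_inner]
      simp only [inner_sum, real_inner_smul_left]
    simp only [sphereInt, hexp]
    rw [integral_finsetSum _ fun l _ => integrable_finsetSum _ fun l' _ => (hi l l').const_mul _]
    refine Finset.sum_congr rfl fun l hl => ?_
    rw [integral_finsetSum _ fun l' _ => (hi l l').const_mul _, Finset.sum_eq_single l]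
    · rw [integral_const_mul]
      simp only [real_inner_self_eq_norm_sq]
    · intro l' _ hne
      rw [integral_const_mul, horth l l' hne.symm, mul_zero]
    · exact fun h => absurd hl h
  refine ⟨f.support, fun l => sphereInt (fun x => ‖f l x‖ ^ 2) r,
    fun l => integral_nonneg fun θ => sq_nonneg _, ?_, ?_⟩
  · have := hdouble fun _ => 1
    simp only [one_smul, one_mul] at this
    rw [← this]
    simp only [hsum, real_inner_self_eq_norm_sq]
  · simp only [hK, hsum]
    exact hdouble fun l => (l : ℝ)

lemma le_sphereInt_spinOrbit_of_mem_posSpan {v : Space → Spinor} (hv : v ∈ posSpan) {r : ℝ}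
    (hr : 0 < r) : sphereInt (fun x => ‖v x‖ ^ 2) r
      ≤ sphereInt (fun x => inner ℝ (spinOrbit v x) (v x)) r := by
  obtain ⟨s, a, ha, h1, h2⟩ := exists_sphereInt_spinOrbit hv hr
  rw [h1, h2]
  refine Finset.sum_le_sum fun l _ => le_mul_of_one_le_left (ha l) ?_
  exact_mod_cast l.2

lemma sphereInt_spinOrbit_le_of_mem_negSpan {v : Space → Spinor} (hv : v ∈ negSpan) {r : ℝ}
    (hr : 0 < r) : sphereInt (fun x => inner ℝ (spinOrbit v x) (v x)) r
      ≤ -sphereInt (fun x => ‖v x‖ ^ 2) r := by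
  obtain ⟨s, a, ha, h1, h2⟩ := exists_sphereInt_spinOrbit hv hr
  rw [h1, h2, ← Finset.sum_neg_distrib]
  refine Finset.sum_le_sum fun l _ => ?_
  have : (l : ℝ) ≤ -1 := by exact_mod_cast (by have := l.2; omega : (l : ℤ) ≤ -1)
  nlinarith [ha l]

/-- Completion of the square, with the multiple `c v` of `v` on the sphere of radius `r`. -/
lemma sphereInt_dirac_ge {v : Space → Spinor} (hv : IsTest v) {r w : ℝ} (hr : 0 < r) (hw : 0 < w)
    (c : ℝ) :
    c * sphereInt (fun x => 2 * inner ℝ (v x) (radialDeriv v x)) r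
      + 2 * c / r * (sphereInt (fun x => ‖v x‖ ^ 2) r
        - sphereInt (fun x => inner ℝ (spinOrbit v x) (v x)) r)
      - w * c ^ 2 * sphereInt (fun x => ‖v x‖ ^ 2) r
    ≤ sphereInt (fun x => ‖dirac v x‖ ^ 2) r / w := by
  have hvc := hv.continuous
  have hec := hv.euler.continuous
  have hdc := hv.dirac.continuous
  have hKc := (isTest_spinOrbit hv).continuous
  have i1 : Integrable (fun θ : UnitSphere => ‖v (r • (θ : Space))‖ ^ 2) sphereMeasure :=
    integrable_sphere (by fun_prop)
  have i2 : Integrable (fun θ : UnitSphere =>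
      inner ℝ (spinOrbit v (r • (θ : Space))) (v (r • (θ : Space)))) sphereMeasure :=
    integrable_sphere (by fun_prop)
  have hrad : ∀ θ : UnitSphere,
      radialDeriv v (r • (θ : Space)) = r⁻¹ • euler v (r • (θ : Space)) := fun θ => by
    rw [radialDeriv, norm_smul, norm_unitSphere, mul_one, Real.norm_of_nonneg hr.le]
  have i3 : Integrable (fun θ : UnitSphere =>
      2 * inner ℝ (v (r • (θ : Space))) (radialDeriv v (r • (θ : Space)))) sphereMeasure := by
    simp only [hrad]
    exact integrable_sphere (by fun_prop)
  have i4 : Integrable (fun θ : UnitSphere => ‖dirac v (r • (θ : Space))‖ ^ 2) sphereMeasure :=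
    integrable_sphere (by fun_prop)
  have i5 : Integrable (fun θ : UnitSphere =>
      c * (2 * inner ℝ (v (r • (θ : Space))) (radialDeriv v (r • (θ : Space))))
      + 2 * c / r * (‖v (r • (θ : Space))‖ ^ 2
        - inner ℝ (spinOrbit v (r • (θ : Space))) (v (r • (θ : Space))))
      - w * c ^ 2 * ‖v (r • (θ : Space))‖ ^ 2) sphereMeasure :=
    ((i3.const_mul c).add ((i1.sub i2).const_mul (2 * c / r))).sub (i1.const_mul (w * c ^ 2))
  have i6 : Integrable (fun θ : UnitSphere =>
      c * (2 * inner ℝ (v (r • (θ : Space))) (radialDeriv v (r • (θ : Space))))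
      + 2 * c / r * (‖v (r • (θ : Space))‖ ^ 2
        - inner ℝ (spinOrbit v (r • (θ : Space))) (v (r • (θ : Space))))) sphereMeasure :=
    (i3.const_mul c).add ((i1.sub i2).const_mul (2 * c / r))
  have i7 : Integrable (fun θ : UnitSphere => 2 * c / r * (‖v (r • (θ : Space))‖ ^ 2
        - inner ℝ (spinOrbit v (r • (θ : Space))) (v (r • (θ : Space))))) sphereMeasure :=
    (i1.sub i2).const_mul (2 * c / r)
  simp only [sphereInt]
  rw [← integral_sub i1 i2, ← integral_const_mul, ← integral_const_mul, ← integral_const_mul,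
    ← integral_div, ← integral_add (i3.const_mul c) i7, ← integral_sub i6 (i1.const_mul _)]
  refine integral_mono i5 (i4.div_const w) fun θ => ?_
  simp only [hrad]
  set x := r • (θ : Space) with hx
  have hxn : ‖x‖ = r := by
    rw [hx, norm_smul, norm_unitSphere, mul_one, Real.norm_of_nonneg hr.le]
  have hd := norm_sq_mul_norm_sq_dirac v x
  rw [hxn] at hd
  set a := r⁻¹ • (euler v x + v x - spinOrbit v x) with ha
  have hda : ‖dirac v x‖ ^ 2 = ‖a‖ ^ 2 := by
    rw [ha, norm_smul, mul_pow, ← hd, norm_inv, Real.norm_of_nonneg hr.le]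
    field_simp
  have hia : inner ℝ a (v x) = r⁻¹ * (inner ℝ (v x) (euler v x) + ‖v x‖ ^ 2
      - inner ℝ (spinOrbit v x) (v x)) := by
    rw [ha, real_inner_smul_left, inner_sub_left, inner_add_left, real_inner_self_eq_norm_sq,
      real_inner_comm]
  have hsq : 0 ≤ ‖a - (w * c) • v x‖ ^ 2 := sq_nonneg _
  rw [norm_sub_sq_real, real_inner_smul_right, norm_smul (w * c), mul_pow ‖w * c‖,
      Real.norm_eq_abs, sq_abs,
    hia]
    at hsq
  rw [hda, real_inner_smul_right, le_div_iff₀ hw]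
  have : 2 * c / r = 2 * c * r⁻¹ := by ring
  rw [this]
  nlinarith

/-- The radial inequality in the positive channel. -/
lemma radial_ineq_posSpan {v : Space → Spinor} (hv : v ∈ posSpan) {r w t : ℝ} (hr : 0 < r)
    (hw : 0 < w) (ht : 0 ≤ t) :
    -t * sphereInt (fun x => 2 * inner ℝ (v x) (radialDeriv v x)) r
      - w * t ^ 2 * sphereInt (fun x => ‖v x‖ ^ 2) r
    ≤ sphereInt (fun x => ‖dirac v x‖ ^ 2) r / w := by
  have h1 := sphereInt_dirac_ge (isTest_of_mem_posSpan hv) hr hw (-t)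
  have h2 := le_sphereInt_spinOrbit_of_mem_posSpan hv hr
  have h3 : 0 ≤ 2 * -t / r * (sphereInt (fun x => ‖v x‖ ^ 2) r
        - sphereInt (fun x => inner ℝ (spinOrbit v x) (v x)) r) :=
    mul_nonneg_of_nonpos_of_nonpos (div_nonpos_of_nonpos_of_nonneg (by linarith) hr.le)
      (by linarith)
  rw [neg_sq] at h1
  linarith

/-- The radial inequality in the negative channel. -/
lemma radial_ineq_negSpan {v : Space → Spinor} (hv : v ∈ negSpan) {r w t : ℝ} (hr : 0 < r)
    (hw : 0 < w) (ht : 0 ≤ t) :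
    t * (sphereInt (fun x => 2 * inner ℝ (v x) (radialDeriv v x)) r
        + 4 / r * sphereInt (fun x => ‖v x‖ ^ 2) r)
      - w * t ^ 2 * sphereInt (fun x => ‖v x‖ ^ 2) r
    ≤ sphereInt (fun x => ‖dirac v x‖ ^ 2) r / w := by
  have h1 := sphereInt_dirac_ge (isTest_of_mem_negSpan hv) hr hw t
  have h2 := sphereInt_spinOrbit_le_of_mem_negSpan hv hr
  have h3 : 2 * t / r * (2 * sphereInt (fun x => ‖v x‖ ^ 2) r)
      ≤ 2 * t / r * (sphereInt (fun x => ‖v x‖ ^ 2) r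
        - sphereInt (fun x => inner ℝ (spinOrbit v x) (v x)) r) :=
    mul_le_mul_of_nonneg_left (by linarith) (by positivity)
  have h4 : 2 * t / r * (2 * sphereInt (fun x => ‖v x‖ ^ 2) r)
      = t * (4 / r * sphereInt (fun x => ‖v x‖ ^ 2) r) := by ring
  linarith

/-! ### The spectral projectors on test spinors -/

lemma spinOrbitEigenfunctions_inner_eq_zero {f g : L2Spinor}
    (hf : f ∈ spinOrbitEigenfunctions (Ioi 0)) (hg : g ∈ spinOrbitEigenfunctions (Iio 0)) :
    inner ℂ f g = 0 := by
  obtain ⟨Φ, hΦ1, hΦ2, hfΦ, l, hl, hΦ⟩ := hf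
  obtain ⟨Ψ, hΨ1, hΨ2, hgΨ, l', hl', hΨ⟩ := hg
  have hne : l ≠ l' := (lt_trans hl' hl).ne'
  have hint : ∀ {u v : Space → Spinor}, IsTest u → IsTest v →
      Integrable fun x => inner ℂ (u x) (v x) := fun {u v} hu hv => by
    refine (hu.continuous.inner hv.continuous).integrable_of_hasCompactSupport ?_
    refine hu.2.mono fun x hx => ?_
    simp only [Function.mem_support] at hx ⊢
    exact fun h => hx (by simp [h])
  have hre : ∀ a b : Spinor, inner ℝ a b = (inner ℂ a b).re := fun a b => by
    simp [PiLp.inner_apply]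
  have h1 : inner ℂ f g = ∫ x, inner ℂ (Φ x) (Ψ x) := by
    rw [L2.inner_def]
    refine integral_congr_ae ?_
    filter_upwards [hfΦ, hgΨ] with x h1 h2
    rw [h1, h2]
  have hΦt : IsTest Φ := ⟨hΦ1, hΦ2⟩
  have hΨt : IsTest Ψ := ⟨hΨ1, hΨ2⟩
  -- Orthogonality is known for the real inner product; applied to `Φ` and `i Φ` it gives the
  -- complex one.
  have key : ∀ u, IsTest u → (∀ x, spinOrbit u x = l • u x) →
      (∫ x, inner ℂ (u x) (Ψ x)).re = 0 := fun u hu hul => by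
    have h := integral_inner_eq_zero hu hΨt hul hΨ hne
    simp only [hre] at h
    rw [← h]
    exact (integral_re (hint hu hΨt)).symm
  rw [h1]
  apply Complex.ext
  · exact key Φ hΦt hΦ
  · have h2 := key (Complex.I • Φ) (hΦt.const_smul _) fun x => by
      rw [spinOrbit_const_smul _ (hΦt.differentiable x), hΦ, Pi.smul_apply, smul_comm]
    simp only [Pi.smul_apply, inner_smul_left, integral_const_mul] at h2
    simpa using h2

lemma isOrtho_spectralSpace : spectralSpace (Ioi 0) ⟂ spectralSpace (Iio 0) := by
  have h : Submodule.span ℂ (spinOrbitEigenfunctions (Ioi 0))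
      ⟂ Submodule.span ℂ (spinOrbitEigenfunctions (Iio 0)) :=
    Submodule.isOrtho_span.2 fun f hf g hg => spinOrbitEigenfunctions_inner_eq_zero hf hg
  unfold spectralSpace
  rw [Submodule.isOrtho_iff_le, Submodule.orthogonal_closure]
  exact Submodule.topologicalClosure_minimal _ h.le (Submodule.isClosed_orthogonal _)

lemma toLp_mem_spectralSpace {q : ℤ → Prop} {I : Set ℝ} (hI : ∀ l, q l → (l : ℝ) ∈ I)
    {v : Space → Spinor} (hv : v ∈ ⨆ l : {l : ℤ // q l}, eigenTest l) (hm : MemLp v 2 volume) :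
    hm.toLp v ∈ spectralSpace I := by
  have : IsTest v ∧ ∀ f : L2Spinor, f =ᵐ[volume] v → f ∈ spectralSpace I := by
    refine Submodule.iSup_induction (fun l : {l : ℤ // q l} => eigenTest l)
      (motive := fun v => IsTest v ∧ ∀ f : L2Spinor, f =ᵐ[volume] v → f ∈ spectralSpace I)
      hv ?_ ?_ ?_
    · intro l v hv
      refine ⟨hv.1, fun f hf => Submodule.le_topologicalClosure _ (Submodule.subset_span ?_)⟩
      exact ⟨v, hv.1.1, hv.1.2, hf, l, hI l l.2, hv.2.1⟩
    · refine ⟨IsTest.zero, fun f hf => ?_⟩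
      rw [(Lp.eq_zero_iff_ae_eq_zero).2 hf]
      exact Submodule.zero_mem _
    · intro u v ⟨hu, hu'⟩ ⟨hv, hv'⟩
      refine ⟨hu.add hv, fun f hf => ?_⟩
      have h1 := hu' _ (hu.memLp volume).coeFn_toLp
      have h2 := hv' _ (hv.memLp volume).coeFn_toLp
      have : f = (hu.memLp volume).toLp u + (hv.memLp volume).toLp v := by
        refine Lp.ext (hf.trans ?_)
        filter_upwards [Lp.coeFn_add ((hu.memLp volume).toLp u) ((hv.memLp volume).toLp v),
          (hu.memLp volume).coeFn_toLp, (hv.memLp volume).coeFn_toLp] with x h1 h2 h3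
        rw [h1, Pi.add_apply, Pi.add_apply, h2, h3]
      rw [this]
      exact Submodule.add_mem _ h1 h2
  exact this.2 _ hm.coeFn_toLp

lemma projPos_toLp_add {u v : Space → Spinor} (hu : u ∈ posSpan) (hv : v ∈ negSpan)
    (hum : MemLp u 2 volume) (hvm : MemLp v 2 volume) :
    projPos (hum.toLp u + hvm.toLp v) = hum.toLp u := by
  have h1 : hum.toLp u ∈ spectralSpace (Ioi 0) :=
    toLp_mem_spectralSpace (fun l hl => mem_Ioi.2 (by exact_mod_cast hl)) hu hum
  have h2 : hvm.toLp v ∈ spectralSpace (Iio 0) :=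
    toLp_mem_spectralSpace (fun l hl => mem_Iio.2 (by exact_mod_cast hl)) hv hvm
  refine (Submodule.eq_starProjection_of_mem_orthogonal h1 ?_)
  rw [add_sub_cancel_left]
  exact isOrtho_spectralSpace.symm.le h2

lemma projNeg_toLp_add {u v : Space → Spinor} (hu : u ∈ posSpan) (hv : v ∈ negSpan)
    (hum : MemLp u 2 volume) (hvm : MemLp v 2 volume) :
    projNeg (hum.toLp u + hvm.toLp v) = hvm.toLp v := by
  have h1 : hum.toLp u ∈ spectralSpace (Ioi 0) :=
    toLp_mem_spectralSpace (fun l hl => mem_Ioi.2 (by exact_mod_cast hl)) hu hum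
  have h2 : hvm.toLp v ∈ spectralSpace (Iio 0) :=
    toLp_mem_spectralSpace (fun l hl => mem_Iio.2 (by exact_mod_cast hl)) hv hvm
  refine (Submodule.eq_starProjection_of_mem_orthogonal h2 ?_)
  rw [add_sub_cancel_right]
  exact isOrtho_spectralSpace.le h1

/-! ### Approximation by polynomials -/

/-- A weak gradient, for spinor fields given as functions. -/
def IsWeakGradientFun (f : Space → Spinor) (F : Fin 3 → Space → Spinor) : Prop :=
  ∀ (j : Fin 3) (η : Space → ℝ), ContDiff ℝ ∞ η → HasCompactSupport η →
    ∫ x : Space, (fderiv ℝ η x (EuclideanSpace.single j 1)) • f x = - ∫ x : Space, η x • F j x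

/-- The polynomial spinor fields. -/
def polySpan : Submodule ℂ (Space → Spinor) := ⨆ n, homPoly n

lemma coord_smul_mem_polySpan {p : Space → Spinor} (hp : p ∈ polySpan) (k : Fin 3) :
    (fun x => x k • p x) ∈ polySpan := by
  refine Submodule.iSup_induction homPoly (motive := fun p => (fun x => x k • p x) ∈ polySpan) hp
    ?_ ?_ ?_
  · exact fun n p hp => Submodule.mem_iSup_of_mem (n + 1) (coord_smul_mem_homPoly hp k)
  · have : (fun x : Space => x k • (0 : Space → Spinor) x) = 0 := by funext x; simp
    rw [this]; exact Submodule.zero_mem _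
  · intro f g hf hg
    have : (fun x : Space => x k • (f + g) x) = (fun x => x k • f x) + fun x => x k • g x := by
      funext x; simp
    rw [this]; exact Submodule.add_mem _ hf hg

lemma const_mem_polySpan (ψ : Spinor) : (fun _ => ψ) ∈ polySpan :=
  Submodule.mem_iSup_of_mem 0 (Submodule.subset_span ⟨ψ, rfl⟩)

lemma real_smul_mem_polySpan {p : Space → Spinor} (hp : p ∈ polySpan) (c : ℝ) :
    (fun x => c • p x) ∈ polySpan := by
  have := Submodule.smul_mem _ (c : ℂ) hp
  have h : (c : ℂ) • p = fun x => c • p x := by funext x; simp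
  rwa [h] at this

lemma radial_smul_mem_eigenSpan {p : Space → Spinor} (hp : p ∈ polySpan) {h : ℝ → ℝ}
    (hh : ContDiff ℝ ∞ h) (hc : HasCompactSupport h) :
    (fun x => h (‖x‖ ^ 2) • p x) ∈ eigenSpan := by
  refine Submodule.iSup_induction homPoly
    (motive := fun p => (fun x => h (‖x‖ ^ 2) • p x) ∈ eigenSpan) hp ?_ ?_ ?_
  · exact fun n p hp => radial_smul_homPoly_mem_eigenSpan hp hh hc
  · have : (fun x : Space => h (‖x‖ ^ 2) • (0 : Space → Spinor) x) = 0 := by funext x; simp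
    rw [this]; exact Submodule.zero_mem _
  · intro f g hf hg
    have : (fun x : Space => h (‖x‖ ^ 2) • (f + g) x)
        = (fun x => h (‖x‖ ^ 2) • f x) + fun x => h (‖x‖ ^ 2) • g x := by funext x; simp
    rw [this]; exact Submodule.add_mem _ hf hg

lemma integrable_continuous_smul {A : ℝ} {f : Space → Spinor} (hf : Integrable f)
    (hA : ∀ x, A < ‖x‖ → f x = 0) {g : Space → ℝ} (hg : Continuous g) :
    Integrable fun x => g x • f x := by
  obtain ⟨C, hC⟩ := (isCompact_closedBall (0 : Space) A).exists_bound_of_continuousOn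
    hg.continuousOn
  refine (hf.norm.const_mul C).mono' (hg.aestronglyMeasurable.smul hf.aestronglyMeasurable)
    (ae_of_all _ fun x => ?_)
  rcases le_or_gt ‖x‖ A with h | h
  · rw [norm_smul]
    exact mul_le_mul_of_nonneg_right (hC x (mem_closedBall_zero_iff.2 h)) (norm_nonneg _)
  · simp [hA x h]

/-- Convolution with a power of the polynomial `1 - c |x|²` produces polynomials. -/
lemma integral_pow_smul_mem_polySpan (c A : ℝ) (n : ℕ) : ∀ {f : Space → Spinor}, Integrable f →
    (∀ x, A < ‖x‖ → f x = 0) →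
    (fun x => ∫ y, (1 - c * ‖x - y‖ ^ 2) ^ n • f y) ∈ polySpan := by
  induction n with
  | zero =>
    intro f hf hA
    simpa using const_mem_polySpan (∫ y, f y)
  | succ n ih =>
    intro f hf hA
    have hcont : ∀ x : Space, Continuous fun y : Space => (1 - c * ‖x - y‖ ^ 2) ^ n := fun x => by
      fun_prop
    have hj : ∀ j : Fin 3, Integrable fun y : Space => y j • f y := fun j =>
      integrable_continuous_smul hf hA (by fun_prop)
    have hN : Integrable fun y : Space => ‖y‖ ^ 2 • f y :=
      integrable_continuous_smul hf hA (by fun_prop)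
    have hjA : ∀ j : Fin 3, ∀ x : Space, A < ‖x‖ → x j • f x = 0 := fun j x hx => by simp [hA x hx]
    have hNA : ∀ x : Space, A < ‖x‖ → ‖x‖ ^ 2 • f x = 0 := fun x hx => by simp [hA x hx]
    have h0 := ih hf hA
    have h1 := fun j => coord_smul_mem_polySpan (ih (hj j) (hjA j)) j
    have h2 := ih hN hNA
    have h3 := fun j => coord_smul_mem_polySpan (coord_smul_mem_polySpan h0 j) j
    -- Expand one factor, `|x - y|² = |x|² - 2 x · y + |y|²`.
    have key : (fun x => ∫ y, (1 - c * ‖x - y‖ ^ 2) ^ (n + 1) • f y)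
        = (fun x => ∫ y, (1 - c * ‖x - y‖ ^ 2) ^ n • f y)
          + (∑ j, fun x : Space => (-c) • (x j • (x j • ∫ y, (1 - c * ‖x - y‖ ^ 2) ^ n • f y)))
          + (∑ j, fun x : Space => (2 * c) • (x j • ∫ y, (1 - c * ‖x - y‖ ^ 2) ^ n • (y j • f y)))
          + fun x => (-c) • ∫ y, (1 - c * ‖x - y‖ ^ 2) ^ n • (‖y‖ ^ 2 • f y) := by
      funext x
      simp only [Pi.add_apply, Finset.sum_apply]
      have i0 := integrable_continuous_smul hf hA (hcont x)
      have i1 := fun j => integrable_continuous_smul (hj j) (hjA j) (hcont x)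
      have i2 := integrable_continuous_smul hN hNA (hcont x)
      simp only [← integral_smul]
      have i0' : ∀ j, Integrable fun y => (-c) •
          (x j • (x j • ((1 - c * ‖x - y‖ ^ 2) ^ n • f y))) :=
        fun j => ((i0.smul (x j)).smul (x j)).smul (-c)
      have i1' : ∀ j, Integrable fun y =>
          (2 * c) • (x j • ((1 - c * ‖x - y‖ ^ 2) ^ n • (y j • f y))) :=
        fun j => ((i1 j).smul (x j)).smul (2 * c)
      have i2' : Integrable fun y => (-c) • ((1 - c * ‖x - y‖ ^ 2) ^ n • (‖y‖ ^ 2 • f y)) :=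
        i2.smul (-c)
      rw [← integral_finsetSum _ fun j _ => i0' j, ← integral_finsetSum _ fun j _ => i1' j]
      have i3 : Integrable fun y => ∑ j, (-c) • (x j • (x j • ((1 - c * ‖x - y‖ ^ 2) ^ n • f y))) :=
        integrable_finsetSum _ fun j _ => i0' j
      have i4 : Integrable fun y =>
          ∑ j, (2 * c) • (x j • ((1 - c * ‖x - y‖ ^ 2) ^ n • (y j • f y))) :=
        integrable_finsetSum _ fun j _ => i1' j
      have i03 : Integrable fun y => (1 - c * ‖x - y‖ ^ 2) ^ n • f y
          + ∑ j, (-c) • (x j • (x j • ((1 - c * ‖x - y‖ ^ 2) ^ n • f y))) := i0.add i3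
      have i034 : Integrable fun y => (1 - c * ‖x - y‖ ^ 2) ^ n • f y
          + ∑ j, (-c) • (x j • (x j • ((1 - c * ‖x - y‖ ^ 2) ^ n • f y)))
          + ∑ j, (2 * c) • (x j • ((1 - c * ‖x - y‖ ^ 2) ^ n • (y j • f y))) := i03.add i4
      rw [← integral_add i0 i3, ← integral_add i03 i4, ← integral_add i034 i2']
      refine integral_congr_ae (ae_of_all _ fun y => ?_)
      simp only [Fin.sum_univ_three, smul_smul, ← add_smul]
      congr 1
      have e1 := norm_sq_space (x - y)
      have e2 := norm_sq_space y
      simp only [PiLp.sub_apply] at e1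
      rw [pow_succ]
      generalize (1 - c * ‖x - y‖ ^ 2) ^ n = B
      rw [e1, e2]
      ring
    rw [key]
    refine Submodule.add_mem _ (Submodule.add_mem _ (Submodule.add_mem _ h0 ?_) ?_)
      (real_smul_mem_polySpan h2 _)
    · exact Submodule.sum_mem _ fun j _ => real_smul_mem_polySpan (h3 j) _
    · exact Submodule.sum_mem _ fun j _ => real_smul_mem_polySpan (h1 j) _

/-! ### Mollification -/

/-- The convolution of `f` with a scalar kernel. -/
def mollify (κ : Space → ℝ) (f : Space → Spinor) (x : Space) : Spinor := ∫ z, κ z • f (x - z)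

lemma mollify_eq (κ : Space → ℝ) (f : Space → Spinor) (x : Space) :
    mollify κ f x = ∫ y, κ (x - y) • f y := by
  rw [mollify, ← integral_sub_left_eq_self _ _ x]
  simp

lemma hasFDerivAt_mollify {κ : Space → ℝ} (hκ : ContDiff ℝ ∞ κ) (hc : HasCompactSupport κ)
    {f : Space → Spinor} (hf : Integrable f) (x : Space) :
    DifferentiableAt ℝ (mollify κ f) x ∧ ∀ j, partialDeriv j (mollify κ f) x
      = ∫ y, (fderiv ℝ κ (x - y) (EuclideanSpace.single j 1)) • f y := by
  have h := hc.hasFDerivAt_convolution_left (ContinuousLinearMap.lsmul ℝ ℝ)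
    (hκ.of_le (by exact_mod_cast le_top)) hf.locallyIntegrable x (μ := volume)
  have h' : HasFDerivAt (mollify κ f) _ x := h
  refine ⟨h'.differentiableAt, fun j => ?_⟩
  have hfc : HasCompactSupport (fderiv ℝ κ) := hc.fderiv (𝕜 := ℝ)
  have hex := hfc.convolutionExists_left ((ContinuousLinearMap.lsmul ℝ ℝ).precompL Space)
    (hκ.continuous_fderiv (by simp)) hf.locallyIntegrable x (μ := volume)
  rw [partialDeriv, h'.fderiv, convolution_def, ContinuousLinearMap.integral_apply hex,
    ← integral_sub_left_eq_self _ _ x]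
  simp

/-- Convolution turns a weak gradient into a classical one. -/
lemma partialDeriv_mollify {κ : Space → ℝ} (hκ : ContDiff ℝ ∞ κ) (hc : HasCompactSupport κ)
    {f : Space → Spinor} {F : Fin 3 → Space → Spinor} (hf : Integrable f)
    (h : IsWeakGradientFun f F) (j : Fin 3) (x : Space) :
    partialDeriv j (mollify κ f) x = mollify κ (F j) x := by
  rw [(hasFDerivAt_mollify hκ hc hf x).2 j, mollify_eq]
  have hη : ContDiff ℝ ∞ fun y => κ (x - y) := hκ.comp (contDiff_const.sub contDiff_id)
  have hηc : HasCompactSupport fun y => κ (x - y) :=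
    hc.comp_homeomorph (Homeomorph.subLeft x)
  have h1 := h j _ hη hηc
  have h2 : ∀ y, fderiv ℝ (fun y => κ (x - y)) y (EuclideanSpace.single j 1)
      = -fderiv ℝ κ (x - y) (EuclideanSpace.single j 1) := fun y => by
    have h3 : HasFDerivAt (fun y : Space => x - y) (-ContinuousLinearMap.id ℝ Space) y := by
      simpa using (hasFDerivAt_id y).const_sub x
    have h4 := ((hκ.differentiable (by simp) (x - y)).hasFDerivAt).comp y h3
    rw [show (fun y => κ (x - y)) = κ ∘ fun y => x - y from rfl, h4.fderiv]
    simp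
  simp only [h2, neg_smul, integral_neg, neg_inj] at h1
  exact h1

/-- The Cauchy–Schwarz inequality with a weight. -/
lemma sq_lintegral_mul_le {α : Type*} [MeasurableSpace α] (μ : Measure α) {k h : α → ℝ≥0∞}
    (hk : AEMeasurable k μ) (hh : AEMeasurable h μ) :
    (∫⁻ a, k a * h a ∂μ) ^ 2 ≤ (∫⁻ a, k a ∂μ) * ∫⁻ a, k a * h a ^ 2 ∂μ := by
  have hconj : (2 : ℝ).HolderConjugate 2 := Real.HolderConjugate.two_two
  have hs : ∀ a : ℝ≥0∞, (a ^ (1 / 2 : ℝ)) ^ (2 : ℝ) = a := fun a => by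
    rw [← ENNReal.rpow_mul]; norm_num
  have h1 := ENNReal.lintegral_mul_le_Lp_mul_Lq μ hconj (f := fun a => k a ^ (1 / 2 : ℝ))
    (g := fun a => k a ^ (1 / 2 : ℝ) * h a) (hk.pow_const _) ((hk.pow_const _).mul hh)
  have h2 : ∀ a, ((fun a => k a ^ (1 / 2 : ℝ)) * fun a => k a ^ (1 / 2 : ℝ) * h a) a
      = k a * h a := fun a => by
    simp only [Pi.mul_apply]
    rw [← mul_assoc, ← ENNReal.rpow_add_of_nonneg _ _ (by norm_num) (by norm_num)]
    norm_num
  simp only [h2, hs, ENNReal.mul_rpow_of_nonneg _ _ (zero_le_two : (0 : ℝ) ≤ 2)] at h1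
  calc (∫⁻ a, k a * h a ∂μ) ^ 2
      ≤ ((∫⁻ a, k a ∂μ) ^ (1 / 2 : ℝ) * (∫⁻ a, k a * h a ^ (2 : ℝ) ∂μ) ^ (1 / 2 : ℝ)) ^ 2 := by
        gcongr
    _ = _ := by
        rw [mul_pow, ← ENNReal.rpow_natCast, ← ENNReal.rpow_natCast, Nat.cast_ofNat, hs, hs]
        simp only [ENNReal.rpow_ofNat]

lemma eLpNorm_two_sq {α : Type*} [MeasurableSpace α] (μ : Measure α) {E : Type*}
    [NormedAddCommGroup E] (f : α → E) : eLpNorm f 2 μ ^ 2 = ∫⁻ x, ‖f x‖ₑ ^ 2 ∂μ := by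
  have := eLpNorm_nnreal_pow_eq_lintegral (f := f) (μ := μ) (p := 2) (by norm_num)
  have h2 : ((2 : NNReal) : ℝ) = (2 : ℕ) := by norm_num
  rw [h2] at this
  simpa only [ENNReal.rpow_natCast, ENNReal.coe_ofNat] using this

lemma tendsto_eLpNorm_two_iff {α ι : Type*} [MeasurableSpace α] {μ : Measure α} {E : Type*}
    [NormedAddCommGroup E] {f : ι → α → E} {l : Filter ι} :
    Tendsto (fun i => eLpNorm (f i) 2 μ) l (𝓝 0)
      ↔ Tendsto (fun i => ∫⁻ x, ‖f i x‖ₑ ^ 2 ∂μ) l (𝓝 0) := by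
  simp only [← eLpNorm_two_sq]
  constructor
  · intro h
    have := (ENNReal.continuous_pow 2).tendsto 0 |>.comp h
    rw [zero_pow two_ne_zero] at this
    exact this
  · intro h
    have := (ENNReal.continuous_rpow_const (y := (1 / 2 : ℝ))).tendsto 0 |>.comp h
    have h0 : (0 : ℝ≥0∞) ^ (1 / 2 : ℝ) = 0 := by norm_num
    rw [h0] at this
    refine this.congr fun i => ?_
    simp only [Function.comp_apply]
    rw [← ENNReal.rpow_natCast, ← ENNReal.rpow_mul]
    norm_num

/-- The integral `∫ |ψ(z) f(x - z) - f(x)|² dx` depends continuously on `z`. -/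
lemma exists_continuous_translation_error {f : Space → Spinor} (hf : MemLp f 2 volume)
    {ψ : Space → ℝ} (hψ : Continuous ψ) :
    ∃ G : Space → ℝ, Continuous G ∧ (∀ z, 0 ≤ G z) ∧ (ψ 0 = 1 → G 0 = 0) ∧
      ∀ z, ∫⁻ x, ‖ψ z • f (x - z) - f x‖ₑ ^ 2 = ENNReal.ofReal (G z) := by
  have : Fact ((2 : ℝ≥0∞) ≠ ⊤) := ⟨by simp⟩
  set T : Space → L2Spinor := fun z => (DomAddAct.mk (-z) +ᵥ hf.toLp f) with hT
  have hTc : Continuous T := by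
    have : Continuous fun z : Space => DomAddAct.mk (-z) :=
      DomAddAct.mkHomeomorph.continuous.comp continuous_neg
    exact this.vadd continuous_const
  refine ⟨fun z => ‖ψ z • T z - hf.toLp f‖ ^ 2, by fun_prop, fun z => sq_nonneg _, fun h0 => ?_,
    fun z => ?_⟩
  · have : T 0 = hf.toLp f := by
      simp [hT]
    simp [h0, this]
  · have h1 : ψ z • T z - hf.toLp f =ᵐ[volume] fun x => ψ z • f (x - z) - f x := by
      have h2 : T z =ᵐ[volume] fun x => f (x - z) := by
        simp only [hT, DomAddAct.mk_vadd_toLp]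
        refine (MemLp.coeFn_toLp _).trans (ae_of_all _ fun x => ?_)
        simp [sub_eq_neg_add]
      filter_upwards [Lp.coeFn_sub (ψ z • T z) (hf.toLp f), Lp.coeFn_smul (ψ z) (T z), h2,
        hf.coeFn_toLp] with x a1 a2 a3 a4
      rw [a1, Pi.sub_apply, a2, Pi.smul_apply, a3, a4]
    have h3 : ENNReal.ofReal (‖ψ z • T z - hf.toLp f‖ ^ 2)
        = eLpNorm (ψ z • T z - hf.toLp f : L2Spinor) 2 volume ^ 2 := by
      rw [ENNReal.ofReal_pow (norm_nonneg _), ← Lp.enorm_def, ofReal_norm]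
    rw [h3, eLpNorm_congr_ae h1, eLpNorm_two_sq]

/-- The integral of the kernel `(1 - |z|²/ρ²)^n` over the ball of radius `ρ`. -/
def landauMass (ρ : ℝ) (n : ℕ) : ℝ :=
  ∫ z in Metric.closedBall (0 : Space) ρ, (1 - (ρ ^ 2)⁻¹ * ‖z‖ ^ 2) ^ n

/-- The Landau kernel, cut off smoothly by `ψ`. -/
def landauKernel (ρ : ℝ) (ψ : Space → ℝ) (n : ℕ) (z : Space) : ℝ :=
  (landauMass ρ n)⁻¹ * (ψ z * (1 - (ρ ^ 2)⁻¹ * ‖z‖ ^ 2) ^ n)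

lemma one_sub_sq_nonneg {ρ : ℝ} (hρ : 0 < ρ) {z : Space}
    (hz : z ∈ Metric.closedBall (0 : Space) ρ) :
    0 ≤ 1 - (ρ ^ 2)⁻¹ * ‖z‖ ^ 2 := by
  have hz' : ‖z‖ ≤ ρ := mem_closedBall_zero_iff.1 hz
  rw [sub_nonneg, inv_mul_le_iff₀ (by positivity), mul_one]
  exact pow_le_pow_left₀ (norm_nonneg _) hz' 2

lemma landauMass_pos {ρ : ℝ} (hρ : 0 < ρ) (n : ℕ) : 0 < landauMass ρ n := by
  have hc : Continuous fun z : Space => (1 - (ρ ^ 2)⁻¹ * ‖z‖ ^ 2) ^ n := by fun_prop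
  have hs := isCompact_closedBall (0 : Space) ρ
  rw [landauMass, setIntegral_pos_iff_support_of_nonneg_ae]
  · have hsub : Metric.ball (0 : Space) ρ ⊆
        Function.support (fun z : Space => (1 - (ρ ^ 2)⁻¹ * ‖z‖ ^ 2) ^ n)
          ∩ Metric.closedBall (0 : Space) ρ := by
      intro z hz
      refine ⟨?_, Metric.ball_subset_closedBall hz⟩
      have hz' : ‖z‖ < ρ := mem_ball_zero_iff.1 hz
      have : 0 < 1 - (ρ ^ 2)⁻¹ * ‖z‖ ^ 2 := by
        rw [sub_pos, inv_mul_lt_iff₀ (by positivity), mul_one]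
        exact pow_lt_pow_left₀ hz' (norm_nonneg _) two_ne_zero
      exact (pow_pos this n).ne'
    exact lt_of_lt_of_le (Metric.measure_ball_pos _ _ hρ) (measure_mono hsub)
  · exact (ae_restrict_iff' hs.measurableSet).2
      (ae_of_all _ fun z hz => pow_nonneg (one_sub_sq_nonneg hρ hz) n)
  · exact hc.continuousOn.integrableOn_compact hs

lemma continuous_landauBase (ρ : ℝ) : Continuous fun z : Space => 1 - (ρ ^ 2)⁻¹ * ‖z‖ ^ 2 := by
  fun_prop

lemma lintegral_landau_pow {ρ : ℝ} (hρ : 0 < ρ) (n : ℕ) :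
    ∫⁻ z in Metric.closedBall (0 : Space) ρ, ENNReal.ofReal ((1 - (ρ ^ 2)⁻¹ * ‖z‖ ^ 2) ^ n)
      = ENNReal.ofReal (landauMass ρ n) := by
  have hsc := isCompact_closedBall (0 : Space) ρ
  rw [landauMass, ofReal_integral_eq_lintegral_ofReal]
  · exact ((continuous_landauBase ρ).pow n).continuousOn.integrableOn_compact hsc
  · exact (ae_restrict_iff' hsc.measurableSet).2
      (ae_of_all _ fun z hz => pow_nonneg (one_sub_sq_nonneg hρ hz) n)

/-- The error of the mollification is at most the average, against the Landau weight, of the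
translation errors of `f`; the cutoff `ψ` is kept inside the latter. -/
lemma enorm_mollify_landau_sub_le {ρ : ℝ} (hρ : 0 < ρ) {ψ : Space → ℝ} (hψ : Continuous ψ)
    (hψs : ∀ z, ρ < ‖z‖ → ψ z = 0) {f : Space → Spinor} (hfi : Integrable f) (n : ℕ) (x : Space) :
    ‖mollify (landauKernel ρ ψ n) f x - f x‖ₑ
      ≤ ENNReal.ofReal (landauMass ρ n)⁻¹ * ∫⁻ z in Metric.closedBall (0 : Space) ρ,
        ENNReal.ofReal ((1 - (ρ ^ 2)⁻¹ * ‖z‖ ^ 2) ^ n) * ‖ψ z • f (x - z) - f x‖ₑ := by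
  have hI := landauMass_pos hρ n
  have hsc := isCompact_closedBall (0 : Space) ρ
  have hbc : Continuous fun z : Space => (1 - (ρ ^ 2)⁻¹ * ‖z‖ ^ 2) ^ n :=
    (continuous_landauBase ρ).pow n
  have hb0 : ∀ z ∈ Metric.closedBall (0 : Space) ρ, 0 ≤ (1 - (ρ ^ 2)⁻¹ * ‖z‖ ^ 2) ^ n :=
    fun z hz => pow_nonneg (one_sub_sq_nonneg hρ hz) n
  have e2 : f x = (landauMass ρ n)⁻¹ •
      ∫ z in Metric.closedBall (0 : Space) ρ, (1 - (ρ ^ 2)⁻¹ * ‖z‖ ^ 2) ^ n • f x := by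
    rw [integral_smul_const, smul_smul]
    change f x = ((landauMass ρ n)⁻¹ * landauMass ρ n) • f x
    rw [inv_mul_cancel₀ hI.ne', one_smul]
  have hker : ∀ z, landauKernel ρ ψ n z
      = (landauMass ρ n)⁻¹ * (ψ z * (1 - (ρ ^ 2)⁻¹ * ‖z‖ ^ 2) ^ n) := fun z => rfl
  generalize landauMass ρ n = I at *
  generalize hbn : (fun z : Space => (1 - (ρ ^ 2)⁻¹ * ‖z‖ ^ 2) ^ n) = b at *
  have hbz : ∀ z : Space, (1 - (ρ ^ 2)⁻¹ * ‖z‖ ^ 2) ^ n = b z := fun z => by rw [← hbn]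
  simp only [hbz] at *
  generalize landauKernel ρ ψ n = κ at *
  generalize hs : Metric.closedBall (0 : Space) ρ = s at *
  have hfx : Integrable fun z => f (x - z) := hfi.comp_sub_left x
  have hbψ : Continuous fun z => b z * ψ z := hbc.mul hψ
  obtain ⟨C, hC⟩ := hsc.exists_bound_of_continuousOn hbψ.continuousOn
  have i1 : IntegrableOn (fun z => (b z * ψ z) • f (x - z)) s := by
    refine (hfx.norm.const_mul C).integrableOn.mono'
      (hbψ.aestronglyMeasurable.smul hfx.aestronglyMeasurable).restrict ?_
    refine (ae_restrict_iff' hsc.measurableSet).2 (ae_of_all _ fun z hz => ?_)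
    rw [norm_smul]
    exact mul_le_mul_of_nonneg_right (hC z hz) (norm_nonneg _)
  have i2 : IntegrableOn (fun z => b z • f x) s :=
    (hbc.smul continuous_const).continuousOn.integrableOn_compact hsc
  have e1 : mollify κ f x = I⁻¹ • ∫ z in s, (b z * ψ z) • f (x - z) := by
    rw [mollify, ← integral_smul, ← setIntegral_eq_integral_of_forall_compl_eq_zero (s := s)]
    · refine setIntegral_congr_fun hsc.measurableSet fun z _ => ?_
      simp only [hker, smul_smul]
      congr 1
      ring
    · intro z hz
      have : ρ < ‖z‖ := by simpa [← hs] using hz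
      simp [hker, hψs z this]
  have e3 : mollify κ f x - f x = I⁻¹ • ∫ z in s, b z • (ψ z • f (x - z) - f x) := by
    rw [e1]
    conv_lhs => rw [e2]
    rw [← smul_sub, ← integral_sub i1 i2]
    simp only [smul_sub, smul_smul]
  rw [e3, enorm_smul, Real.enorm_of_nonneg (inv_nonneg.2 hI.le)]
  gcongr
  refine (enorm_integral_le_lintegral_enorm _).trans (le_of_eq ?_)
  refine setLIntegral_congr_fun hsc.measurableSet fun z hz => ?_
  simp only [enorm_smul]
  rw [Real.enorm_of_nonneg (hb0 z hz)]

lemma measurable_enorm_translation_error {ψ : Space → ℝ} (hψ : Continuous ψ)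
    {f : Space → Spinor} (hfm : StronglyMeasurable f) :
    Measurable fun p : Space × Space => ‖ψ p.2 • f (p.1 - p.2) - f p.1‖ₑ := by
  have hf := hfm.measurable
  have h0 : Measurable fun p : Space × Space => ψ p.2 := hψ.measurable.comp measurable_snd
  have h1 : Measurable fun p : Space × Space => f (p.1 - p.2) :=
    hf.comp (measurable_fst.sub measurable_snd)
  have h2 : Measurable fun p : Space × Space => f p.1 := hf.comp measurable_fst
  have h3 : Measurable fun p : Space × Space => ψ p.2 • f (p.1 - p.2) := h0.smul h1
  have h4 : Measurable fun p : Space × Space => ψ p.2 • f (p.1 - p.2) - f p.1 := h3.sub h2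
  exact h4.enorm

lemma measurable_enorm_translation_error_right {ψ : Space → ℝ} (hψ : Continuous ψ)
    {f : Space → Spinor} (hfm : StronglyMeasurable f) (x : Space) :
    Measurable fun z : Space => ‖ψ z • f (x - z) - f x‖ₑ := by
  have h1 : Measurable fun z : Space => f (x - z) :=
      hfm.measurable.comp (measurable_const.sub measurable_id)
  have h3 : Measurable fun z : Space => ψ z • f (x - z) := hψ.measurable.smul h1
  have h4 : Measurable fun z : Space => ψ z • f (x - z) - f x := h3.sub_const _
  exact h4.enorm

/-- Jensen's inequality for a weighted average of `ψ(z) f(x - z) - f(x)` over `z`, integrated in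
`x`. -/
lemma lintegral_sq_le_of_average {s : Set Space} (hsc : IsCompact s) {b ψ : Space → ℝ}
    (hbc : Continuous b) (hb0 : ∀ z ∈ s, 0 ≤ b z) {I : ℝ} (hI : 0 < I)
    (hkI : ∫⁻ z in s, ENNReal.ofReal (b z) = ENNReal.ofReal I) (hψ : Continuous ψ)
    {f g : Space → Spinor} (hfm : StronglyMeasurable f)
    (hpt : ∀ x, ‖g x‖ₑ ≤ ENNReal.ofReal I⁻¹ *
      ∫⁻ z in s, ENNReal.ofReal (b z) * ‖ψ z • f (x - z) - f x‖ₑ)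
    {G : Space → ℝ} (hGc : Continuous G) (hG0 : ∀ z, 0 ≤ G z)
    (hG : ∀ z, ∫⁻ x, ‖ψ z • f (x - z) - f x‖ₑ ^ 2 = ENNReal.ofReal (G z)) :
    ∫⁻ x, ‖g x‖ₑ ^ 2 ≤ ENNReal.ofReal (I⁻¹ • ∫ z in s, b z • G z) := by
  have hkm : Measurable fun z => ENNReal.ofReal (b z) := hbc.measurable.ennreal_ofReal
  have hE := measurable_enorm_translation_error hψ hfm
  have hEx : ∀ x, Measurable fun z => ‖ψ z • f (x - z) - f x‖ₑ := fun x =>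
    measurable_enorm_translation_error_right hψ hfm x
  calc ∫⁻ x, ‖g x‖ₑ ^ 2
      ≤ ∫⁻ x, ENNReal.ofReal I⁻¹
          * ∫⁻ z in s, ENNReal.ofReal (b z) * ‖ψ z • f (x - z) - f x‖ₑ ^ 2 := by
        refine lintegral_mono fun x => ?_
        calc ‖g x‖ₑ ^ 2
            ≤ (ENNReal.ofReal I⁻¹
                * ∫⁻ z in s, ENNReal.ofReal (b z) * ‖ψ z • f (x - z) - f x‖ₑ) ^ 2 := by
              gcongr; exact hpt x
          _ ≤ ENNReal.ofReal I⁻¹ ^ 2 * (ENNReal.ofReal I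
                * ∫⁻ z in s, ENNReal.ofReal (b z) * ‖ψ z • f (x - z) - f x‖ₑ ^ 2) := by
              rw [mul_pow, ← hkI]
              gcongr
              exact sq_lintegral_mul_le _ hkm.aemeasurable (hEx x).aemeasurable
          _ = ENNReal.ofReal I⁻¹
                * ∫⁻ z in s, ENNReal.ofReal (b z) * ‖ψ z • f (x - z) - f x‖ₑ ^ 2 := by
              rw [sq, ← mul_assoc, mul_assoc (ENNReal.ofReal I⁻¹),
                ← ENNReal.ofReal_mul (inv_nonneg.2 hI.le), inv_mul_cancel₀ hI.ne',
                ENNReal.ofReal_one, mul_one]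
    _ = ENNReal.ofReal I⁻¹
          * ∫⁻ z in s, ∫⁻ x, ENNReal.ofReal (b z) * ‖ψ z • f (x - z) - f x‖ₑ ^ 2 := by
        rw [lintegral_const_mul' _ _ ENNReal.ofReal_ne_top, lintegral_lintegral_swap]
        exact ((hkm.comp measurable_snd).mul (hE.pow_const 2)).aemeasurable
    _ = ENNReal.ofReal I⁻¹ * ∫⁻ z in s, ENNReal.ofReal (b z • G z) := by
        congr 1
        refine setLIntegral_congr_fun hsc.measurableSet fun z hz => ?_
        rw [lintegral_const_mul' _ _ ENNReal.ofReal_ne_top, hG,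
          ← ENNReal.ofReal_mul (hb0 z hz), smul_eq_mul]
    _ = ENNReal.ofReal (I⁻¹ • ∫ z in s, b z • G z) := by
        rw [smul_eq_mul, ENNReal.ofReal_mul (inv_nonneg.2 hI.le),
          ofReal_integral_eq_lintegral_ofReal]
        · exact (hbc.smul hGc).continuousOn.integrableOn_compact hsc
        · exact (ae_restrict_iff' hsc.measurableSet).2 (ae_of_all _ fun z hz =>
            mul_nonneg (hb0 z hz) (hG0 z))

/-- Convolution with the Landau kernels converges to the identity in `L²`. -/
lemma tendsto_landau {ρ : ℝ} (hρ : 0 < ρ) {ψ : Space → ℝ} (hψ : Continuous ψ) (hψ0 : ψ 0 = 1)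
    (hψs : ∀ z, ρ < ‖z‖ → ψ z = 0) {f : Space → Spinor} (hfm : StronglyMeasurable f)
    (hf : MemLp f 2 volume) (hfi : Integrable f) :
    Tendsto (fun n => eLpNorm (fun x => mollify (landauKernel ρ ψ n) f x - f x) 2 volume) atTop
      (𝓝 0) := by
  obtain ⟨G, hGc, hG0, hG1, hG⟩ := exists_continuous_translation_error hf hψ
  have hpeak : Tendsto (fun n : ℕ => (landauMass ρ n)⁻¹ •
      ∫ z in Metric.closedBall (0 : Space) ρ, (1 - (ρ ^ 2)⁻¹ * ‖z‖ ^ 2) ^ n • G z) atTop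
      (𝓝 (G 0)) := by
    refine tendsto_setIntegral_pow_smul_of_unique_maximum_of_isCompact_of_continuousOn
      (isCompact_closedBall _ _) (continuous_landauBase ρ).continuousOn (fun z _ hz => ?_)
      (fun z hz => one_sub_sq_nonneg hρ hz) (by simp) ?_ hGc.continuousOn
    · have : 0 < (ρ ^ 2)⁻¹ * ‖z‖ ^ 2 := by
        have := norm_pos_iff.2 hz
        positivity
      simp only [norm_zero]
      linarith
    · rw [interior_closedBall _ hρ.ne']
      exact subset_closure (Metric.mem_ball_self hρ)
  rw [hG1 hψ0] at hpeak
  rw [tendsto_eLpNorm_two_iff]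
  have hpeak' := ENNReal.tendsto_ofReal hpeak
  rw [ENNReal.ofReal_zero] at hpeak'
  exact tendsto_of_tendsto_of_tendsto_of_le_of_le tendsto_const_nhds hpeak' (fun _ => zero_le)
    fun n => lintegral_sq_le_of_average (isCompact_closedBall _ _)
      ((continuous_landauBase ρ).pow n) (fun z hz => pow_nonneg (one_sub_sq_nonneg hρ hz) n)
      (landauMass_pos hρ n) (lintegral_landau_pow hρ n) hψ hfm
      (enorm_mollify_landau_sub_le hρ hψ hψs hfi n) hGc hG0 hG

lemma integrable_of_memLp_of_support {A : ℝ} {f : Space → Spinor} (hf : MemLp f 2 volume)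
    (hA : ∀ x, A < ‖x‖ → f x = 0) : Integrable f := by
  have : IsFiniteMeasure (volume.restrict (Metric.closedBall (0 : Space) A)) :=
    isFiniteMeasure_restrict.2 (isCompact_closedBall _ _).measure_ne_top
  have h1 : IntegrableOn f (Metric.closedBall 0 A) :=
    (hf.restrict _).integrable one_le_two
  refine (integrableOn_iff_integrable_of_support_subset fun x hx => ?_).1 h1
  by_contra h
  exact hx (hA x (by simpa using h))

lemma contDiff_landauKernel (ρ : ℝ) {ψ : Space → ℝ} (hψ : ContDiff ℝ ∞ ψ) (n : ℕ) :
    ContDiff ℝ ∞ (landauKernel ρ ψ n) := by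
  have : ContDiff ℝ ∞ fun z : Space => ‖z‖ ^ 2 := contDiff_norm_sq ℝ
  exact contDiff_const.mul (hψ.mul ((contDiff_const.sub (contDiff_const.mul this)).pow n))

lemma tendsto_eLpNorm_zero_of_le {E E' : Type*} [NormedAddCommGroup E] [NormedAddCommGroup E']
    {f : ℕ → Space → E} {g : ℕ → Space → E'}
    (hg : Tendsto (fun n => eLpNorm (g n) 2 volume) atTop (𝓝 0)) (C : ℝ)
    (h : ∀ n x, ‖f n x‖ ≤ C * ‖g n x‖) :
    Tendsto (fun n => eLpNorm (f n) 2 volume) atTop (𝓝 0) := by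
  have h1 : Tendsto (fun n => ENNReal.ofReal C * eLpNorm (g n) 2 volume) atTop (𝓝 0) := by
    simpa using ENNReal.Tendsto.const_mul hg (Or.inr ENNReal.ofReal_ne_top)
  exact tendsto_of_tendsto_of_tendsto_of_le_of_le tendsto_const_nhds h1 (fun _ => zero_le)
    fun n => eLpNorm_le_mul_eLpNorm_of_ae_le_mul (ae_of_all _ (h n)) 2

lemma tendsto_eLpNorm_zero_add {E : Type*} [NormedAddCommGroup E] {f g : ℕ → Space → E}
    (hfm : ∀ n, AEStronglyMeasurable (f n) volume) (hgm : ∀ n, AEStronglyMeasurable (g n) volume)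
    (hf : Tendsto (fun n => eLpNorm (f n) 2 volume) atTop (𝓝 0))
    (hg : Tendsto (fun n => eLpNorm (g n) 2 volume) atTop (𝓝 0)) :
    Tendsto (fun n => eLpNorm (fun x => f n x + g n x) 2 volume) atTop (𝓝 0) := by
  have h1 := hf.add hg
  rw [add_zero] at h1
  exact tendsto_of_tendsto_of_tendsto_of_le_of_le tendsto_const_nhds h1 (fun _ => zero_le)
    fun n => eLpNorm_add_le (hfm n) (hgm n) one_le_two

/-- A compactly supported `H¹` spinor is approximated in `H¹` by sums of test eigenfunctions of
`1 + σ · L`. -/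
lemma exists_eigenSpan_approx_of_support {A : ℝ} (hA : 0 < A) {f : Space → Spinor}
    {F : Fin 3 → Space → Spinor} (hfm : StronglyMeasurable f) (hFm : ∀ j, StronglyMeasurable (F j))
    (hf : MemLp f 2 volume) (hF : ∀ j, MemLp (F j) 2 volume) (hfA : ∀ x, A ≤ ‖x‖ → f x = 0)
    (hFA : ∀ j x, A ≤ ‖x‖ → F j x = 0) (h : IsWeakGradientFun f F) :
    ∃ v : ℕ → Space → Spinor, (∀ n, v n ∈ eigenSpan) ∧
      Tendsto (fun n => eLpNorm (fun x => v n x - f x) 2 volume) atTop (𝓝 0) ∧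
      ∀ j, Tendsto (fun n => eLpNorm (fun x => partialDeriv j (v n) x - F j x) 2 volume) atTop
        (𝓝 0) := by
  have hfi := integrable_of_memLp_of_support hf fun x hx => hfA x hx.le
  have hFi := fun j => integrable_of_memLp_of_support (hF j) fun x hx => hFA j x hx.le
  -- If `‖x‖ < 2 A` and `‖y‖ < A`, then `‖x - y‖ ≤ 3 A`. So the cutoff `ψ` of the kernel is not
  -- seen where the radial cutoff `X` is nonzero, and there the mollified spinor is a polynomial.
  let ψ : ContDiffBump (0 : Space) := ⟨3 * A, 4 * A, by positivity, by linarith⟩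
  let χ : ContDiffBump (0 : ℝ) := ⟨A ^ 2, (2 * A) ^ 2, by positivity, by nlinarith⟩
  have hψ1 : ∀ z : Space, ‖z‖ ≤ 3 * A → ψ z = 1 := fun z hz =>
    ψ.one_of_mem_closedBall (by simpa using hz)
  have hψ0 : ∀ z : Space, 4 * A < ‖z‖ → ψ z = 0 := fun z hz =>
    ψ.zero_of_le_dist (by simpa using hz.le)
  set κ := landauKernel (4 * A) ψ with hκ
  have hκd : ∀ n, ContDiff ℝ ∞ (κ n) := fun n => contDiff_landauKernel _ ψ.contDiff n
  have hκc : ∀ n, HasCompactSupport (κ n) := fun n =>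
    ψ.hasCompactSupport.mono fun z hz hz' => hz (by simp [hκ, landauKernel, hz'])
  set X : Space → ℝ := fun x => χ (‖x‖ ^ 2) with hX
  have hXd : ContDiff ℝ ∞ X := χ.contDiff.comp (contDiff_norm_sq ℝ)
  have hX1 : ∀ x, ‖x‖ ≤ A → X x = 1 := fun x hx => by
    refine χ.one_of_mem_closedBall ?_
    simpa [abs_of_nonneg (sq_nonneg ‖x‖)] using pow_le_pow_left₀ (norm_nonneg x) hx 2
  have hX0 : ∀ x, 2 * A ≤ ‖x‖ → X x = 0 := fun x hx => by
    refine χ.zero_of_le_dist ?_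
    have := pow_le_pow_left₀ (by positivity) hx 2
    simpa [abs_of_nonneg (sq_nonneg ‖x‖)] using this
  have hXle : ∀ x, ‖X x‖ ≤ 1 := fun x => by
    rw [Real.norm_of_nonneg χ.nonneg]; exact χ.le_one
  have hXc : HasCompactSupport X := by
    refine HasCompactSupport.intro (isCompact_closedBall (0 : Space) (2 * A)) fun x hx => ?_
    exact hX0 x (le_of_lt (by simpa using hx))
  have hpoly : ∀ n, (fun x => X x • mollify (κ n) f x) ∈ eigenSpan := by
    intro n
    have hp := real_smul_mem_polySpan
      (integral_pow_smul_mem_polySpan (((4 * A) ^ 2)⁻¹) A n hfi fun x hx => hfA x hx.le)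
      (landauMass (4 * A) n)⁻¹
    have := radial_smul_mem_eigenSpan hp (h := χ) χ.contDiff χ.hasCompactSupport
    convert this using 1
    funext x
    rcases le_or_gt (2 * A) ‖x‖ with hx | hx
    · have h0 := hX0 x hx
      simp only [hX] at h0
      simp [hX, h0]
    · simp only [hX, mollify_eq]
      congr 1
      rw [← integral_smul]
      refine integral_congr_ae (ae_of_all _ fun y => ?_)
      rcases le_or_gt A ‖y‖ with hy | hy
      · simp [hfA y hy]
      · have : ‖x - y‖ ≤ 3 * A := (norm_sub_le x y).trans (by linarith)
        simp only [hκ, landauKernel, hψ1 _ this, one_mul, smul_smul]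
  have hconv : Tendsto (fun n => eLpNorm (fun x => mollify (κ n) f x - f x) 2 volume) atTop
      (𝓝 0) :=
    tendsto_landau (by positivity) ψ.continuous (hψ1 0 (by simp; positivity)) hψ0 hfm hf hfi
  have hconvF : ∀ j, Tendsto (fun n => eLpNorm (fun x => mollify (κ n) (F j) x - F j x) 2 volume)
      atTop (𝓝 0) := fun j =>
    tendsto_landau (by positivity) ψ.continuous (hψ1 0 (by simp; positivity)) hψ0 (hFm j) (hF j)
      (hFi j)
  have hmd : ∀ n x, DifferentiableAt ℝ (mollify (κ n) f) x := fun n x =>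
    (hasFDerivAt_mollify (hκd n) (hκc n) hfi x).1
  have hmc : ∀ n, Continuous (mollify (κ n) f) := fun n =>
    Differentiable.continuous (𝕜 := ℝ) (hmd n)
  have hmcF : ∀ n j, Continuous (mollify (κ n) (F j)) := fun n j =>
    Differentiable.continuous (𝕜 := ℝ) fun x =>
      (hasFDerivAt_mollify (hκd n) (hκc n) (hFi j) x).1
  have hXfc : Continuous (fderiv ℝ X) := hXd.continuous_fderiv (by simp)
  obtain ⟨C, hC⟩ := (hXc.fderiv (𝕜 := ℝ)).exists_bound_of_continuous hXfc
  refine ⟨fun n x => X x • mollify (κ n) f x, hpoly, ?_, fun j => ?_⟩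
  · refine tendsto_eLpNorm_zero_of_le hconv 1 fun n x => ?_
    have : X x • mollify (κ n) f x - f x = X x • (mollify (κ n) f x - f x) := by
      rw [smul_sub]
      congr 1
      rcases le_or_gt A ‖x‖ with hx | hx
      · simp [hfA x hx]
      · rw [hX1 x hx.le, one_smul]
    rw [this, norm_smul]
    exact mul_le_mul_of_nonneg_right (hXle x) (norm_nonneg _)
  · have hsplit : ∀ n x, partialDeriv j (fun x => X x • mollify (κ n) f x) x - F j x
        = X x • (mollify (κ n) (F j) x - F j x)
          + fderiv ℝ X x (EuclideanSpace.single j 1) • (mollify (κ n) f x - f x) := by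
      intro n x
      rw [partialDeriv_smul (hXd.differentiable (by simp) x) (hmd n x),
        partialDeriv_mollify (hκd n) (hκc n) hfi h]
      have e1 : F j x = X x • F j x := by
        rcases le_or_gt A ‖x‖ with hx | hx
        · simp [hFA j x hx]
        · rw [hX1 x hx.le, one_smul]
      have e2 : fderiv ℝ X x (EuclideanSpace.single j 1) • f x = 0 := by
        rcases le_or_gt A ‖x‖ with hx | hx
        · simp [hfA x hx]
        · have : X =ᶠ[𝓝 x] fun _ => 1 := by
            have hball : Metric.ball (0 : Space) A ∈ 𝓝 x :=
              Metric.isOpen_ball.mem_nhds (by simpa using hx)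
            filter_upwards [hball] with y hy
            exact hX1 y (le_of_lt (by simpa using hy))
          rw [this.fderiv_eq]
          simp
      rw [smul_sub, smul_sub, e2, sub_zero, ← e1]
      abel
    simp only [hsplit]
    have hcf : Continuous fun x => fderiv ℝ X x (EuclideanSpace.single j 1) :=
      hXfc.clm_apply continuous_const
    refine tendsto_eLpNorm_zero_add (fun n => ?_) (fun n => ?_)
      (tendsto_eLpNorm_zero_of_le (hconvF j) 1 fun n x => ?_)
      (tendsto_eLpNorm_zero_of_le hconv C fun n x => ?_)
    · exact hXd.continuous.aestronglyMeasurable.smul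
        ((hmcF n j).aestronglyMeasurable.sub (hFm j).aestronglyMeasurable)
    · exact hcf.aestronglyMeasurable.smul
        ((hmc n).aestronglyMeasurable.sub hfm.aestronglyMeasurable)
    · rw [norm_smul]
      exact mul_le_mul_of_nonneg_right (hXle x) (norm_nonneg _)
    · rw [norm_smul]
      refine mul_le_mul_of_nonneg_right ?_ (norm_nonneg _)
      refine (ContinuousLinearMap.le_opNorm _ _).trans ?_
      simpa using hC x

/-! ### Density of the eigenfunctions in `H¹` -/

/-- The product rule for weak gradients. -/
lemma isWeakGradientFun_smul {f : Space → Spinor} {F : Fin 3 → Space → Spinor}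
    (hf : MemLp f 2 volume) (hF : ∀ j, MemLp (F j) 2 volume) (h : IsWeakGradientFun f F)
    {χ : Space → ℝ} (hχ : ContDiff ℝ ∞ χ) :
    IsWeakGradientFun (fun x => χ x • f x)
      (fun j x => fderiv ℝ χ x (EuclideanSpace.single j 1) • f x + χ x • F j x) := by
  intro j η hη hηc
  have hint : ∀ {g : Space → ℝ} {k : Space → Spinor}, Continuous g → HasCompactSupport g →
      MemLp k 2 volume → Integrable fun x => g x • k x := fun hg hgc hk =>
    memLp_one_iff_integrable.1 (hk.smul (hg.memLp_of_hasCompactSupport (p := 2) hgc))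
  have hχ' : Continuous fun x => fderiv ℝ χ x (EuclideanSpace.single j 1) :=
    (hχ.continuous_fderiv (by simp)).clm_apply continuous_const
  have hη' : Continuous fun x => fderiv ℝ η x (EuclideanSpace.single j 1) :=
    (hη.continuous_fderiv (by simp)).clm_apply continuous_const
  have hηc' : HasCompactSupport fun x => fderiv ℝ η x (EuclideanSpace.single j 1) :=
    hηc.fderiv_apply (𝕜 := ℝ) _
  have h1 := h j (fun x => η x * χ x) (hη.mul hχ) hηc.mul_right
  have h2 : ∀ x, fderiv ℝ (fun x => η x * χ x) x (EuclideanSpace.single j 1)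
      = η x * fderiv ℝ χ x (EuclideanSpace.single j 1)
        + fderiv ℝ η x (EuclideanSpace.single j 1) * χ x := fun x => by
    have := ((hη.differentiable (by simp) x).hasFDerivAt.mul
      (hχ.differentiable (by simp) x).hasFDerivAt).fderiv
    rw [show (fun x => η x * χ x) = η * χ from rfl, this]
    simp [mul_comm]
  have i1 : Integrable fun x => (η x * fderiv ℝ χ x (EuclideanSpace.single j 1)) • f x :=
    hint (hη.continuous.mul hχ') hηc.mul_right hf
  have i2 : Integrable fun x => (fderiv ℝ η x (EuclideanSpace.single j 1) * χ x) • f x :=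
    hint (hη'.mul hχ.continuous) hηc'.mul_right hf
  have i3 : Integrable fun x => (η x * χ x) • F j x :=
    hint (hη.continuous.mul hχ.continuous) hηc.mul_right (hF j)
  simp only [h2, add_smul] at h1
  rw [integral_add i1 i2] at h1
  simp only [smul_add, smul_smul]
  rw [integral_add i1 i3, neg_add, ← h1]
  abel

lemma tendsto_cutoff (χ : ContDiffBump (0 : Space)) {f : Space → Spinor} (hf : MemLp f 2 volume) :
    Tendsto (fun n : ℕ => eLpNorm (fun x => χ (((n : ℝ) + 1)⁻¹ • x) • f x - f x) 2 volume) atTop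
      (𝓝 0) := by
  rw [tendsto_eLpNorm_two_iff]
  have hlim := tendsto_lintegral_of_dominated_convergence' (μ := (volume : Measure Space))
    (F := fun (n : ℕ) x => ‖χ (((n : ℝ) + 1)⁻¹ • x) • f x - f x‖ₑ ^ 2) (f := fun _ => 0)
    (fun x => ‖f x‖ₑ ^ 2) (fun n => ?_) (fun n => ae_of_all _ fun x => ?_) ?_
    (ae_of_all _ fun x => ?_)
  · simpa using hlim
  · have : Continuous fun x : Space => χ (((n : ℝ) + 1)⁻¹ • x) :=
      χ.continuous.comp (continuous_const_smul _)
    exact ((this.aestronglyMeasurable.smul hf.1).sub hf.1).enorm.pow_const 2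
  · have : χ (((n : ℝ) + 1)⁻¹ • x) • f x - f x = (χ (((n : ℝ) + 1)⁻¹ • x) - 1) • f x := by
      rw [sub_smul, one_smul]
    simp only [this, enorm_smul]
    have h1 : ‖χ (((n : ℝ) + 1)⁻¹ • x) - 1‖ₑ ≤ 1 := by
      rw [Real.enorm_eq_ofReal_abs, ENNReal.ofReal_le_one, abs_le]
      constructor <;> linarith [χ.nonneg (x := ((n : ℝ) + 1)⁻¹ • x),
        χ.le_one (x := ((n : ℝ) + 1)⁻¹ • x)]
    gcongr
    exact mul_le_of_le_one_left' h1
  · rw [← eLpNorm_two_sq]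
    exact ENNReal.pow_ne_top hf.2.ne
  · have h0 : Tendsto (fun n : ℕ => ((n : ℝ) + 1)⁻¹ • x) atTop (𝓝 0) := by
      have := (tendsto_one_div_add_atTop_nhds_zero_nat (𝕜 := ℝ)).smul_const x
      simpa using this
    have h1 : ∀ᶠ n : ℕ in atTop, χ (((n : ℝ) + 1)⁻¹ • x) = 1 := by
      filter_upwards [h0.eventually (Metric.closedBall_mem_nhds (0 : Space) χ.rIn_pos)] with n hn
      exact χ.one_of_mem_closedBall hn
    refine tendsto_const_nhds.congr' ?_
    filter_upwards [h1] with n hn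
    simp [hn]

/-- The finite sums of test eigenfunctions of `1 + σ · L` are dense in `H¹`. -/
lemma exists_eigenSpan_approx {φ : L2Spinor} {D : Fin 3 → L2Spinor} (h : IsWeakGradient φ D) :
    ∃ v : ℕ → Space → Spinor, (∀ n, v n ∈ eigenSpan) ∧
      Tendsto (fun n => eLpNorm (fun x => v n x - φ x) 2 volume) atTop (𝓝 0) ∧
      ∀ j, Tendsto (fun n => eLpNorm (fun x => partialDeriv j (v n) x - D j x) 2 volume) atTop
        (𝓝 0) := by
  let χ : ContDiffBump (0 : Space) := ⟨1, 2, one_pos, one_lt_two⟩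
  set X : ℕ → Space → ℝ := fun n x => χ (((n : ℝ) + 1)⁻¹ • x) with hX
  have hφ := Lp.memLp φ
  have hD := fun j => Lp.memLp (D j)
  have hXd : ∀ n, ContDiff ℝ ∞ (X n) := fun n => χ.contDiff.comp (contDiff_const_smul _)
  have hX0 : ∀ (n : ℕ) x, 2 * ((n : ℝ) + 1) ≤ ‖x‖ → X n x = 0 := fun n x hx => by
    refine χ.zero_of_le_dist ?_
    rw [dist_zero_right, norm_smul, norm_inv, Real.norm_of_nonneg (by positivity),
      inv_mul_eq_div, le_div_iff₀ (by positivity)]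
    exact hx
  have hXle : ∀ n x, ‖X n x‖ ≤ 1 := fun n x => by
    rw [Real.norm_of_nonneg χ.nonneg]; exact χ.le_one
  obtain ⟨C, hC⟩ := (χ.hasCompactSupport.fderiv (𝕜 := ℝ)).exists_bound_of_continuous
    (χ.contDiff.continuous_fderiv (n := ∞) (by simp))
  have hXf : ∀ (n : ℕ) x (j : Fin 3), fderiv ℝ (X n) x (EuclideanSpace.single j 1)
      = ((n : ℝ) + 1)⁻¹ * fderiv ℝ χ (((n : ℝ) + 1)⁻¹ • x) (EuclideanSpace.single j 1) := by
    intro n x j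
    have h1 : HasFDerivAt (fun x : Space => ((n : ℝ) + 1)⁻¹ • x)
        (((n : ℝ) + 1)⁻¹ • ContinuousLinearMap.id ℝ Space) x :=
      ((((n : ℝ) + 1)⁻¹) • ContinuousLinearMap.id ℝ Space).hasFDerivAt
    have h2 := ((χ.contDiff : ContDiff ℝ ∞ χ).differentiable (by simp)
      (((n : ℝ) + 1)⁻¹ • x)).hasFDerivAt.comp x h1
    rw [show X n = χ ∘ fun x => ((n : ℝ) + 1)⁻¹ • x from rfl, h2.fderiv]
    simp
  have hXfb : ∀ (n : ℕ) x (j : Fin 3), ‖fderiv ℝ (X n) x (EuclideanSpace.single j 1)‖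
      ≤ ((n : ℝ) + 1)⁻¹ * C := fun n x j => by
    rw [hXf, norm_mul, norm_inv, Real.norm_of_nonneg (by positivity : (0 : ℝ) ≤ n + 1)]
    gcongr
    refine (ContinuousLinearMap.le_opNorm _ _).trans ?_
    simpa using hC _
  have hXc : ∀ n (j : Fin 3), Continuous fun x => fderiv ℝ (X n) x (EuclideanSpace.single j 1) :=
    fun n j => ((hXd n).continuous_fderiv (by simp)).clm_apply continuous_const
  -- The points where the nonnegative function `X n` vanishes are minima.
  have hXf0 : ∀ (n : ℕ) x (j : Fin 3), 2 * ((n : ℝ) + 1) ≤ ‖x‖ →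
      fderiv ℝ (X n) x (EuclideanSpace.single j 1) = 0 := fun n x j hx => by
    have hmin : IsLocalMin (X n) x := Eventually.of_forall fun y => by
      rw [hX0 n x hx]; exact χ.nonneg
    rw [hmin.fderiv_eq_zero]
    simp
  set f : ℕ → Space → Spinor := fun n x => X n x • φ x with hf
  set F : ℕ → Fin 3 → Space → Spinor := fun n j x =>
    fderiv ℝ (X n) x (EuclideanSpace.single j 1) • φ x + X n x • D j x with hF
  have hsm : ∀ n, StronglyMeasurable (f n) := fun n =>
    (hXd n).continuous.stronglyMeasurable.smul (Lp.stronglyMeasurable φ)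
  have hsF1 : ∀ n j, StronglyMeasurable
      fun x => fderiv ℝ (X n) x (EuclideanSpace.single j 1) • φ x := fun n j =>
    (hXc n j).stronglyMeasurable.smul (Lp.stronglyMeasurable φ)
  have hsF2 : ∀ n j, StronglyMeasurable fun x => X n x • D j x := fun n j =>
    (hXd n).continuous.stronglyMeasurable.smul (Lp.stronglyMeasurable (D j))
  have hfL : ∀ n, MemLp (f n) 2 volume := fun n =>
    hφ.of_le_mul (c := 1) (hsm n).aestronglyMeasurable (ae_of_all _ fun x => by
      rw [hf, norm_smul]; exact mul_le_mul_of_nonneg_right (hXle n x) (norm_nonneg _))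
  have hFL1 : ∀ n j, MemLp (fun x => fderiv ℝ (X n) x (EuclideanSpace.single j 1) • φ x) 2 volume :=
    fun n j => hφ.of_le_mul (c := ((n : ℝ) + 1)⁻¹ * C) (hsF1 n j).aestronglyMeasurable
      (ae_of_all _ fun x => by
        rw [norm_smul]; exact mul_le_mul_of_nonneg_right (hXfb n x j) (norm_nonneg _))
  have hFL2 : ∀ n j, MemLp (fun x => X n x • D j x) 2 volume := fun n j =>
    (hD j).of_le_mul (c := 1) (hsF2 n j).aestronglyMeasurable (ae_of_all _ fun x => by
      rw [norm_smul]; exact mul_le_mul_of_nonneg_right (hXle n x) (norm_nonneg _))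
  have hflim : Tendsto (fun n => eLpNorm (fun x => f n x - φ x) 2 volume) atTop (𝓝 0) :=
    tendsto_cutoff χ hφ
  have hFlim : ∀ j, Tendsto (fun n => eLpNorm (fun x => F n j x - D j x) 2 volume) atTop (𝓝 0) := by
    intro j
    have h1 : Tendsto (fun n => eLpNorm
        (fun x => fderiv ℝ (X n) x (EuclideanSpace.single j 1) • φ x) 2 volume) atTop (𝓝 0) := by
      have h2 : Tendsto (fun n : ℕ => ENNReal.ofReal (((n : ℝ) + 1)⁻¹ * C) * eLpNorm φ 2 volume)
          atTop (𝓝 0) := by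
        have h3 := (tendsto_one_div_add_atTop_nhds_zero_nat (𝕜 := ℝ)).mul_const C
        simp only [zero_mul, one_div] at h3
        have h4 := ENNReal.Tendsto.mul_const (b := eLpNorm φ 2 volume)
          (ENNReal.tendsto_ofReal h3) (Or.inr hφ.2.ne)
        simpa using h4
      refine tendsto_of_tendsto_of_tendsto_of_le_of_le tendsto_const_nhds h2 (fun _ => zero_le)
        fun n => eLpNorm_le_mul_eLpNorm_of_ae_le_mul (ae_of_all _ fun x => ?_) 2
      rw [norm_smul]
      exact mul_le_mul_of_nonneg_right (hXfb n x j) (norm_nonneg _)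
    have h2 := tendsto_eLpNorm_zero_add (fun n => (hsF1 n j).aestronglyMeasurable)
      (fun n => ((hsF2 n j).sub (Lp.stronglyMeasurable (D j))).aestronglyMeasurable) h1
      (tendsto_cutoff χ (hD j))
    refine h2.congr fun n => ?_
    congr 1
    funext x
    simp only [hF, add_sub_assoc]
    rfl
  have happ := fun n : ℕ => exists_eigenSpan_approx_of_support
    (A := 2 * ((n : ℝ) + 1)) (by positivity)
    (hsm n) (fun j => (hsF1 n j).add (hsF2 n j)) (hfL n) (fun j => (hFL1 n j).add (hFL2 n j))
    (fun x hx => by simp [hf, hX0 n x hx]) (fun j x hx => by simp [hX0 n x hx, hXf0 n x j hx])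
    (isWeakGradientFun_smul hφ hD h (hXd n))
  -- A diagonal sequence: the `n`-th cutoff is approximated up to `1 / (n + 1)`.
  have hsel : ∀ n : ℕ, ∃ v ∈ eigenSpan, eLpNorm (fun x => v x - f n x) 2 volume
        < ENNReal.ofReal (1 / ((n : ℝ) + 1)) ∧
      ∀ j, eLpNorm (fun x => partialDeriv j v x - F n j x) 2 volume
        < ENNReal.ofReal (1 / ((n : ℝ) + 1)) := by
    intro n
    obtain ⟨v, hv, hv1, hv2⟩ := happ n
    have hpos : (0 : ℝ≥0∞) < ENNReal.ofReal (1 / ((n : ℝ) + 1)) :=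
      ENNReal.ofReal_pos.2 (by positivity)
    obtain ⟨k, hk1, hk2⟩ := ((hv1.eventually_lt_const hpos).and
      (eventually_all.2 fun j => (hv2 j).eventually_lt_const hpos)).exists
    exact ⟨v k, hv k, hk1, hk2⟩
  choose v hv hv1 hv2 using hsel
  have hvt := fun n => isTest_of_mem_iSup (hv n)
  have hε : Tendsto (fun n : ℕ => ENNReal.ofReal (1 / ((n : ℝ) + 1))) atTop (𝓝 0) := by
    have := ENNReal.tendsto_ofReal (tendsto_one_div_add_atTop_nhds_zero_nat (𝕜 := ℝ))
    simpa using this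
  refine ⟨v, hv, ?_, fun j => ?_⟩
  · have h1 := tendsto_eLpNorm_zero_add
      (fun n => ((hvt n).continuous.stronglyMeasurable.sub (hsm n)).aestronglyMeasurable)
      (fun n => ((hsm n).sub (Lp.stronglyMeasurable φ)).aestronglyMeasurable)
      (tendsto_of_tendsto_of_tendsto_of_le_of_le tendsto_const_nhds hε (fun _ => zero_le)
        fun n => (hv1 n).le) hflim
    simpa using h1
  · have h1 := tendsto_eLpNorm_zero_add
      (fun n => (((hvt n).partialDeriv j).continuous.stronglyMeasurable.sub
        ((hsF1 n j).add (hsF2 n j))).aestronglyMeasurable)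
      (fun n => (((hsF1 n j).add (hsF2 n j)).sub
        (Lp.stronglyMeasurable (D j))).aestronglyMeasurable)
      (tendsto_of_tendsto_of_tendsto_of_le_of_le tendsto_const_nhds hε (fun _ => zero_le)
        fun n => (hv2 n j).le) (hFlim j)
    simpa using h1

/-! ### Convergence in `H¹` -/

lemma tendsto_toLp_iff {X E ι : Type*} [MeasurableSpace X] {μ : Measure X} [NormedAddCommGroup E]
    {l : Filter ι} {u : ι → X → E} (hu : ∀ n, MemLp (u n) 2 μ) (f : Lp E 2 μ) :
    Tendsto (fun n => (hu n).toLp (u n)) l (𝓝 f)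
      ↔ Tendsto (fun n => eLpNorm (fun x => u n x - f x) 2 μ) l (𝓝 0) := by
  have h := Lp.tendsto_Lp_iff_tendsto_eLpNorm'' (fi := l) u hu f (Lp.memLp f)
  rw [Lp.toLp_coeFn] at h
  exact h

lemma norm_toLp_sq {X E : Type*} [MeasurableSpace X] {μ : Measure X} [NormedAddCommGroup E]
    {f : X → E} (hf : MemLp f 2 μ) : ‖hf.toLp f‖ ^ 2 = ∫ x, ‖f x‖ ^ 2 ∂μ := by
  rw [Lp.norm_toLp, ← ENNReal.toReal_pow, eLpNorm_two_sq,
    integral_eq_lintegral_of_nonneg_ae (ae_of_all _ fun x => sq_nonneg _)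
      (hf.1.norm.pow 2)]
  congr 1
  refine lintegral_congr fun x => ?_
  rw [ENNReal.ofReal_pow (norm_nonneg _), ofReal_norm]

/-- The test spinors `u n` converge to `f` in `L²`, and their gradients to `F`. -/
structure H1Tendsto (u : ℕ → Space → Spinor) (f : L2Spinor) (F : Fin 3 → L2Spinor) : Prop where
  test : ∀ n, IsTest (u n)
  tendsto : Tendsto (fun n => eLpNorm (fun x => u n x - f x) 2 volume) atTop (𝓝 0)
  tendsto_partialDeriv : ∀ j,
    Tendsto (fun n => eLpNorm (fun x => partialDeriv j (u n) x - F j x) 2 volume) atTop (𝓝 0)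

lemma tendsto_integral_smul {u : ℕ → Space → Spinor} {f : Space → Spinor}
    (hu : ∀ n, MemLp (u n) 2 volume) (hf : MemLp f 2 volume)
    (h : Tendsto (fun n => eLpNorm (fun x => u n x - f x) 2 volume) atTop (𝓝 0))
    {ζ : Space → ℝ} (hζ : MemLp ζ 2 volume) :
    Tendsto (fun n => ∫ x, ζ x • u n x) atTop (𝓝 (∫ x, ζ x • f x)) := by
  have hint : ∀ {k : Space → Spinor}, MemLp k 2 volume → Integrable fun x => ζ x • k x :=
    fun hk => memLp_one_iff_integrable.1 (hk.smul hζ)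
  refine tendsto_integral_of_L1' _ (hint hf).aestronglyMeasurable
    (Eventually.of_forall fun n => hint (hu n)) ?_
  have h1 := ENNReal.Tendsto.const_mul (a := eLpNorm ζ 2 volume) h (Or.inr hζ.2.ne)
  rw [mul_zero] at h1
  refine tendsto_of_tendsto_of_tendsto_of_le_of_le tendsto_const_nhds h1 (fun _ => zero_le)
    fun n => ?_
  have h2 : ((fun x => ζ x • u n x) - fun x => ζ x • f x) = ζ • fun x => u n x - f x := by
    funext x
    simp [smul_sub]
  rw [h2]
  exact eLpNorm_smul_le_mul_eLpNorm ((hu n).sub hf).1 hζ.1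

lemma H1Tendsto.isWeakGradient {u : ℕ → Space → Spinor} {f : L2Spinor} {F : Fin 3 → L2Spinor}
    (h : H1Tendsto u f F) : IsWeakGradient f F := by
  intro j η hη hηc
  have hηL : MemLp η 2 volume := hη.continuous.memLp_of_hasCompactSupport hηc
  have hη' : Continuous fun x => fderiv ℝ η x (EuclideanSpace.single j 1) :=
    (hη.continuous_fderiv (by simp)).clm_apply continuous_const
  have hηc' : HasCompactSupport fun x => fderiv ℝ η x (EuclideanSpace.single j 1) :=
    hηc.fderiv_apply (𝕜 := ℝ) _
  have hηL' : MemLp (fun x => fderiv ℝ η x (EuclideanSpace.single j 1)) 2 volume :=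
    hη'.memLp_of_hasCompactSupport hηc'
  have h1 := tendsto_integral_smul (fun n => (h.test n).memLp volume) (Lp.memLp f) h.tendsto hηL'
  have h2 := tendsto_integral_smul (fun n => ((h.test n).partialDeriv j).memLp volume)
    (Lp.memLp (F j)) (h.tendsto_partialDeriv j) hηL
  refine tendsto_nhds_unique h1 (h2.neg.congr fun n => ?_)
  have hint : ∀ {g : Space → ℝ} {k : Space → Spinor}, MemLp g 2 volume →
      MemLp k 2 volume → Integrable fun x => g x • k x := fun hg hk =>
    memLp_one_iff_integrable.1 (hk.smul hg)
  have h3 := integral_smul_fderiv_eq_neg_fderiv_smul_of_integrable (𝕜 := ℝ)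
    (μ := (volume : Measure Space)) (f := η) (g := u n) (v := EuclideanSpace.single j 1)
    (hint hηL' ((h.test n).memLp volume)) (hint hηL (((h.test n).partialDeriv j).memLp volume))
    (hint hηL ((h.test n).memLp volume))
    (fun x _ => hη.differentiable (by simp) x) (fun x _ => (h.test n).differentiable x)
  rw [← neg_eq_iff_eq_neg] at h3
  exact h3

/-! ### The gradient controls the channels -/

lemma IsTest.integrable_norm_sq {u : Space → Spinor} (hu : IsTest u) :
    Integrable fun x => ‖u x‖ ^ 2 := by
  simpa only [real_inner_self_eq_norm_sq] using hu.integrable_inner hu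

lemma integral_norm_sq_dirac_channels {u v : Space → Spinor} (hu : u ∈ posSpan)
    (hv : v ∈ negSpan) :
    ∫ x, ‖dirac (u + v) x‖ ^ 2 = (∫ x, ‖dirac u x‖ ^ 2) + ∫ x, ‖dirac v x‖ ^ 2 := by
  have hut := isTest_of_mem_posSpan hu
  have hvt := isTest_of_mem_negSpan hv
  have i1 := hut.dirac.integrable_norm_sq
  have i2 := hvt.dirac.integrable_norm_sq
  rw [← integral_sphereInt i1, ← integral_sphereInt i2,
    ← integral_sphereInt (hut.add hvt).dirac.integrable_norm_sq, ← integral_add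
    (integrable_sphereInt i1) (integrable_sphereInt i2), integral_radialMeasure,
    integral_radialMeasure]
  refine setIntegral_congr_fun measurableSet_Ioi fun r hr => ?_
  simp only [sphereInt_norm_sq_dirac_channels hu hv hr]

lemma norm_toLp_partialDeriv_le {w u : Space → Spinor} (hw : IsTest w) (hu : IsTest u)
    (h : ∫ x, ‖dirac w x‖ ^ 2 ≤ ∫ x, ‖dirac u x‖ ^ 2) (j : Fin 3) :
    ‖((hw.partialDeriv j).memLp volume).toLp (partialDeriv j w)‖
      ≤ ∑ k, ‖((hu.partialDeriv k).memLp volume).toLp (partialDeriv k u)‖ := by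
  rw [integral_norm_sq_dirac hw, integral_norm_sq_dirac hu] at h
  refine le_of_sq_le_sq ?_ (Finset.sum_nonneg fun _ _ => norm_nonneg _)
  calc ‖((hw.partialDeriv j).memLp volume).toLp (partialDeriv j w)‖ ^ 2
      = ∫ x, ‖partialDeriv j w x‖ ^ 2 := norm_toLp_sq _
    _ ≤ ∑ k, ∫ x, ‖partialDeriv k w x‖ ^ 2 :=
        Finset.single_le_sum (f := fun k => ∫ x, ‖partialDeriv k w x‖ ^ 2)
          (fun k _ => integral_nonneg fun x => sq_nonneg _) (Finset.mem_univ j)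
    _ ≤ ∑ k, ∫ x, ‖partialDeriv k u x‖ ^ 2 := h
    _ = ∑ k, ‖((hu.partialDeriv k).memLp volume).toLp (partialDeriv k u)‖ ^ 2 :=
        Finset.sum_congr rfl fun k _ => (norm_toLp_sq _).symm
    _ ≤ _ := Finset.sum_sq_le_sq_sum_of_nonneg fun _ _ => norm_nonneg _

lemma partialDeriv_sub {u v : Space → Spinor} (hu : IsTest u) (hv : IsTest v) (j : Fin 3) :
    partialDeriv j (u - v) = partialDeriv j u - partialDeriv j v := by
  funext x
  simp [partialDeriv, fderiv_sub (hu.differentiable x) (hv.differentiable x)]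

/-- If the Dirac energies of the differences of `w n` are controlled by those of a sequence that
converges in `H¹`, then the gradients of `w n` converge. -/
lemma exists_tendsto_partialDeriv {u w : ℕ → Space → Spinor} {f : L2Spinor} {F : Fin 3 → L2Spinor}
    (h : H1Tendsto u f F) (hw : ∀ n, IsTest (w n))
    (hle : ∀ n k, ∫ x, ‖dirac (w n - w k) x‖ ^ 2 ≤ ∫ x, ‖dirac (u n - u k) x‖ ^ 2) (j : Fin 3) :
    ∃ G : L2Spinor,
      Tendsto (fun n => eLpNorm (fun x => partialDeriv j (w n) x - G x) 2 volume) atTop (𝓝 0) := by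
  have hc : CauchySeq fun n => (((hw n).partialDeriv j).memLp volume).toLp
      (partialDeriv j (w n)) := by
    rw [cauchySeq_iff_tendsto_dist_atTop_0]
    have h0 : ∀ k, Tendsto (fun n : ℕ × ℕ =>
        dist ((((h.test n.1).partialDeriv k).memLp volume).toLp (partialDeriv k (u n.1)))
          ((((h.test n.2).partialDeriv k).memLp volume).toLp (partialDeriv k (u n.2)))) atTop
        (𝓝 0) := fun k =>
      cauchySeq_iff_tendsto_dist_atTop_0.1
        ((tendsto_toLp_iff (fun n => ((h.test n).partialDeriv k).memLp volume) (F k)).2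
          (h.tendsto_partialDeriv k)).cauchySeq
    have h1 := tendsto_finsetSum Finset.univ fun k _ => h0 k
    rw [Finset.sum_const_zero] at h1
    refine squeeze_zero (fun _ => dist_nonneg) (fun n => ?_) h1
    have h2 := norm_toLp_partialDeriv_le ((hw n.1).sub (hw n.2))
      ((h.test n.1).sub (h.test n.2)) (hle n.1 n.2) j
    simp only [partialDeriv_sub (hw n.1) (hw n.2), partialDeriv_sub (h.test n.1) (h.test n.2)] at h2
    simp only [dist_eq_norm]
    exact h2
  obtain ⟨G, hG⟩ := cauchySeq_tendsto_of_complete hc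
  exact ⟨G, (tendsto_toLp_iff _ G).1 hG⟩

/-- Every `H¹` spinor is the `H¹` limit of sums of test eigenfunctions of `1 + σ · L` whose positive
and negative parts converge in `H¹` to its two spectral components. -/
lemma exists_channel_approx {φ : L2Spinor} {D : Fin 3 → L2Spinor} (h : IsWeakGradient φ D) :
    ∃ (p m : ℕ → Space → Spinor) (Dp Dm : Fin 3 → L2Spinor),
      (∀ n, p n ∈ posSpan) ∧ (∀ n, m n ∈ negSpan) ∧ H1Tendsto p (projPos φ) Dp ∧
      H1Tendsto m (projNeg φ) Dm ∧ H1Tendsto (fun n => p n + m n) φ D := by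
  obtain ⟨v, hv, hv1, hv2⟩ := exists_eigenSpan_approx h
  have hsplit : ∀ n, ∃ p ∈ posSpan, ∃ m ∈ negSpan, p + m = v n := fun n =>
    Submodule.mem_sup.1 (eigenSpan_le (hv n))
  choose p hp m hm hpm using hsplit
  have hpt := fun n => isTest_of_mem_posSpan (hp n)
  have hmt := fun n => isTest_of_mem_negSpan (hm n)
  have hvH : H1Tendsto (fun n => p n + m n) φ D := by
    refine ⟨fun n => (hpt n).add (hmt n), ?_, fun j => ?_⟩ <;> simp only [hpm]
    · exact hv1
    · exact hv2 j
  -- `σ · ∇` keeps the channels orthogonal, so each channel has at most the Dirac energy of the sum.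
  have hdiff : ∀ n k, p n + m n - (p k + m k) = (p n - p k) + (m n - m k) := fun n k => by abel
  have hen := fun n k => integral_norm_sq_dirac_channels (posSpan.sub_mem (hp n) (hp k))
    (negSpan.sub_mem (hm n) (hm k))
  have hnn : ∀ u : Space → Spinor, 0 ≤ ∫ x, ‖dirac u x‖ ^ 2 := fun u =>
    integral_nonneg fun x => sq_nonneg _
  have hDp := exists_tendsto_partialDeriv hvH hpt fun n k => by
    rw [hdiff, hen]; linarith [hnn (m n - m k)]
  have hDm := exists_tendsto_partialDeriv hvH hmt fun n k => by
    rw [hdiff, hen]; linarith [hnn (p n - p k)]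
  choose Dp hDp using hDp
  choose Dm hDm using hDm
  have hvL : Tendsto (fun n => ((hpt n).memLp volume).toLp (p n) + ((hmt n).memLp volume).toLp
      (m n)) atTop (𝓝 φ) :=
    (tendsto_toLp_iff (fun n => (hvH.test n).memLp volume) φ).2 hvH.tendsto
  refine ⟨p, m, Dp, Dm, hp, hm, ⟨hpt, ?_, hDp⟩, ⟨hmt, ?_, hDm⟩, hvH⟩
  · refine (tendsto_toLp_iff (fun n => (hpt n).memLp volume) _).1 ?_
    exact ((projPos.continuous.tendsto φ).comp hvL).congr fun n =>
      projPos_toLp_add (hp n) (hm n) _ _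
  · refine (tendsto_toLp_iff (fun n => (hmt n).memLp volume) _).1 ?_
    exact ((projNeg.continuous.tendsto φ).comp hvL).congr fun n =>
      projNeg_toLp_add (hp n) (hm n) _ _

/-! ### Traces on spheres -/

lemma fderiv_eq_sum (u : Space → Spinor) (x y : Space) :
    fderiv ℝ u x y = ∑ j, y j • partialDeriv j u x := by
  conv_lhs => rw [← (EuclideanSpace.basisFun (Fin 3) ℝ).sum_repr y]
  simp [partialDeriv]

/-- The Cauchy–Schwarz inequality for a combination of spinors. -/
lemma norm_sum_smul_sq_le (y : Space) (a : Fin 3 → Spinor) :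
    ‖∑ j, y j • a j‖ ^ 2 ≤ ‖y‖ ^ 2 * ∑ j, ‖a j‖ ^ 2 := by
  have h1 : ‖∑ j, y j • a j‖ ≤ ∑ j, |y j| * ‖a j‖ :=
    (norm_sum_le _ _).trans (le_of_eq (Finset.sum_congr rfl fun j _ => by
      rw [norm_smul, Real.norm_eq_abs]))
  calc ‖∑ j, y j • a j‖ ^ 2 ≤ (∑ j, |y j| * ‖a j‖) ^ 2 := by gcongr
    _ ≤ (∑ j, |y j| ^ 2) * ∑ j, ‖a j‖ ^ 2 := Finset.sum_mul_sq_le_sq_mul_sq _ _ _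
    _ = _ := by rw [EuclideanSpace.norm_sq_eq]; simp

/-- The trace inequality, from integrating the derivative of `r³ ∫ |u(rθ)|² dθ` over `(0, R)`. -/
lemma sphereInt_norm_sq_le {u : Space → Spinor} (hu : IsTest u) {R : ℝ} (hR : 0 < R) :
    R ^ 3 * sphereInt (fun x => ‖u x‖ ^ 2) R
      ≤ (3 + R) * (∫ x, ‖u x‖ ^ 2) + R * ∑ j, ∫ x, ‖partialDeriv j u x‖ ^ 2 := by
  set g : Space → ℝ := fun x => (3 + R) * ‖u x‖ ^ 2 + R * ∑ j, ‖partialDeriv j u x‖ ^ 2 with hg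
  have hu' := hu.continuous
  have hp := fun j => (hu.partialDeriv j).continuous
  have hgc : Continuous g := by fun_prop
  have i1 : Integrable fun x => (3 + R) * ‖u x‖ ^ 2 := hu.integrable_norm_sq.const_mul _
  have i2 : ∀ j, Integrable fun x => ‖partialDeriv j u x‖ ^ 2 := fun j =>
    (hu.partialDeriv j).integrable_norm_sq
  have i3 : Integrable fun x => R * ∑ j, ‖partialDeriv j u x‖ ^ 2 :=
    (integrable_finsetSum _ fun j _ => i2 j).const_mul R
  have hgi : Integrable g := i1.add i3
  have hG : ∫ x, g x = (3 + R) * (∫ x, ‖u x‖ ^ 2) + R * ∑ j, ∫ x, ‖partialDeriv j u x‖ ^ 2 := by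
    rw [hg, integral_add i1 i3, integral_const_mul, integral_const_mul,
      integral_finsetSum _ fun j _ => i2 j]
  have hGc : Continuous fun r => r ^ 2 * sphereInt g r :=
    (continuous_id.pow 2).mul (continuous_sphereInt hgc)
  rw [← hG, ← integral_sphereInt hgi, integral_radialMeasure]
  have hder : ∀ r, HasDerivAt (fun r => r ^ 3 * sphereInt (fun x => ‖u x‖ ^ 2) r)
      (3 * r ^ 2 * sphereInt (fun x => ‖u x‖ ^ 2) r + r ^ 3 *
        ∫ θ : UnitSphere, 2 * inner ℝ (u (r • (θ : Space)))
        (fderiv ℝ u (r • (θ : Space)) (θ : Space)) ∂sphereMeasure) r := fun r => by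
    exact ((hasDerivAt_pow 3 r).mul (hasDerivAt_sphereInt_norm_sq hu r)).congr_deriv (by simp)
  have hle := intervalIntegral.sub_le_integral_of_hasDeriv_right_of_le hR.le
    (fun r _ => (hder r).continuousAt.continuousWithinAt)
    (fun r _ => (hder r).hasDerivWithinAt) (φ := fun r => r ^ 2 * sphereInt g r)
    hGc.continuousOn.integrableOn_Icc ?_
  · rw [zero_pow three_ne_zero, zero_mul, sub_zero, intervalIntegral.integral_of_le hR.le] at hle
    refine hle.trans (setIntegral_mono_set
      (integrable_radialMeasure_iff.1 (integrable_sphereInt hgi)) ?_ ?_)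
    · exact ae_of_all _ fun r => mul_nonneg (sq_nonneg r) (integral_nonneg fun θ => by
        simp only [hg, Pi.zero_apply]; positivity)
    · exact (Ioc_subset_Ioi_self).eventuallyLE
  · intro r hr
    have hr0 : 0 < r := hr.1
    have hfd : Continuous (fderiv ℝ u) := hu.1.continuous_fderiv (by simp)
    have h2 : Continuous fun θ : UnitSphere => fderiv ℝ u (r • (θ : Space)) (θ : Space) :=
      (hfd.comp (by fun_prop)).clm_apply continuous_subtype_val
    have e : 3 * r ^ 2 * sphereInt (fun x => ‖u x‖ ^ 2) r + r ^ 3 *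
        ∫ θ : UnitSphere, 2 * inner ℝ (u (r • (θ : Space)))
        (fderiv ℝ u (r • (θ : Space)) (θ : Space)) ∂sphereMeasure
        = r ^ 2 * ∫ θ : UnitSphere, (3 * ‖u (r • (θ : Space))‖ ^ 2
          + r * (2 * inner ℝ (u (r • (θ : Space)))
            (fderiv ℝ u (r • (θ : Space)) (θ : Space)))) ∂sphereMeasure := by
      rw [integral_add (integrable_sphere (by fun_prop)) (integrable_sphere (by fun_prop)),
        integral_const_mul 3, integral_const_mul r, sphereInt]
      ring
    simp only [e]
    refine mul_le_mul_of_nonneg_left (integral_mono (integrable_sphere (by fun_prop))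
      (integrable_sphere (by fun_prop)) fun θ => ?_) (sq_nonneg r)
    simp only [hg]
    have h3 := norm_sum_smul_sq_le (θ : Space) fun j => partialDeriv j u (r • (θ : Space))
    rw [← fderiv_eq_sum, norm_unitSphere, one_pow, one_mul] at h3
    have h4 := real_inner_le_norm (u (r • (θ : Space))) (fderiv ℝ u (r • (θ : Space)) (θ : Space))
    have h5 := two_mul_le_add_sq ‖u (r • (θ : Space))‖ ‖fderiv ℝ u (r • (θ : Space)) (θ : Space)‖
    have h6 : 2 * inner ℝ (u (r • (θ : Space))) (fderiv ℝ u (r • (θ : Space)) (θ : Space))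
        ≤ ‖u (r • (θ : Space))‖ ^ 2 + ∑ j, ‖partialDeriv j u (r • (θ : Space))‖ ^ 2 := by
      nlinarith
    have h7 := mul_le_mul_of_nonneg_left h6 hr0.le
    have h8 : r * (‖u (r • (θ : Space))‖ ^ 2 + ∑ j, ‖partialDeriv j u (r • (θ : Space))‖ ^ 2)
        ≤ R * (‖u (r • (θ : Space))‖ ^ 2 + ∑ j, ‖partialDeriv j u (r • (θ : Space))‖ ^ 2) :=
      mul_le_mul_of_nonneg_right hr.2.le (by positivity)
    linarith

/-- By the trace inequality, `H¹` convergent sequences of test spinors converge in `L²` of the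
sphere. -/
lemma exists_sphere_trace {u : ℕ → Space → Spinor} {f : L2Spinor} {F : Fin 3 → L2Spinor}
    (h : H1Tendsto u f F) {R : ℝ} (hR : 0 < R) :
    ∃ T : Lp Spinor 2 (surfaceMeasure R),
      Tendsto (fun n => eLpNorm (fun x => u n x - T x) 2 (surfaceMeasure R)) atTop (𝓝 0) := by
  have hc : CauchySeq fun n => ((h.test n).memLp (surfaceMeasure R)).toLp (u n) := by
    rw [cauchySeq_iff_tendsto_dist_atTop_0]
    have h0 := cauchySeq_iff_tendsto_dist_atTop_0.1
        ((tendsto_toLp_iff (fun n => (h.test n).memLp volume) f).2 h.tendsto).cauchySeq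
    have h1 : ∀ k, Tendsto (fun n : ℕ × ℕ =>
        dist ((((h.test n.1).partialDeriv k).memLp volume).toLp (partialDeriv k (u n.1)))
          ((((h.test n.2).partialDeriv k).memLp volume).toLp (partialDeriv k (u n.2)))) atTop
        (𝓝 0) := fun k =>
      cauchySeq_iff_tendsto_dist_atTop_0.1
        ((tendsto_toLp_iff (fun n => ((h.test n).partialDeriv k).memLp volume) (F k)).2
          (h.tendsto_partialDeriv k)).cauchySeq
    have h2 := ((((h0.pow 2).const_mul (3 + R)).add
      ((tendsto_finsetSum Finset.univ fun k _ => (h1 k).pow 2).const_mul R)).const_mul R⁻¹).sqrt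
    simp only [ne_eq, OfNat.ofNat_ne_zero, not_false_eq_true, zero_pow, mul_zero,
      Finset.sum_const_zero, add_zero, Real.sqrt_zero] at h2
    refine squeeze_zero (fun _ => dist_nonneg) (fun n => Real.le_sqrt_of_sq_le ?_) h2
    have ht := (h.test n.1).sub (h.test n.2)
    have h3 := sphereInt_norm_sq_le ht hR
    have h4 : ‖(ht.memLp (surfaceMeasure R)).toLp (u n.1 - u n.2)‖ ^ 2
        = R ^ 2 * sphereInt (fun x => ‖(u n.1 - u n.2) x‖ ^ 2) R := by
      rw [norm_toLp_sq, integral_surfaceMeasure hR.ne']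
    have h5 : R ^ 2 * sphereInt (fun x => ‖(u n.1 - u n.2) x‖ ^ 2) R
        = R⁻¹ * (R ^ 3 * sphereInt (fun x => ‖(u n.1 - u n.2) x‖ ^ 2) R) := by
      field_simp
    have h6 := h4.le.trans (h5.le.trans (mul_le_mul_of_nonneg_left h3 (inv_nonneg.2 hR.le)))
    rw [← norm_toLp_sq (ht.memLp volume)] at h6
    have h7 : ∀ k, ∫ x, ‖partialDeriv k (u n.1 - u n.2) x‖ ^ 2
        = ‖(((h.test n.1).partialDeriv k).memLp volume).toLp (partialDeriv k (u n.1))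
          - (((h.test n.2).partialDeriv k).memLp volume).toLp (partialDeriv k (u n.2))‖ ^ 2 :=
      fun k => by
        rw [partialDeriv_sub (h.test n.1) (h.test n.2)]
        exact (norm_toLp_sq ((((h.test n.1).partialDeriv k).memLp volume).sub
          (((h.test n.2).partialDeriv k).memLp volume))).symm
    simp only [h7] at h6
    simp only [dist_eq_norm]
    exact h6
  obtain ⟨T, hT⟩ := cauchySeq_tendsto_of_complete hc
  exact ⟨T, (tendsto_toLp_iff _ T).1 hT⟩

lemma H1Tendsto.isSphereTrace {u : ℕ → Space → Spinor} {f : L2Spinor} {F : Fin 3 → L2Spinor}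
    (h : H1Tendsto u f F) {R : ℝ} {T : Space → Spinor} (hT : MemLp T 2 (surfaceMeasure R))
    (ht : Tendsto (fun n => eLpNorm (fun x => u n x - T x) 2 (surfaceMeasure R)) atTop (𝓝 0)) :
    IsSphereTrace R f T :=
  ⟨hT, u, F, h.isWeakGradient, h.test, h.tendsto, h.tendsto_partialDeriv, ht⟩

/-! ### Limits of spherical integrals -/

lemma lintegral_enorm_mul_le {f g : Space → Spinor} (hf : MemLp f 2 volume)
    (hg : MemLp g 2 volume) :
    ∫⁻ x, ‖f x‖ₑ * ‖g x‖ₑ ≤ eLpNorm f 2 volume * eLpNorm g 2 volume := by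
  have h := eLpNorm_smul_le_mul_eLpNorm (p := 2) (q := 2) (r := 1) hg.1 hf.1.norm
  rw [eLpNorm_one_eq_lintegral_enorm, eLpNorm_norm] at h
  refine le_trans (le_of_eq (lintegral_congr fun x => ?_)) h
  simp [enorm_smul]

lemma integrable_inner_of_memLp {f g : Space → Spinor} (hf : MemLp f 2 volume)
    (hg : MemLp g 2 volume) : Integrable fun x => inner ℝ (f x) (g x) := by
  refine ⟨hf.1.inner hg.1, ?_⟩
  refine lt_of_le_of_lt ?_ (lt_of_le_of_lt (lintegral_enorm_mul_le hf hg)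
    (ENNReal.mul_lt_top hf.2 hg.2))
  refine lintegral_mono fun x => ?_
  rw [← enorm_norm (f x), ← enorm_norm (g x), ← enorm_mul]
  exact enorm_le_iff_norm_le.2 (by simpa using abs_real_inner_le_norm (f x) (g x))

/-- Inner products of `L²` convergent sequences converge in `L¹`. -/
lemma tendsto_lintegral_enorm_inner_sub {f g : ℕ → Space → Spinor} {F G : Space → Spinor}
    (hf : ∀ n, MemLp (f n) 2 volume) (hg : ∀ n, MemLp (g n) 2 volume) (hF : MemLp F 2 volume)
    (hG : MemLp G 2 volume)
    (h1 : Tendsto (fun n => eLpNorm (fun x => f n x - F x) 2 volume) atTop (𝓝 0))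
    (h2 : Tendsto (fun n => eLpNorm (fun x => g n x - G x) 2 volume) atTop (𝓝 0)) :
    Tendsto (fun n => ∫⁻ x, ‖inner ℝ (f n x) (g n x) - inner ℝ (F x) (G x)‖ₑ) atTop (𝓝 0) := by
  have hlim : Tendsto (fun n => eLpNorm (fun x => f n x - F x) 2 volume
      * eLpNorm (fun x => g n x - G x) 2 volume
      + eLpNorm (fun x => f n x - F x) 2 volume * eLpNorm G 2 volume
      + eLpNorm F 2 volume * eLpNorm (fun x => g n x - G x) 2 volume) atTop (𝓝 0) := by
    have a1 := ENNReal.Tendsto.mul h1 (Or.inr ENNReal.zero_ne_top) h2 (Or.inr ENNReal.zero_ne_top)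
    have a2 := ENNReal.Tendsto.mul_const (b := eLpNorm G 2 volume) h1 (Or.inr hG.2.ne)
    have a3 := ENNReal.Tendsto.const_mul (a := eLpNorm F 2 volume) h2 (Or.inr hF.2.ne)
    simpa using (a1.add a2).add a3
  refine tendsto_of_tendsto_of_tendsto_of_le_of_le tendsto_const_nhds hlim (fun _ => zero_le)
    fun n => ?_
  have hfF : MemLp (fun x => f n x - F x) 2 volume := (hf n).sub hF
  have hgG : MemLp (fun x => g n x - G x) 2 volume := (hg n).sub hG
  have m1 : AEMeasurable (fun x => ‖f n x - F x‖ₑ * ‖g n x - G x‖ₑ) :=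
    hfF.1.enorm.mul hgG.1.enorm
  have m2 : AEMeasurable (fun x => ‖f n x - F x‖ₑ * ‖G x‖ₑ) := hfF.1.enorm.mul hG.1.enorm
  have m3 : AEMeasurable (fun x => ‖f n x - F x‖ₑ * ‖g n x - G x‖ₑ
      + ‖f n x - F x‖ₑ * ‖G x‖ₑ) := m1.add m2
  refine le_trans ?_ (add_le_add (add_le_add (lintegral_enorm_mul_le hfF hgG)
    (lintegral_enorm_mul_le hfF hG)) (lintegral_enorm_mul_le hF hgG))
  rw [← lintegral_add_left' m1, ← lintegral_add_left' m3]
  refine lintegral_mono fun x => ?_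
  have e : inner ℝ (f n x) (g n x) - inner ℝ (F x) (G x)
      = inner ℝ (f n x - F x) (g n x - G x) + inner ℝ (f n x - F x) (G x)
        + inner ℝ (F x) (g n x - G x) := by
    simp only [inner_sub_left, inner_sub_right]; ring
  have hb : ∀ a b : Spinor, ‖(inner ℝ a b : ℝ)‖ₑ ≤ ‖a‖ₑ * ‖b‖ₑ := fun a b => by
    rw [← enorm_norm a, ← enorm_norm b, ← enorm_mul]
    exact enorm_le_iff_norm_le.2 (by simpa using abs_real_inner_le_norm a b)
  simp only [e]
  exact (enorm_add_le _ _).trans (add_le_add ((enorm_add_le _ _).trans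
    (add_le_add (hb _ _) (hb _ _))) (hb _ _))

lemma tendsto_sphereInt_inner {f g : ℕ → Space → Spinor} {F G : Space → Spinor}
    (hf : ∀ n, MemLp (f n) 2 volume) (hg : ∀ n, MemLp (g n) 2 volume) (hF : MemLp F 2 volume)
    (hG : MemLp G 2 volume)
    (h1 : Tendsto (fun n => eLpNorm (fun x => f n x - F x) 2 volume) atTop (𝓝 0))
    (h2 : Tendsto (fun n => eLpNorm (fun x => g n x - G x) 2 volume) atTop (𝓝 0)) :
    Tendsto (fun n => ∫⁻ r, ‖sphereInt (fun x => inner ℝ (f n x) (g n x)) r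
      - sphereInt (fun x => inner ℝ (F x) (G x)) r‖ₑ ∂radialMeasure) atTop (𝓝 0) :=
  tendsto_of_tendsto_of_tendsto_of_le_of_le tendsto_const_nhds
    (tendsto_lintegral_enorm_inner_sub hf hg hF hG h1 h2) (fun _ => zero_le) fun n =>
    lintegral_enorm_sphereInt_sub_le (integrable_inner_of_memLp (hf n) (hg n))
      (integrable_inner_of_memLp hF hG)

/-- A sequence dominated by three null sequences of `L²` is a null sequence. -/
lemma tendsto_eLpNorm_zero_of_le_sum {h : ℕ → Space → Spinor} {G : Fin 3 → ℕ → Space → Spinor}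
    (hm : ∀ j n, AEStronglyMeasurable (G j n) volume)
    (hG : ∀ j, Tendsto (fun n => eLpNorm (G j n) 2 volume) atTop (𝓝 0)) (C : ℝ)
    (hle : ∀ n x, ‖h n x‖ ≤ C * ∑ j, ‖G j n x‖) :
    Tendsto (fun n => eLpNorm (h n) 2 volume) atTop (𝓝 0) := by
  have hG' : ∀ j, Tendsto (fun n => eLpNorm (fun x => ‖G j n x‖) 2 volume) atTop (𝓝 0) :=
      fun j => by
    simpa only [eLpNorm_norm] using hG j
  have h1 := tendsto_eLpNorm_zero_add (fun n => ((hm 0 n).norm.add (hm 1 n).norm))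
    (fun n => (hm 2 n).norm) (tendsto_eLpNorm_zero_add (fun n => (hm 0 n).norm)
      (fun n => (hm 1 n).norm) (hG' 0) (hG' 1)) (hG' 2)
  refine tendsto_eLpNorm_zero_of_le h1 C fun n x => (hle n x).trans (le_of_eq ?_)
  have h2 : 0 ≤ ‖G 0 n x‖ + ‖G 1 n x‖ + ‖G 2 n x‖ := by positivity
  rw [Fin.sum_univ_three]
  exact congrArg _ (Real.norm_of_nonneg h2).symm

/-- The radial component `∑ⱼ (xⱼ / |x|) Fⱼ` of a gradient. -/
def radialPart (F : Fin 3 → Space → Spinor) (x : Space) : Spinor := ∑ j, (‖x‖⁻¹ • x) j • F j x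

lemma norm_radialPart_le (F : Fin 3 → Space → Spinor) (x : Space) :
    ‖radialPart F x‖ ≤ 1 * ∑ j, ‖F j x‖ := by
  have h1 : ‖‖x‖⁻¹ • x‖ ≤ 1 := by
    rw [norm_smul, norm_inv, norm_norm]
    exact inv_mul_le_one
  refine (norm_sum_le _ _).trans ?_
  rw [one_mul]
  refine Finset.sum_le_sum fun j _ => ?_
  rw [norm_smul]
  exact mul_le_of_le_one_left (norm_nonneg _) ((PiLp.norm_apply_le _ j).trans h1)

lemma radialDeriv_eq (u : Space → Spinor) :
    radialDeriv u = radialPart fun j => partialDeriv j u := by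
  funext x
  simp [radialDeriv, radialPart, euler_eq_sum, Finset.smul_sum, smul_smul]

lemma radialPart_sub (F G : Fin 3 → Space → Spinor) (x : Space) :
    radialPart F x - radialPart G x = radialPart (fun j x => F j x - G j x) x := by
  simp [radialPart, smul_sub, Finset.sum_sub_distrib]

lemma memLp_radialPart {F : Fin 3 → Space → Spinor} (hF : ∀ j, MemLp (F j) 2 volume) :
    MemLp (radialPart F) 2 volume := by
  have hs : MemLp (fun x => ∑ j, ‖F j x‖) 2 volume := memLp_finsetSum _ fun j _ => (hF j).norm
  refine hs.of_le_mul (c := 1) ?_ (ae_of_all _ fun x => ?_)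
  · refine Finset.aestronglyMeasurable_fun_sum _ fun j _ => ?_
    have : Measurable fun x : Space => (‖x‖⁻¹ • x) j := by
      simp only [PiLp.smul_apply]
      fun_prop
    exact this.aestronglyMeasurable.smul (hF j).1
  · rw [Real.norm_of_nonneg (Finset.sum_nonneg fun _ _ => norm_nonneg _)]
    exact norm_radialPart_le F x

lemma norm_pauliDot_le (a : Fin 3 → Spinor) : ‖pauliDot a‖ ≤ ‖pauliDotL‖ * ∑ j, ‖a j‖ := by
  refine (pauliDotL.le_opNorm a).trans (mul_le_mul_of_nonneg_left ?_ (norm_nonneg _))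
  exact (pi_norm_le_iff_of_nonneg (Finset.sum_nonneg fun _ _ => norm_nonneg _)).2 fun j =>
    Finset.single_le_sum (f := fun j => ‖a j‖) (fun _ _ => norm_nonneg _) (Finset.mem_univ j)

lemma memLp_pauliDot {F : Fin 3 → Space → Spinor} (hF : ∀ j, MemLp (F j) 2 volume) :
    MemLp (fun x => pauliDot fun j => F j x) 2 volume := by
  have hs : MemLp (fun x => ∑ j, ‖F j x‖) 2 volume := memLp_finsetSum _ fun j _ => (hF j).norm
  refine hs.of_le_mul (c := ‖pauliDotL‖) ?_ (ae_of_all _ fun x => ?_)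
  · refine Finset.aestronglyMeasurable_fun_sum _ fun j _ => ?_
    exact (LinearMap.continuous_of_finiteDimensional
      (Matrix.toEuclideanLin (pauli j))).comp_aestronglyMeasurable (hF j).1
  · rw [Real.norm_of_nonneg (Finset.sum_nonneg fun _ _ => norm_nonneg _)]
    exact norm_pauliDot_le _

section

variable {u : ℕ → Space → Spinor} {f : L2Spinor} {F : Fin 3 → L2Spinor}

lemma H1Tendsto.tendsto_radialDeriv (h : H1Tendsto u f F) :
    Tendsto (fun n => eLpNorm (fun x => radialDeriv (u n) x - radialPart (fun j => F j) x) 2 volume)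
      atTop (𝓝 0) := by
  refine tendsto_eLpNorm_zero_of_le_sum (fun j n =>
    (((h.test n).partialDeriv j).continuous.aestronglyMeasurable.sub
      (Lp.aestronglyMeasurable (F j)))) h.tendsto_partialDeriv 1 fun n x => ?_
  rw [radialDeriv_eq, radialPart_sub]
  exact norm_radialPart_le _ x

lemma H1Tendsto.tendsto_dirac (h : H1Tendsto u f F) :
    Tendsto (fun n => eLpNorm (fun x => dirac (u n) x - pauliDot fun j => F j x) 2 volume)
      atTop (𝓝 0) := by
  refine tendsto_eLpNorm_zero_of_le_sum (fun j n =>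
    (((h.test n).partialDeriv j).continuous.aestronglyMeasurable.sub
      (Lp.aestronglyMeasurable (F j)))) h.tendsto_partialDeriv ‖pauliDotL‖ fun n x => ?_
  rw [dirac, ← pauliDot_sub]
  exact norm_pauliDot_le _

lemma H1Tendsto.memLp_radialDeriv (h : H1Tendsto u f F) (n : ℕ) :
    MemLp (radialDeriv (u n)) 2 volume := by
  rw [radialDeriv_eq]
  exact memLp_radialPart fun j => ((h.test n).partialDeriv j).memLp volume

end

/-! ### Radial functions -/

lemma integrable_of_radialMeasure {g : ℝ → ℝ} (hg : Integrable g radialMeasure) {c a b : ℝ}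
    (hc : 0 < c) (ha : c ≤ a) (hb : c ≤ b) : IntervalIntegrable g volume a b ∧
      |∫ r in a..b, g r| ≤ (c ^ 2)⁻¹ * ∫ r, |g r| ∂radialMeasure := by
  have hsub : uIoc a b ⊆ Ioi c := fun r hr => lt_of_le_of_lt (le_min ha hb) hr.1
  have hsub0 : Ioi c ⊆ Ioi 0 := Ioi_subset_Ioi hc.le
  have h1 := integrable_radialMeasure_iff.1 hg
  have hle : ∀ r ∈ Ioi c, |g r| ≤ (c ^ 2)⁻¹ * (r ^ 2 * |g r|) := fun r hr => by
    have hr' : c < r := hr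
    rw [← mul_assoc]
    refine le_mul_of_one_le_left (abs_nonneg _) ?_
    rw [inv_mul_eq_div, one_le_div (by positivity)]
    exact pow_le_pow_left₀ hc.le hr'.le 2
  have h2 : IntegrableOn (fun r => r ^ 2 * |g r|) (Ioi 0) := by
    refine h1.norm.congr (ae_of_all _ fun r => ?_)
    simp
  have h3 : IntegrableOn (fun r => (c ^ 2)⁻¹ * (r ^ 2 * |g r|)) (Ioi c) :=
    (h2.mono_set hsub0).const_mul _
  have hgm : AEStronglyMeasurable g (volume.restrict (Ioi c)) := by
    have : AEStronglyMeasurable (fun r => (r ^ 2)⁻¹ * (r ^ 2 * g r)) (volume.restrict (Ioi c)) :=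
      ((by fun_prop : Measurable fun r : ℝ => (r ^ 2)⁻¹).aestronglyMeasurable).mul
        (h1.mono_set hsub0).1
    refine this.congr ((ae_restrict_iff' measurableSet_Ioi).2 (ae_of_all _ fun r hr => ?_))
    have hr' : 0 < r := hc.trans hr
    field_simp
  have h4 : IntegrableOn g (Ioi c) :=
    h3.mono' hgm ((ae_restrict_iff' measurableSet_Ioi).2 (ae_of_all _ fun r hr => hle r hr))
  refine ⟨intervalIntegrable_iff.2 (h4.mono_set hsub), ?_⟩
  calc |∫ r in a..b, g r| ≤ ∫ r in uIoc a b, ‖g r‖ := by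
        rw [← Real.norm_eq_abs]
        exact intervalIntegral.norm_integral_le_integral_norm_uIoc
    _ ≤ ∫ r in Ioi c, |g r| :=
        setIntegral_mono_set h4.norm (ae_of_all _ fun r => norm_nonneg _) hsub.eventuallyLE
    _ ≤ ∫ r in Ioi c, (c ^ 2)⁻¹ * (r ^ 2 * |g r|) :=
        setIntegral_mono_on h4.norm h3 measurableSet_Ioi hle
    _ = (c ^ 2)⁻¹ * ∫ r in Ioi c, r ^ 2 * |g r| := integral_const_mul _ _
    _ ≤ (c ^ 2)⁻¹ * ∫ r, |g r| ∂radialMeasure := by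
        rw [integral_radialMeasure]
        refine mul_le_mul_of_nonneg_left (setIntegral_mono_set h2
          (ae_of_all _ fun r => by simp only [Pi.zero_apply]; positivity) hsub0.eventuallyLE)
          (by positivity)

/-- The integrals over compact subintervals of `(0, ∞)` converge when the functions converge in
`L¹(r² dr)`. -/
lemma tendsto_intervalIntegral {g : ℕ → ℝ → ℝ} {G : ℝ → ℝ}
    (hg : ∀ n, Integrable (g n) radialMeasure)
    (hG : Integrable G radialMeasure)
    (h : Tendsto (fun n => ∫⁻ r, ‖g n r - G r‖ₑ ∂radialMeasure) atTop (𝓝 0)) {a b : ℝ}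
    (ha : 0 < a) (hb : 0 < b) :
    Tendsto (fun n => ∫ r in a..b, g n r) atTop (𝓝 (∫ r in a..b, G r)) := by
  rw [tendsto_iff_norm_sub_tendsto_zero]
  set c := min a b
  have hc : 0 < c := lt_min ha hb
  have h1 : Tendsto (fun n => (c ^ 2)⁻¹ * ∫ r, |g n r - G r| ∂radialMeasure) atTop (𝓝 0) := by
    have h2 : ∀ n, ∫ r, |g n r - G r| ∂radialMeasure
        = (∫⁻ r, ‖g n r - G r‖ₑ ∂radialMeasure).toReal := fun n =>
      integral_norm_eq_lintegral_enorm ((hg n).sub hG).1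
    simp only [h2]
    have h3 := (ENNReal.tendsto_toReal ENNReal.zero_ne_top).comp h
    simpa using h3.const_mul (c ^ 2)⁻¹
  refine squeeze_zero (fun n => norm_nonneg _) (fun n => ?_) h1
  rw [← intervalIntegral.integral_sub
    (integrable_of_radialMeasure (hg n) hc (min_le_left a b) (min_le_right a b)).1
    (integrable_of_radialMeasure hG hc (min_le_left a b) (min_le_right a b)).1]
  exact (integrable_of_radialMeasure ((hg n).sub hG) hc (min_le_left a b) (min_le_right a b)).2

/-- Functions converging in `L¹(r² dr)` have a subsequence converging almost everywhere; a common
one can be chosen for finitely many sequences. -/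
lemma exists_subseq_tendsto_ae {ι : Type*} [Fintype ι] {g : ι → ℕ → ℝ → ℝ} {G : ι → ℝ → ℝ}
    (hg : ∀ i n, Integrable (g i n) radialMeasure) (hG : ∀ i, Integrable (G i) radialMeasure)
    (h : ∀ i, Tendsto (fun n => ∫⁻ r, ‖g i n r - G i r‖ₑ ∂radialMeasure) atTop (𝓝 0)) :
    ∃ ns : ℕ → ℕ, StrictMono ns ∧ ∀ᵐ r ∂(volume.restrict (Ioi (0 : ℝ))), ∀ i,
      Tendsto (fun k => g i (ns k) r) atTop (𝓝 (G i r)) := by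
  have hm : ∀ i n, AEStronglyMeasurable (fun r => ‖g i n r - G i r‖) radialMeasure := fun i n =>
    ((hg i n).sub (hG i)).1.norm
  have h1 : Tendsto (fun n => eLpNorm ((fun r => ∑ i, ‖g i n r - G i r‖) - fun _ => (0 : ℝ)) 1
      radialMeasure) atTop (𝓝 0) := by
    have h2 := tendsto_finsetSum Finset.univ fun i _ => h i
    rw [Finset.sum_const_zero] at h2
    refine tendsto_of_tendsto_of_tendsto_of_le_of_le tendsto_const_nhds h2 (fun _ => zero_le)
      fun n => ?_
    rw [eLpNorm_one_eq_lintegral_enorm, ← lintegral_finsetSum' _ fun i _ => (hm i n).enorm.congr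
      (ae_of_all _ fun r => enorm_norm _)]
    refine lintegral_mono fun r => ?_
    simp only [Pi.sub_apply, sub_zero]
    refine (enorm_sum_le _ _).trans (le_of_eq ?_)
    simp only [enorm_norm]
  obtain ⟨ns, hns, hae⟩ := (tendstoInMeasure_of_tendsto_eLpNorm one_ne_zero
    (fun n => Finset.aestronglyMeasurable_fun_sum _ fun i _ => hm i n) aestronglyMeasurable_const
    h1).exists_seq_tendsto_ae
  refine ⟨ns, hns, ?_⟩
  rw [← ae_radialMeasure_iff]
  filter_upwards [hae] with r hr i
  rw [tendsto_iff_norm_sub_tendsto_zero]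
  exact squeeze_zero (fun _ => norm_nonneg _) (fun k => Finset.single_le_sum
    (f := fun i => ‖g i (ns k) r - G i r‖) (fun _ _ => norm_nonneg _) (Finset.mem_univ i)) hr

/-! ### Radial data of an `H¹` spinor -/

/-- The derivative of `r ↦ ∫ |f(rθ)|² dθ`, for `f` with gradient `F`. -/
def radialFlux (f : L2Spinor) (F : Fin 3 → L2Spinor) (r : ℝ) : ℝ :=
  2 * sphereInt (fun x => inner ℝ (f x) (radialPart (fun j => F j) x)) r

/-- The continuous version of `r ↦ ∫ |f(rθ)|² dθ`, for `f` with gradient `F` and trace `T` on the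
sphere of radius `R`. -/
def radialMass (R : ℝ) (T : Space → Spinor) (f : L2Spinor) (F : Fin 3 → L2Spinor) (r : ℝ) : ℝ :=
  (R ^ 2)⁻¹ * ∫ x, ‖T x‖ ^ 2 ∂surfaceMeasure R + ∫ s in R..r, radialFlux f F s

lemma integrable_radialFlux (f : L2Spinor) (F : Fin 3 → L2Spinor) :
    Integrable (radialFlux f F) radialMeasure :=
  (integrable_sphereInt (integrable_inner_of_memLp (Lp.memLp f)
    (memLp_radialPart fun j => Lp.memLp (F j)))).const_mul 2

lemma radialMass_sub (R : ℝ) (hR : 0 < R) (T : Space → Spinor) (f : L2Spinor)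
    (F : Fin 3 → L2Spinor) {a b : ℝ} (ha : 0 < a) (hb : 0 < b) :
    radialMass R T f F b - radialMass R T f F a = ∫ s in a..b, radialFlux f F s := by
  have hi : ∀ {c : ℝ}, 0 < c → IntervalIntegrable (radialFlux f F) volume R c := fun hc =>
    (integrable_of_radialMeasure (integrable_radialFlux f F) (lt_min hR hc) (min_le_left _ _)
      (min_le_right _ _)).1
  rw [radialMass, radialMass, add_sub_add_left_eq_sub,
    intervalIntegral.integral_interval_sub_left (hi hb) (hi ha)]

lemma tendsto_integral_norm_sq {X : Type*} [MeasurableSpace X] {μ : Measure X}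
    {u : ℕ → X → Spinor} {T : X → Spinor} (hu : ∀ n, MemLp (u n) 2 μ) (hT : MemLp T 2 μ)
    (h : Tendsto (fun n => eLpNorm (fun x => u n x - T x) 2 μ) atTop (𝓝 0)) :
    Tendsto (fun n => ∫ x, ‖u n x‖ ^ 2 ∂μ) atTop (𝓝 (∫ x, ‖T x‖ ^ 2 ∂μ)) := by
  simp only [← norm_toLp_sq (hu _), ← norm_toLp_sq hT]
  exact (((Lp.tendsto_Lp_iff_tendsto_eLpNorm'' u hu T hT).2 h).norm).pow 2

lemma integrable_norm_sq_Lp (f : L2Spinor) : Integrable fun x => ‖f x‖ ^ 2 := by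
  simpa only [real_inner_self_eq_norm_sq] using integrable_inner_of_memLp (Lp.memLp f) (Lp.memLp f)

section

variable {u : ℕ → Space → Spinor} {f : L2Spinor} {F : Fin 3 → L2Spinor}

lemma H1Tendsto.tendsto_radialFlux (h : H1Tendsto u f F) :
    Tendsto (fun n => ∫⁻ r, ‖2 * sphereInt (fun x => inner ℝ (u n x) (radialDeriv (u n) x)) r
      - radialFlux f F r‖ₑ ∂radialMeasure) atTop (𝓝 0) := by
  have h1 := tendsto_sphereInt_inner (fun n => (h.test n).memLp volume) h.memLp_radialDeriv
    (Lp.memLp f) (memLp_radialPart fun j => Lp.memLp (F j)) h.tendsto h.tendsto_radialDeriv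
  have h2 := ENNReal.Tendsto.const_mul (a := 2) h1 (Or.inr ENNReal.ofNat_ne_top)
  rw [mul_zero] at h2
  refine h2.congr fun n => ?_
  rw [← lintegral_const_mul' _ _ ENNReal.ofNat_ne_top]
  refine lintegral_congr fun r => ?_
  rw [radialFlux, ← mul_sub, enorm_mul]
  congr 1
  simp [Real.enorm_eq_ofReal_abs]

lemma H1Tendsto.integrable_radialFlux (h : H1Tendsto u f F) (n : ℕ) :
    Integrable (fun r => 2 * sphereInt (fun x => inner ℝ (u n x) (radialDeriv (u n) x)) r)
      radialMeasure :=
  (integrable_sphereInt (integrable_inner_of_memLp ((h.test n).memLp volume)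
    (h.memLp_radialDeriv n))).const_mul 2

lemma H1Tendsto.tendsto_radialMass (h : H1Tendsto u f F) {R : ℝ} (hR : 0 < R)
    {T : Space → Spinor} (hT : MemLp T 2 (surfaceMeasure R))
    (ht : Tendsto (fun n => eLpNorm (fun x => u n x - T x) 2 (surfaceMeasure R)) atTop (𝓝 0))
    {r : ℝ} (hr : 0 < r) :
    Tendsto (fun n => sphereInt (fun x => ‖u n x‖ ^ 2) r) atTop (𝓝 (radialMass R T f F r)) := by
  have h1 :=
      (tendsto_integral_norm_sq (fun n => (h.test n).memLp (surfaceMeasure R)) hT ht).const_mul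
    (R ^ 2)⁻¹
  have h2 := tendsto_intervalIntegral h.integrable_radialFlux
    (DiracHardy.integrable_radialFlux f F) h.tendsto_radialFlux hR hr
  refine (h1.add h2).congr fun n => ?_
  have h3 := sphereInt_norm_sq_sub (h.test n) hR hr
  have h4 : ∀ s, sphereInt (fun x => 2 * inner ℝ (u n x) (radialDeriv (u n) x)) s
      = 2 * sphereInt (fun x => inner ℝ (u n x) (radialDeriv (u n) x)) s := fun s =>
    integral_const_mul _ _
  simp only [h4] at h3
  rw [← h3, integral_surfaceMeasure hR.ne', ← mul_assoc,
    inv_mul_cancel₀ (pow_ne_zero 2 hR.ne'), one_mul]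
  ring

lemma H1Tendsto.tendsto_sphereInt (h : H1Tendsto u f F) :
    Tendsto (fun n => ∫⁻ r, ‖sphereInt (fun x => ‖u n x‖ ^ 2) r
      - sphereInt (fun x => ‖f x‖ ^ 2) r‖ₑ ∂radialMeasure) atTop (𝓝 0) := by
  simpa only [real_inner_self_eq_norm_sq] using tendsto_sphereInt_inner
    (fun n => (h.test n).memLp volume) (fun n => (h.test n).memLp volume) (Lp.memLp f)
    (Lp.memLp f) h.tendsto h.tendsto

lemma H1Tendsto.tendsto_sphereInt_dirac (h : H1Tendsto u f F) :
    Tendsto (fun n => ∫⁻ r, ‖sphereInt (fun x => ‖dirac (u n) x‖ ^ 2) r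
      - sphereInt (fun x => ‖pauliDot fun j => F j x‖ ^ 2) r‖ₑ ∂radialMeasure) atTop (𝓝 0) := by
  have hm := memLp_pauliDot fun j => Lp.memLp (F j)
  simpa only [real_inner_self_eq_norm_sq] using tendsto_sphereInt_inner
    (fun n => (h.test n).dirac.memLp volume) (fun n => (h.test n).dirac.memLp volume) hm hm
    h.tendsto_dirac h.tendsto_dirac

lemma H1Tendsto.radialMass_ae_eq (h : H1Tendsto u f F) {R : ℝ} (hR : 0 < R)
    {T : Space → Spinor} (hT : MemLp T 2 (surfaceMeasure R))
    (ht : Tendsto (fun n => eLpNorm (fun x => u n x - T x) 2 (surfaceMeasure R)) atTop (𝓝 0)) :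
    ∀ᵐ r ∂(volume.restrict (Ioi (0 : ℝ))),
      radialMass R T f F r = sphereInt (fun x => ‖f x‖ ^ 2) r := by
  obtain ⟨ns, hns, hae⟩ := exists_subseq_tendsto_ae (ι := Unit)
    (g := fun _ n => sphereInt fun x => ‖u n x‖ ^ 2) (G := fun _ => sphereInt fun x => ‖f x‖ ^ 2)
    (fun _ n => integrable_sphereInt (h.test n).integrable_norm_sq)
    (fun _ => integrable_sphereInt (integrable_norm_sq_Lp f)) fun _ => h.tendsto_sphereInt
  filter_upwards [hae, ae_restrict_mem measurableSet_Ioi] with r hr hr0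
  exact tendsto_nhds_unique ((h.tendsto_radialMass hR hT ht hr0).comp hns.tendsto_atTop) (hr ())

lemma integrable_norm_sq_pauliDot (D : Fin 3 → L2Spinor) :
    Integrable fun x => ‖pauliDot fun j => D j x‖ ^ 2 := by
  have hm := memLp_pauliDot fun j => Lp.memLp (D j)
  simpa only [real_inner_self_eq_norm_sq] using integrable_inner_of_memLp hm hm

end

/-- The functions of the radius to which the problem reduces: the spherical integrals `S` of
`|σ · ∇φ|²` and `Ap`, `Am` of `|P₊φ|²`, `|P₋φ|²`, the latter with derivatives `Bp`, `Bm`, and the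
inequality that the spectral gap of `1 + σ · L` gives on almost every sphere. -/
structure RadialData (S Ap Am Bp Bm : ℝ → ℝ) : Prop where
  integrable_energy : Integrable S radialMeasure
  integrable_pos : Integrable Ap radialMeasure
  integrable_neg : Integrable Am radialMeasure
  integrable_pos_deriv : Integrable Bp radialMeasure
  integrable_neg_deriv : Integrable Bm radialMeasure
  pos_nonneg : ∀ r, 0 < r → 0 ≤ Ap r
  neg_nonneg : ∀ r, 0 < r → 0 ≤ Am r
  energy_nonneg : ∀ r, 0 ≤ S r
  pos_sub : ∀ a b, 0 < a → 0 < b → Ap b - Ap a = ∫ s in a..b, Bp s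
  neg_sub : ∀ a b, 0 < a → 0 < b → Am b - Am a = ∫ s in a..b, Bm s
  ineq : ∀ᵐ r ∂(volume.restrict (Ioi (0 : ℝ))), ∀ t s w : ℝ, 0 ≤ t → 0 ≤ s → 0 < w →
    -t * Bp r - w * t ^ 2 * Ap r + s * (Bm r + 4 / r * Am r) - w * s ^ 2 * Am r ≤ S r / w

lemma exists_subseq_tendsto_ae_three {g g' g'' : ℕ → ℝ → ℝ} {G G' G'' : ℝ → ℝ}
    (hg : ∀ n, Integrable (g n) radialMeasure) (hg' : ∀ n, Integrable (g' n) radialMeasure)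
    (hg'' : ∀ n, Integrable (g'' n) radialMeasure) (hG : Integrable G radialMeasure)
    (hG' : Integrable G' radialMeasure) (hG'' : Integrable G'' radialMeasure)
    (h : Tendsto (fun n => ∫⁻ r, ‖g n r - G r‖ₑ ∂radialMeasure) atTop (𝓝 0))
    (h' : Tendsto (fun n => ∫⁻ r, ‖g' n r - G' r‖ₑ ∂radialMeasure) atTop (𝓝 0))
    (h'' : Tendsto (fun n => ∫⁻ r, ‖g'' n r - G'' r‖ₑ ∂radialMeasure) atTop (𝓝 0)) :
    ∃ ns : ℕ → ℕ, StrictMono ns ∧ ∀ᵐ r ∂(volume.restrict (Ioi (0 : ℝ))),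
      Tendsto (fun k => g (ns k) r) atTop (𝓝 (G r)) ∧
      Tendsto (fun k => g' (ns k) r) atTop (𝓝 (G' r)) ∧
      Tendsto (fun k => g'' (ns k) r) atTop (𝓝 (G'' r)) := by
  obtain ⟨ns, hns, hae⟩ := exists_subseq_tendsto_ae (g := ![g, g', g'']) (G := ![G, G', G''])
    (fun i n => by fin_cases i; exacts [hg n, hg' n, hg'' n])
    (fun i => by fin_cases i; exacts [hG, hG', hG''])
    (fun i => by fin_cases i; exacts [h, h', h''])
  exact ⟨ns, hns, hae.mono fun r hr => ⟨hr 0, hr 1, hr 2⟩⟩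

/-- The radial inequalities of the two channels pass to `H¹` limits. -/
lemma radial_ineq_ae {p m : ℕ → Space → Spinor} {φ fp fm : L2Spinor} {D Dp Dm : Fin 3 → L2Spinor}
    (hp : ∀ n, p n ∈ posSpan) (hm : ∀ n, m n ∈ negSpan) (hpH : H1Tendsto p fp Dp)
    (hmH : H1Tendsto m fm Dm) (hvH : H1Tendsto (fun n => p n + m n) φ D) {R : ℝ} (hR : 0 < R)
    {Tp Tm : Space → Spinor} (hTpL : MemLp Tp 2 (surfaceMeasure R))
    (hTp : Tendsto (fun n => eLpNorm (fun x => p n x - Tp x) 2 (surfaceMeasure R)) atTop (𝓝 0))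
    (hTmL : MemLp Tm 2 (surfaceMeasure R))
    (hTm : Tendsto (fun n => eLpNorm (fun x => m n x - Tm x) 2 (surfaceMeasure R)) atTop (𝓝 0)) :
    ∀ᵐ r ∂(volume.restrict (Ioi (0 : ℝ))), ∀ t s w : ℝ, 0 ≤ t → 0 ≤ s → 0 < w →
      -t * radialFlux fp Dp r - w * t ^ 2 * radialMass R Tp fp Dp r
        + s * (radialFlux fm Dm r + 4 / r * radialMass R Tm fm Dm r)
        - w * s ^ 2 * radialMass R Tm fm Dm r
      ≤ sphereInt (fun x => ‖pauliDot fun j => D j x‖ ^ 2) r / w := by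
  obtain ⟨ns, hns, hae⟩ := exists_subseq_tendsto_ae_three
    (fun n => integrable_sphereInt (hvH.test n).dirac.integrable_norm_sq)
    hpH.integrable_radialFlux hmH.integrable_radialFlux
    (integrable_sphereInt (integrable_norm_sq_pauliDot D)) (integrable_radialFlux _ _)
    (integrable_radialFlux _ _) hvH.tendsto_sphereInt_dirac hpH.tendsto_radialFlux
    hmH.tendsto_radialFlux
  filter_upwards [hae, ae_restrict_mem measurableSet_Ioi] with r hr hr0 t s w ht hs hw
  have hr0 : 0 < r := hr0
  have l0 : Tendsto (fun k => sphereInt (fun x => ‖dirac (p (ns k) + m (ns k)) x‖ ^ 2) r) atTop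
    (𝓝 (sphereInt (fun x => ‖pauliDot fun j => D j x‖ ^ 2) r)) := hr.1
  have l1 : Tendsto (fun k => 2 * sphereInt (fun x => inner ℝ (p (ns k) x)
    (radialDeriv (p (ns k)) x)) r) atTop (𝓝 (radialFlux fp Dp r)) := hr.2.1
  have l2 : Tendsto (fun k => 2 * sphereInt (fun x => inner ℝ (m (ns k) x)
    (radialDeriv (m (ns k)) x)) r) atTop (𝓝 (radialFlux fm Dm r)) := hr.2.2
  have l3 := (hpH.tendsto_radialMass hR hTpL hTp hr0).comp hns.tendsto_atTop
  have l4 := (hmH.tendsto_radialMass hR hTmL hTm hr0).comp hns.tendsto_atTop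
  refine le_of_tendsto_of_tendsto' ((((l1.const_mul (-t)).sub (l3.const_mul (w * t ^ 2))).add
    ((l2.add (l4.const_mul (4 / r))).const_mul s)).sub (l4.const_mul (w * s ^ 2)))
    (l0.div_const w) fun k => ?_
  have e1 := radial_ineq_posSpan (hp (ns k)) hr0 hw ht
  have e2 := radial_ineq_negSpan (hm (ns k)) hr0 hw hs
  have e3 := sphereInt_norm_sq_dirac_channels (hp (ns k)) (hm (ns k)) hr0
  have e4 : ∀ v : Space → Spinor, sphereInt (fun x => 2 * inner ℝ (v x) (radialDeriv v x)) r
      = 2 * sphereInt (fun x => inner ℝ (v x) (radialDeriv v x)) r := fun v =>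
    integral_const_mul _ _
  rw [e4] at e1 e2
  rw [e3, add_div]
  simp only [Function.comp_apply]
  linarith

/-- The radial data and the traces of an `H¹` spinor. -/
lemma exists_radialData {φ : L2Spinor} {D : Fin 3 → L2Spinor} (h : IsWeakGradient φ D) {R : ℝ}
    (hR : 0 < R) :
    ∃ (Tp Tm : Space → Spinor) (Ap Am Bp Bm : ℝ → ℝ),
      IsSphereTrace R (projPos φ) Tp ∧ IsSphereTrace R (projNeg φ) Tm ∧
      IsSphereTrace R φ (fun x => Tp x + Tm x) ∧
      RadialData (sphereInt fun x => ‖pauliDot fun j => D j x‖ ^ 2) Ap Am Bp Bm ∧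
      R ^ 2 * Ap R = ∫ x, ‖Tp x‖ ^ 2 ∂surfaceMeasure R ∧
      R ^ 2 * Am R = ∫ x, ‖Tm x‖ ^ 2 ∂surfaceMeasure R ∧
      R ^ 2 * (Ap R + Am R) = ∫ x, ‖Tp x + Tm x‖ ^ 2 ∂surfaceMeasure R ∧
      (∀ᵐ r ∂(volume.restrict (Ioi (0 : ℝ))), Ap r = sphereInt (fun x => ‖projPos φ x‖ ^ 2) r) ∧
      (∀ᵐ r ∂(volume.restrict (Ioi (0 : ℝ))), Am r = sphereInt (fun x => ‖projNeg φ x‖ ^ 2) r) ∧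
      ∀ᵐ r ∂(volume.restrict (Ioi (0 : ℝ))), Ap r + Am r = sphereInt (fun x => ‖φ x‖ ^ 2) r := by
  obtain ⟨p, m, Dp, Dm, hp, hm, hpH, hmH, hvH⟩ := exists_channel_approx h
  obtain ⟨Tp, hTp⟩ := exists_sphere_trace hpH hR
  obtain ⟨Tm, hTm⟩ := exists_sphere_trace hmH hR
  have hTpL := Lp.memLp Tp
  have hTmL := Lp.memLp Tm
  have hTL : MemLp (fun x => Tp x + Tm x) 2 (surfaceMeasure R) := hTpL.add hTmL
  have hT : Tendsto (fun n => eLpNorm (fun x => (p n + m n) x - (Tp x + Tm x)) 2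
      (surfaceMeasure R)) atTop (𝓝 0) := by
    have h1 := hTp.add hTm
    rw [add_zero] at h1
    refine tendsto_of_tendsto_of_tendsto_of_le_of_le tendsto_const_nhds h1 (fun _ => zero_le)
      fun n => ?_
    have h2 := eLpNorm_add_le (((hpH.test n).memLp (surfaceMeasure R)).sub hTpL).1
      (((hmH.test n).memLp (surfaceMeasure R)).sub hTmL).1 (one_le_two (α := ℝ≥0∞))
    refine le_trans (le_of_eq ?_) h2
    congr 1
    funext x
    simp only [Pi.add_apply, Pi.sub_apply]
    abel
  have hA : ∀ T f F, radialMass R T f F R = (R ^ 2)⁻¹ * ∫ x, ‖T x‖ ^ 2 ∂surfaceMeasure R :=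
    fun T f F => by rw [radialMass, intervalIntegral.integral_same, add_zero]
  have hR2 : R ^ 2 ≠ 0 := pow_ne_zero 2 hR.ne'
  have hsum : ∀ r, 0 < r → radialMass R Tp (projPos φ) Dp r + radialMass R Tm (projNeg φ) Dm r
      = radialMass R (fun x => Tp x + Tm x) φ D r := fun r hr => by
    refine tendsto_nhds_unique ((hpH.tendsto_radialMass hR hTpL hTp hr).add
      (hmH.tendsto_radialMass hR hTmL hTm hr)) ?_
    refine (hvH.tendsto_radialMass hR hTL hT hr).congr fun n => ?_
    exact sphereInt_norm_sq_channels (hp n) (hm n) hr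
  have hAp := hpH.radialMass_ae_eq hR hTpL hTp
  have hAm := hmH.radialMass_ae_eq hR hTmL hTm
  have hint : ∀ {T f F}, (∀ᵐ r ∂(volume.restrict (Ioi (0 : ℝ))),
      radialMass R T f F r = sphereInt (fun x => ‖f x‖ ^ 2) r) →
      Integrable (radialMass R T f F) radialMeasure := fun {T f F} hae =>
    (integrable_sphereInt (integrable_norm_sq_Lp f)).congr
      (ae_radialMeasure_iff.2 (hae.mono fun r hr => hr.symm))
  refine ⟨Tp, Tm, radialMass R Tp (projPos φ) Dp, radialMass R Tm (projNeg φ) Dm,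
    radialFlux (projPos φ) Dp, radialFlux (projNeg φ) Dm, hpH.isSphereTrace hTpL hTp,
    hmH.isSphereTrace hTmL hTm, hvH.isSphereTrace hTL hT, ?_, ?_, ?_, ?_, hAp, hAm, ?_⟩
  · refine ⟨integrable_sphereInt (integrable_norm_sq_pauliDot D), hint hAp, hint hAm,
      integrable_radialFlux _ _, integrable_radialFlux _ _, fun r hr => ?_, fun r hr => ?_,
      fun r => integral_nonneg fun θ => sq_nonneg _,
      fun a b ha hb => radialMass_sub R hR _ _ _ ha hb,
      fun a b ha hb => radialMass_sub R hR _ _ _ ha hb, ?_⟩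
    · exact ge_of_tendsto' (hpH.tendsto_radialMass hR hTpL hTp hr) fun n =>
        integral_nonneg fun θ => sq_nonneg _
    · exact ge_of_tendsto' (hmH.tendsto_radialMass hR hTmL hTm hr) fun n =>
        integral_nonneg fun θ => sq_nonneg _
    · exact radial_ineq_ae hp hm hpH hmH hvH hR hTpL hTp hTmL hTm
  · rw [hA, mul_inv_cancel_left₀ hR2]
  · rw [hA, mul_inv_cancel_left₀ hR2]
  · rw [hsum R hR, hA, mul_inv_cancel_left₀ hR2]
  · filter_upwards [hvH.radialMass_ae_eq hR hTL hT, ae_restrict_mem measurableSet_Ioi] with r h1 h2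
    rw [hsum r h2, h1]

/-! ### Truncated profiles -/

lemma absolutelyContinuousOnInterval_comp {f g : ℝ → ℝ} {a b : ℝ} {s : Set ℝ}
    (hf : AbsolutelyContinuousOnInterval f a b) (hs : MapsTo f (uIcc a b) s)
    (hg : ∀ x ∈ s, ∀ y ∈ s, |g x - g y| ≤ |x - y|) :
    AbsolutelyContinuousOnInterval (fun x => g (f x)) a b := by
  rw [absolutelyContinuousOnInterval_iff] at hf ⊢
  intro ε hε
  obtain ⟨δ, hδ, h⟩ := hf ε hε
  refine ⟨δ, hδ, fun E hE hlt => lt_of_le_of_lt (Finset.sum_le_sum fun i hi => ?_) (h E hE hlt)⟩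
  simp only [Real.dist_eq]
  exact hg _ (hs (hE.1 i hi).1) _ (hs (hE.1 i hi).2)

/-- The factor `1 / (1 + δ m(s) / s)`. -/
def truncFactor (δ : ℝ) (m : ℝ → ℝ) (s : ℝ) : ℝ := (1 + δ * (m s / s))⁻¹

/-- The quotient `m̃(s) / s` of the truncated profile `m̃ = m / (1 + δ m / s)`; it is bounded by
`1 / δ`. -/
def truncQuot (δ : ℝ) (m : ℝ → ℝ) (s : ℝ) : ℝ := m s / s * truncFactor δ m s

lemma truncFactor_mem {δ : ℝ} (hδ : 0 < δ) {m : ℝ → ℝ} {s : ℝ} (hq : 0 ≤ m s / s) :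
    0 < truncFactor δ m s ∧ truncFactor δ m s ≤ 1 := by
  have h : 0 ≤ δ * (m s / s) := mul_nonneg hδ.le hq
  exact ⟨inv_pos.2 (by linarith), inv_le_one_of_one_le₀ (by linarith)⟩

lemma truncQuot_nonneg {δ : ℝ} (hδ : 0 < δ) {m : ℝ → ℝ} {s : ℝ} (hq : 0 ≤ m s / s) :
    0 ≤ truncQuot δ m s := mul_nonneg hq (truncFactor_mem hδ hq).1.le

lemma truncQuot_le {δ : ℝ} (hδ : 0 < δ) {m : ℝ → ℝ} {s : ℝ} (hq : 0 ≤ m s / s) :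
    truncQuot δ m s ≤ δ⁻¹ := by
  have h : 0 ≤ δ * (m s / s) := mul_nonneg hδ.le hq
  rw [truncQuot, truncFactor, ← div_eq_mul_inv, div_le_iff₀ (by linarith), inv_mul_eq_div,
    le_div_iff₀ hδ]
  linarith

/-- Truncation improves the density up to the factor `(1 + δ m / s)⁻²`, for both signs. -/
lemma truncFactor_sq_mul_profileDensity_le {δ : ℝ} (hδ : 0 < δ) {W m : ℝ → ℝ} {s q' ε : ℝ}
    (hs : 0 < s) (hq : 0 ≤ m s / s) (hε : -2 ≤ ε) (hm : deriv m s = m s / s + s * q') :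
    truncFactor δ m s ^ 2 * profileDensity ε W m s
      ≤ (2 + ε) * truncQuot δ m s + ε * s * (truncFactor δ m s ^ 2 * q')
        - (1 + W s / s) * (s * truncQuot δ m s) ^ 2 := by
  obtain ⟨h1, h2⟩ := truncFactor_mem hδ hq
  rw [profileDensity, hm, truncQuot]
  generalize truncFactor δ m s = c at *
  have e : c ^ 2 * (1 / s * (2 * m s + ε * s * (m s / s + s * q') - (s + W s) * m s ^ 2))
      = (2 + ε) * (m s / s) * c ^ 2 + ε * s * (c ^ 2 * q')
        - (1 + W s / s) * (s * (m s / s * c)) ^ 2 := by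
    field_simp
    ring
  rw [e]
  have h3 : c ^ 2 ≤ c := by nlinarith
  have h4 : (2 + ε) * (m s / s) * c ^ 2 ≤ (2 + ε) * (m s / s) * c :=
    mul_le_mul_of_nonneg_left h3 (mul_nonneg (by linarith) hq)
  linarith

section

variable {R : ℝ} {m : ℝ → ℝ}

lemma IsProfile.quot_nonneg (hm : IsProfile R m) {s : ℝ} (hs : 0 < s) (hsR : s ≠ R) :
    0 ≤ m s / s := div_nonneg (hm.nonneg s hs hsR) hs.le

lemma IsProfile.truncQuot_absCont (hm : IsProfile R m) {δ a b : ℝ} (hδ : 0 < δ) (ha : 0 < a)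
    (hab : a ≤ b) (hR : R ∉ Icc a b) : AbsolutelyContinuousOnInterval (truncQuot δ m) a b := by
  refine absolutelyContinuousOnInterval_comp (g := fun q => q * (1 + δ * q)⁻¹) (s := Ici 0)
    (hm.absCont a b ha hab hR) (fun s hs => ?_) fun x hx y hy => ?_
  · rw [uIcc_of_le hab] at hs
    exact hm.quot_nonneg (ha.trans_le hs.1) fun h => hR (h ▸ hs)
  · have hx' : 0 ≤ δ * x := mul_nonneg hδ.le hx
    have hy' : 0 ≤ δ * y := mul_nonneg hδ.le hy
    have hpx : 0 < 1 + δ * x := by linarith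
    have hpy : 0 < 1 + δ * y := by linarith
    have e : x * (1 + δ * x)⁻¹ - y * (1 + δ * y)⁻¹ = (x - y) / ((1 + δ * x) * (1 + δ * y)) := by
      rw [← div_eq_mul_inv, ← div_eq_mul_inv, div_sub_div _ _ hpx.ne' hpy.ne']
      congr 1
      ring
    simp only [e]
    rw [abs_div, abs_of_pos (mul_pos hpx hpy)]
    refine div_le_self (abs_nonneg _) ?_
    nlinarith [mul_nonneg hx' hy']

lemma hasDerivAt_of_quot {s q' : ℝ} (hs : 0 < s) (hq : HasDerivAt (fun s => m s / s) q' s) :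
    HasDerivAt m (m s / s + s * q') s := by
  have h := (hasDerivAt_id s).mul hq
  have h' : HasDerivAt (id * fun s => m s / s) (m s / s + s * q') s := by
    simpa using h
  refine h'.congr_of_eventuallyEq ?_
  filter_upwards [lt_mem_nhds hs] with t ht
  simp only [Pi.mul_apply, id]
  field_simp

lemma hasDerivAt_truncQuot {δ s q' : ℝ} (hδ : 0 < δ) (hq0 : 0 ≤ m s / s)
    (hq : HasDerivAt (fun s => m s / s) q' s) :
    HasDerivAt (truncQuot δ m) (truncFactor δ m s ^ 2 * q') s := by
  have hne : 1 + δ * (m s / s) ≠ 0 := by have := mul_nonneg hδ.le hq0; linarith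
  have h1 : HasDerivAt (fun s => 1 + δ * (m s / s)) (δ * q') s := (hq.const_mul δ).const_add 1
  refine (hq.mul (h1.inv hne)).congr_deriv ?_
  simp only [truncFactor, Pi.inv_apply]
  generalize m s / s = q at *
  field_simp
  ring

lemma IsProfile.ae_hasDerivAt (hm : IsProfile R m) {a b : ℝ} (ha : 0 < a) (hab : a ≤ b)
    (hR : R ∉ Icc a b) :
    ∀ᵐ s ∂(volume.restrict (Ioc a b)), ∃ q', HasDerivAt (fun s => m s / s) q' s := by
  rw [ae_restrict_iff' measurableSet_Ioc]
  filter_upwards [(hm.absCont a b ha hab hR).ae_differentiableAt] with s h hs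
  rw [uIcc_of_le hab] at h
  exact ⟨_, (h (Ioc_subset_Icc_self hs)).hasDerivAt⟩

/-- The boundary term `r² m̃(r) A(r)` of the integration by parts. -/
def boundaryTerm (δ : ℝ) (m A : ℝ → ℝ) (r : ℝ) : ℝ := r ^ 3 * truncQuot δ m r * A r

/-- If `A(b) - A(a) = ∫ B` for all `a` and `b`, then `A` is absolutely continuous on compact
subintervals of `(0, ∞)`, with derivative `B` almost everywhere. -/
lemma absCont_of_sub_eq {A B : ℝ → ℝ} (hB : Integrable B radialMeasure)
    (hAB : ∀ a b, 0 < a → 0 < b → A b - A a = ∫ s in a..b, B s) {a b : ℝ} (ha : 0 < a)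
    (hab : a ≤ b) : AbsolutelyContinuousOnInterval A a b ∧
      ∀ᵐ s ∂(volume.restrict (Ioc a b)), HasDerivAt A (B s) s := by
  have hi : IntervalIntegrable B volume a b := (integrable_of_radialMeasure hB ha le_rfl hab).1
  have hac := hi.absolutelyContinuousOnInterval_intervalIntegral (c := a) left_mem_uIcc
  have hA : ∀ x, 0 < x → A x = A a + ∫ s in a..x, B s := fun x hx => by
    rw [← hAB a x ha hx]; ring
  constructor
  · have h1 : AbsolutelyContinuousOnInterval (fun x => A a + ∫ s in a..x, B s) a b :=
      (contDiffOn_const.absolutelyContinuousOnInterval).add hac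
    rw [absolutelyContinuousOnInterval_iff] at h1 ⊢
    intro ε hε
    obtain ⟨δ, hδ, h⟩ := h1 ε hε
    refine ⟨δ, hδ, fun E hE hlt => lt_of_le_of_lt (le_of_eq ?_) (h E hE hlt)⟩
    refine Finset.sum_congr rfl fun i hi => ?_
    have hmem := hE.1 i hi
    rw [uIcc_of_le hab] at hmem
    rw [hA _ (ha.trans_le hmem.1.1), hA _ (ha.trans_le hmem.2.1)]
  · rw [ae_restrict_iff' measurableSet_Ioc]
    filter_upwards [hi.ae_hasDerivAt_integral] with s h hs
    have h1 := (h (by rw [uIcc_of_le hab]; exact Ioc_subset_Icc_self hs) a left_mem_uIcc).const_add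
      (A a)
    refine h1.congr_of_eventuallyEq ?_
    filter_upwards [lt_mem_nhds (ha.trans hs.1)] with x hx
    exact hA x hx

lemma IsProfile.boundaryTerm_absCont (hm : IsProfile R m) {A B : ℝ → ℝ}
    (hB : Integrable B radialMeasure)
    (hAB : ∀ a b, 0 < a → 0 < b → A b - A a = ∫ s in a..b, B s) {δ a b : ℝ} (hδ : 0 < δ)
    (ha : 0 < a) (hab : a ≤ b) (hR : R ∉ Icc a b) :
    AbsolutelyContinuousOnInterval (boundaryTerm δ m A) a b := by
  have h1 : AbsolutelyContinuousOnInterval (fun r : ℝ => r ^ 3) a b :=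
    ContDiffOn.absolutelyContinuousOnInterval (by fun_prop)
  exact (h1.mul (hm.truncQuot_absCont hδ ha hab hR)).mul (absCont_of_sub_eq hB hAB ha hab).1

lemma hasDerivAt_boundaryTerm {A : ℝ → ℝ} {δ s q' B : ℝ} (hδ : 0 < δ) (hq0 : 0 ≤ m s / s)
    (hq : HasDerivAt (fun s => m s / s) q' s) (hA : HasDerivAt A B s) :
    HasDerivAt (boundaryTerm δ m A) (3 * s ^ 2 * truncQuot δ m s * A s
      + s ^ 3 * (truncFactor δ m s ^ 2 * q') * A s + s ^ 3 * truncQuot δ m s * B) s := by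
  refine (((hasDerivAt_pow 3 s).mul (hasDerivAt_truncQuot hδ hq0 hq)).mul hA).congr_deriv ?_
  simp only [Pi.mul_apply]
  push_cast
  ring

end

/-! ### The one-dimensional inequality away from the sphere -/

section

variable {R : ℝ} {W mp mm S Ap Am Bp Bm : ℝ → ℝ}

/-- The radial inequality with the truncated profiles as multipliers. -/
lemma RadialData.density_le (h : RadialData S Ap Am Bp Bm) (hmp : IsProfile R mp)
    (hmm : IsProfile R mm) (hWpos : ∀ s, 0 < s → 0 < W s) {δ a b : ℝ} (hδ : 0 < δ) (ha : 0 < a)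
    (hab : a ≤ b) (hR : R ∉ Icc a b) :
    ∀ᵐ r ∂(volume.restrict (Ioc a b)),
      truncFactor δ mp r ^ 2 * (profileDensity 1 W mp r * (r ^ 2 * Ap r))
        + truncFactor δ mm r ^ 2 * (profileDensity (-1) W mm r * (r ^ 2 * Am r))
      ≤ r ^ 2 * (S r / (1 + W r / r)) + deriv (boundaryTerm δ mp Ap) r
        - deriv (boundaryTerm δ mm Am) r := by
  have hsub : Ioc a b ⊆ Ioi 0 := fun r hr => ha.trans hr.1
  filter_upwards [hmp.ae_hasDerivAt ha hab hR, hmm.ae_hasDerivAt ha hab hR,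
    (absCont_of_sub_eq h.integrable_pos_deriv h.pos_sub ha hab).2,
    (absCont_of_sub_eq h.integrable_neg_deriv h.neg_sub ha hab).2,
    ae_restrict_of_ae_restrict_of_subset hsub h.ineq, ae_restrict_mem measurableSet_Ioc]
    with r ⟨qp, hqp⟩ ⟨qm, hqm⟩ hAp hAm hineq hr
  have hr0 : 0 < r := hsub hr
  have hrR : r ≠ R := fun e => hR (e ▸ Ioc_subset_Icc_self hr)
  have hp0 := hmp.quot_nonneg hr0 hrR
  have hm0 := hmm.quot_nonneg hr0 hrR
  have hw : 0 < 1 + W r / r := by have := div_pos (hWpos r hr0) hr0; linarith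
  have e1 := truncFactor_sq_mul_profileDensity_le (W := W) hδ hr0 hp0 (ε := 1) (by norm_num)
    (hasDerivAt_of_quot hr0 hqp).deriv
  have e2 := truncFactor_sq_mul_profileDensity_le (W := W) hδ hr0 hm0 (ε := -1) (by norm_num)
    (hasDerivAt_of_quot hr0 hqm).deriv
  have e3 := hineq (r * truncQuot δ mp r) (r * truncQuot δ mm r) (1 + W r / r)
    (mul_nonneg hr0.le (truncQuot_nonneg hδ hp0)) (mul_nonneg hr0.le (truncQuot_nonneg hδ hm0)) hw
  rw [(hasDerivAt_boundaryTerm hδ hp0 hqp hAp).deriv,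
      (hasDerivAt_boundaryTerm hδ hm0 hqm hAm).deriv]
  have f1 := mul_le_mul_of_nonneg_right e1 (mul_nonneg (sq_nonneg r) (h.pos_nonneg r hr0))
  have f2 := mul_le_mul_of_nonneg_right e2 (mul_nonneg (sq_nonneg r) (h.neg_nonneg r hr0))
  have f3 := mul_le_mul_of_nonneg_left e3 (sq_nonneg r)
  have e4 : r * truncQuot δ mm r * (Bm r + 4 / r * Am r)
      = r * truncQuot δ mm r * Bm r + 4 * truncQuot δ mm r * Am r := by
    field_simp
  rw [e4] at f3
  generalize 1 + W r / r = w at *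
  generalize truncFactor δ mp r = c at *
  generalize truncFactor δ mm r = c' at *
  nlinarith [f1, f2, f3]

/-- The one-dimensional inequality on an interval that does not contain `R`. -/
lemma RadialData.lintegral_Ioc_le (h : RadialData S Ap Am Bp Bm) (hmp : IsProfile R mp)
    (hmm : IsProfile R mm) (hWpos : ∀ s, 0 < s → 0 < W s) {δ a b : ℝ} (hδ : 0 < δ) (ha : 0 < a)
    (hab : a ≤ b) (hR : R ∉ Icc a b)
    (hE : IntegrableOn (fun r => r ^ 2 * (S r / (1 + W r / r))) (Ioi 0)) {yp ym : ℝ → ℝ}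
    (hyp : IntegrableOn yp (Ioi 0)) (hym : IntegrableOn ym (Ioi 0))
    (hyp0 : ∀ r, 0 ≤ yp r) (hym0 : ∀ r, 0 ≤ ym r)
    (hyp1 : ∀ r, -(profileDensity 1 W mp r * (r ^ 2 * Ap r)) ≤ yp r)
    (hym1 : ∀ r, -(profileDensity (-1) W mm r * (r ^ 2 * Am r)) ≤ ym r) :
    (∫⁻ r in Ioc a b,
      (ENNReal.ofReal (truncFactor δ mp r ^ 2 * (profileDensity 1 W mp r * (r ^ 2 * Ap r)))
        + ENNReal.ofReal (truncFactor δ mm r ^ 2 * (profileDensity (-1) W mm r * (r ^ 2 * Am r))))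
      ≤ ENNReal.ofReal ((∫ r in Ioc a b, (r ^ 2 * (S r / (1 + W r / r)) + yp r + ym r))
        + (boundaryTerm δ mp Ap b - boundaryTerm δ mp Ap a)
        - (boundaryTerm δ mm Am b - boundaryTerm δ mm Am a))) ∧
    0 ≤ (∫ r in Ioc a b, (r ^ 2 * (S r / (1 + W r / r)) + yp r + ym r))
        + (boundaryTerm δ mp Ap b - boundaryTerm δ mp Ap a)
        - (boundaryTerm δ mm Am b - boundaryTerm δ mm Am a) := by
  have hsub : Ioc a b ⊆ Ioi 0 := fun r hr => ha.trans hr.1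
  have hUp := hmp.boundaryTerm_absCont h.integrable_pos_deriv h.pos_sub hδ ha hab hR
  have hUm := hmm.boundaryTerm_absCont h.integrable_neg_deriv h.neg_sub hδ ha hab hR
  have iUp : IntegrableOn (deriv (boundaryTerm δ mp Ap)) (Ioc a b) :=
    (intervalIntegrable_iff_integrableOn_Ioc_of_le hab).1 hUp.intervalIntegrable_deriv
  have iUm : IntegrableOn (deriv (boundaryTerm δ mm Am)) (Ioc a b) :=
    (intervalIntegrable_iff_integrableOn_Ioc_of_le hab).1 hUm.intervalIntegrable_deriv
  have vUp : ∫ r in Ioc a b, deriv (boundaryTerm δ mp Ap) r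
      = boundaryTerm δ mp Ap b - boundaryTerm δ mp Ap a := by
    rw [← intervalIntegral.integral_of_le hab, hUp.integral_deriv_eq_sub]
  have vUm : ∫ r in Ioc a b, deriv (boundaryTerm δ mm Am) r
      = boundaryTerm δ mm Am b - boundaryTerm δ mm Am a := by
    rw [← intervalIntegral.integral_of_le hab, hUm.integral_deriv_eq_sub]
  have i0 : IntegrableOn (fun r => r ^ 2 * (S r / (1 + W r / r)) + yp r + ym r) (Ioc a b) :=
    ((hE.add hyp).add hym).mono_set hsub
  set H : ℝ → ℝ := fun r => (r ^ 2 * (S r / (1 + W r / r)) + yp r + ym r)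
    + deriv (boundaryTerm δ mp Ap) r - deriv (boundaryTerm δ mm Am) r with hH
  have i1 : IntegrableOn (fun r => (r ^ 2 * (S r / (1 + W r / r)) + yp r + ym r)
    + deriv (boundaryTerm δ mp Ap) r) (Ioc a b) := i0.add iUp
  have iH : IntegrableOn H (Ioc a b) := i1.sub iUm
  have vH : ∫ r in Ioc a b, H r
      = (∫ r in Ioc a b, (r ^ 2 * (S r / (1 + W r / r)) + yp r + ym r))
        + (boundaryTerm δ mp Ap b - boundaryTerm δ mp Ap a)
        - (boundaryTerm δ mm Am b - boundaryTerm δ mm Am a) := by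
    rw [hH, integral_sub i1 iUm, integral_add i0 iUp, vUp, vUm]
  rw [← vH]
  -- The positive parts on the left are bounded by `H`, since `c² y ≤ 0` costs at most `y⁻`.
  have hle : ∀ᵐ r ∂(volume.restrict (Ioc a b)),
      max (truncFactor δ mp r ^ 2 * (profileDensity 1 W mp r * (r ^ 2 * Ap r))) 0
        + max (truncFactor δ mm r ^ 2 * (profileDensity (-1) W mm r * (r ^ 2 * Am r))) 0 ≤ H r := by
    filter_upwards [h.density_le hmp hmm hWpos hδ ha hab hR, ae_restrict_mem measurableSet_Ioc]
      with r hd hr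
    have hr0 : 0 < r := hsub hr
    have hrR : r ≠ R := fun e => hR (e ▸ Ioc_subset_Icc_self hr)
    have key : ∀ {c y z : ℝ}, 0 < c → c ≤ 1 → 0 ≤ z → -y ≤ z → max
        (c ^ 2 * y) 0 ≤ c ^ 2 * y + z := by
      intro c y z hc hc1 hz hyz
      have h1 : c ^ 2 ≤ 1 := pow_le_one₀ hc.le hc1
      refine max_le (by linarith) ?_
      rcases le_or_gt 0 y with hy | hy
      · have := mul_nonneg (sq_nonneg c) hy
        linarith
      · nlinarith
    have cp := truncFactor_mem hδ (hmp.quot_nonneg hr0 hrR)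
    have cm := truncFactor_mem hδ (hmm.quot_nonneg hr0 hrR)
    have k1 := key cp.1 cp.2 (hyp0 r) (hyp1 r)
    have k2 := key cm.1 cm.2 (hym0 r) (hym1 r)
    simp only [hH]
    linarith
  have hH0 : 0 ≤ᵐ[volume.restrict (Ioc a b)] H := by
    filter_upwards [hle] with r hr
    exact (add_nonneg (le_max_right _ _) (le_max_right _ _)).trans hr
  refine ⟨?_, integral_nonneg_of_ae hH0⟩
  rw [ofReal_integral_eq_lintegral_ofReal iH hH0]
  refine lintegral_mono_ae ?_
  filter_upwards [hle] with r hr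
  have hmax : ∀ x : ℝ, ENNReal.ofReal x = ENNReal.ofReal (max x 0) := fun x => by
    rcases le_total 0 x with hx | hx
    · rw [max_eq_left hx]
    · rw [max_eq_right hx, ENNReal.ofReal_zero, ENNReal.ofReal_of_nonpos hx]
  rw [hmax, hmax (truncFactor δ mm r ^ 2 * _),
    ← ENNReal.ofReal_add (le_max_right _ _) (le_max_right _ _)]
  exact ENNReal.ofReal_le_ofReal hr

end

/-! ### The one-dimensional inequality -/

/-- An integrable nonnegative function on `(0, ∞)` is `o(1/r)` along sequences tending to `0` and
to `∞`. -/
lemma exists_mul_le_of_integrableOn {F : ℝ → ℝ} (hF : IntegrableOn F (Ioi 0))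
    {ε : ℝ} (hε : 0 < ε) {c : ℝ} (hc : 0 < c) :
    (∃ a, 0 < a ∧ a < c ∧ a * F a ≤ ε) ∧ ∃ b, c < b ∧ b * F b ≤ ε := by
  have key : ∀ s : Set ℝ, MeasurableSet s → s ⊆ Ioi 0 → (∀ a ∈ s, ε < a * F a) →
      IntegrableOn (fun x => x⁻¹) s := by
    intro s hs hs0 h
    have h1 : IntegrableOn (fun x => ε⁻¹ * F x) s := (hF.mono_set hs0).const_mul _
    refine h1.mono' (by fun_prop) ((ae_restrict_iff' hs).2 (ae_of_all _ fun x hx => ?_))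
    have hx0 : 0 < x := hs0 hx
    rw [Real.norm_of_nonneg (inv_nonneg.2 hx0.le), inv_mul_eq_div, le_div_iff₀ hε,
      inv_mul_le_iff₀ hx0]
    exact (h x hx).le
  constructor
  · by_contra! hcon
    have h1 := key (Ioo 0 c) measurableSet_Ioo (fun x hx => hx.1) fun a ha => hcon a ha.1 ha.2
    have h2 : IntervalIntegrable (fun x : ℝ => x⁻¹) volume 0 c :=
      (intervalIntegrable_iff_integrableOn_Ioo_of_le hc.le).2 h1
    rcases intervalIntegrable_inv_iff.1 h2 with h3 | h3
    · exact hc.ne h3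
    · exact h3 left_mem_uIcc
  · by_contra! hcon
    exact not_integrableOn_Ioi_inv (key (Ioi c) measurableSet_Ioi
      (fun x hx => hc.trans hx) fun a ha => hcon a ha)

section

variable {R : ℝ} {m : ℝ → ℝ}

lemma IsProfile.aemeasurable (hm : IsProfile R m) :
    AEMeasurable m (volume.restrict (Ioi (0 : ℝ))) := by
  have hc : ContinuousOn m (Ioi 0 \ {R}) := by
    intro s hs
    have hs0 : 0 < s := hs.1
    have hsR : s ≠ R := hs.2
    obtain ⟨a, b, ha, hsab, hab⟩ : ∃ a b, 0 < a ∧ s ∈ Ioo a b ∧ R ∉ Icc a b := by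
      rcases lt_or_gt_of_ne hsR with h | h
      · exact ⟨s / 2, (s + R) / 2, by linarith, ⟨by linarith, by linarith⟩,
          fun h' => by linarith [h'.2]⟩
      · exact ⟨max (s / 2) ((s + R) / 2), s + 1, lt_max_of_lt_left (by linarith),
          ⟨max_lt (by linarith) (by linarith), by linarith⟩,
          fun h' => by linarith [h'.1, le_max_right (s / 2) ((s + R) / 2)]⟩
    have h1 := (hm.absCont a b ha (hsab.1.trans hsab.2).le hab).continuousOn
    rw [uIcc_of_le (hsab.1.trans hsab.2).le] at h1
    have h2 : ContinuousAt (fun s => m s / s) s := h1.continuousAt (Icc_mem_nhds hsab.1 hsab.2)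
    have h3 : ContinuousAt (fun s => s * (m s / s)) s := continuousAt_id.mul h2
    refine (h3.congr ?_).continuousWithinAt
    filter_upwards [lt_mem_nhds hs0] with t ht
    field_simp
  have h := hc.aemeasurable (μ := volume) (measurableSet_Ioi.diff (measurableSet_singleton R))
  rwa [Measure.restrict_congr_set (sdiff_null_ae_eq_self (measure_singleton R))] at h

lemma IsProfile.aemeasurable_profileDensity (hm : IsProfile R m) {W : ℝ → ℝ} (hW : Measurable W)
    (ε : ℝ) : AEMeasurable (profileDensity ε W m) (volume.restrict (Ioi (0 : ℝ))) := by
  have h1 := hm.aemeasurable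
  have h2 := (measurable_deriv m).aemeasurable (μ := volume.restrict (Ioi (0 : ℝ)))
  have h3 := hW.aemeasurable (μ := volume.restrict (Ioi (0 : ℝ)))
  have h4 := aemeasurable_id (μ := volume.restrict (Ioi (0 : ℝ)))
  have h5 : AEMeasurable (fun s : ℝ => 1 / s) (volume.restrict (Ioi (0 : ℝ))) := by fun_prop
  exact h5.mul (((h1.const_mul 2).add ((h4.const_mul ε).mul h2)).sub
    ((h4.add h3).mul (h1.pow_const 2)))

lemma IsProfile.aemeasurable_truncFactor (hm : IsProfile R m) (δ : ℝ) :
    AEMeasurable (truncFactor δ m) (volume.restrict (Ioi (0 : ℝ))) :=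
  (((hm.aemeasurable.div aemeasurable_id).const_mul δ).const_add 1).inv

/-- The limit of the boundary terms on one side of the sphere, as the truncation is removed. -/
lemma tendsto_boundaryTerm (hR : 0 < R) {A : ℝ → ℝ} (hA : ContinuousAt A R) {l : ℝ}
    {δ ρ : ℕ → ℝ} (hδ : Tendsto δ atTop (𝓝 0)) (hρ : Tendsto ρ atTop (𝓝 R))
    (hm : Tendsto (fun k => m (ρ k)) atTop (𝓝 l)) :
    Tendsto (fun k => boundaryTerm (δ k) m A (ρ k)) atTop (𝓝 (l * (R ^ 2 * A R))) := by
  have h1 : Tendsto (fun k => m (ρ k) / ρ k) atTop (𝓝 (l / R)) := hm.div hρ hR.ne'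
  have h2 : Tendsto (fun k => (1 + δ k * (m (ρ k) / ρ k))⁻¹) atTop (𝓝 (1 + 0 * (l / R))⁻¹) :=
    ((hδ.mul h1).const_add 1).inv₀ (by simp)
  have h3 := ((hρ.pow 3).mul (h1.mul h2)).mul (hA.tendsto.comp hρ)
  have e : R ^ 3 * (l / R * (1 + 0 * (l / R))⁻¹) * A R = l * (R ^ 2 * A R) := by
    rw [zero_mul, add_zero, inv_one, mul_one]
    field_simp
  rw [e] at h3
  exact h3

end

lemma tendsto_truncFactor (m : ℝ → ℝ) (r : ℝ) {δ : ℕ → ℝ} (hδ : Tendsto δ atTop (𝓝 0)) :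
    Tendsto (fun k => truncFactor (δ k) m r) atTop (𝓝 1) := by
  have := ((hδ.mul_const (m r / r)).const_add 1).inv₀ (by simp)
  simpa [truncFactor] using this

/-- The negative part of a function whose negative part has finite integral. -/
lemma integrable_negPart {X : Type*} [MeasurableSpace X] {μ : Measure X} {y : X → ℝ}
    (hy : AEMeasurable y μ) (hfin : ∫⁻ r, ENNReal.ofReal (-y r) ∂μ ≠ ⊤) :
    Integrable (fun r => max (-y r) 0) μ ∧
      ∫ r, max (-y r) 0 ∂μ = (∫⁻ r, ENNReal.ofReal (-y r) ∂μ).toReal := by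
  have hmax : ∀ r, ENNReal.ofReal (max (-y r) 0) = ENNReal.ofReal (-y r) := fun r => by
    rcases le_total 0 (-y r) with h | h
    · rw [max_eq_left h]
    · rw [max_eq_right h, ENNReal.ofReal_zero, ENNReal.ofReal_of_nonpos h]
  have hm : AEStronglyMeasurable (fun r => max (-y r) 0) μ :=
    (hy.neg.max aemeasurable_const).aestronglyMeasurable
  have h0 : 0 ≤ᵐ[μ] fun r => max (-y r) 0 := ae_of_all _ fun r => le_max_right _ _
  refine ⟨⟨hm, ?_⟩, ?_⟩
  · rw [hasFiniteIntegral_iff_ofReal h0]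
    simp only [hmax]
    exact hfin.lt_top
  · rw [integral_eq_lintegral_of_nonneg_ae h0 hm]
    simp only [hmax]

section

variable {R : ℝ} {W mp mm S Ap Am Bp Bm : ℝ → ℝ}

lemma RadialData.continuousAt (h : RadialData S Ap Am Bp Bm) (hR : 0 < R) :
    ContinuousAt Ap R ∧ ContinuousAt Am R := by
  have hle : R / 2 ≤ R + 1 := by linarith
  have hn : Icc (R / 2) (R + 1) ∈ 𝓝 R := Icc_mem_nhds (by linarith) (by linarith)
  have h1 := (absCont_of_sub_eq h.integrable_pos_deriv h.pos_sub (half_pos hR) hle).1.continuousOn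
  have h2 := (absCont_of_sub_eq h.integrable_neg_deriv h.neg_sub (half_pos hR) hle).1.continuousOn
  rw [uIcc_of_le hle] at h1 h2
  exact ⟨h1.continuousAt hn, h2.continuousAt hn⟩

lemma RadialData.integrableOn_energy (h : RadialData S Ap Am Bp Bm) (hW : Measurable W)
    (hWpos : ∀ s, 0 < s → 0 < W s) :
    IntegrableOn (fun r => r ^ 2 * (S r / (1 + W r / r))) (Ioi 0) := by
  have h1 := integrable_radialMeasure_iff.1 h.integrable_energy
  have hm : AEStronglyMeasurable (fun r => r ^ 2 * S r * (1 + W r / r)⁻¹)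
      (volume.restrict (Ioi 0)) :=
    h1.1.mul (by fun_prop : Measurable fun r => (1 + W r / r)⁻¹).aestronglyMeasurable
  refine h1.mono' (hm.congr (ae_of_all _ fun r => by simp [div_eq_mul_inv, mul_assoc]))
    ((ae_restrict_iff' measurableSet_Ioi).2 (ae_of_all _ fun r hr => ?_))
  have hr0 : 0 < r := hr
  have hw : 1 ≤ 1 + W r / r := by linarith [div_pos (hWpos r hr0) hr0]
  have hS := h.energy_nonneg r
  rw [Real.norm_of_nonneg (by positivity)]
  exact mul_le_mul_of_nonneg_left (div_le_self hS hw) (sq_nonneg r)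

/-- The one-dimensional inequality on two intervals on either side of the sphere. -/
lemma RadialData.lintegral_two_Ioc_le (h : RadialData S Ap Am Bp Bm) (hmp : IsProfile R mp)
    (hmm : IsProfile R mm) (hWm : Measurable W) (hWpos : ∀ s, 0 < s → 0 < W s) {δ a b c d : ℝ}
    (hδ : 0 < δ) (ha : 0 < a) (hab : a ≤ b) (hb : b < R) (hc : R < c) (hcd : c ≤ d)
    {yp ym : ℝ → ℝ} (hyp : IntegrableOn yp (Ioi 0)) (hym : IntegrableOn ym (Ioi 0))
    (hyp0 : ∀ r, 0 ≤ yp r) (hym0 : ∀ r, 0 ≤ ym r)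
    (hyp1 : ∀ r, -(profileDensity 1 W mp r * (r ^ 2 * Ap r)) ≤ yp r)
    (hym1 : ∀ r, -(profileDensity (-1) W mm r * (r ^ 2 * Am r)) ≤ ym r) {X : ℝ}
    (hX : X = (∫ r in Ioi 0, (r ^ 2 * (S r / (1 + W r / r)) + yp r + ym r))
        + (boundaryTerm δ mp Ap b - boundaryTerm δ mm Am b)
        - (boundaryTerm δ mp Ap c - boundaryTerm δ mm Am c)
        + δ⁻¹ * (a * (a ^ 2 * Am a)) + δ⁻¹ * (d * (d ^ 2 * Ap d))) :
    (∫⁻ r in Ioc a b ∪ Ioc c d,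
      (ENNReal.ofReal (truncFactor δ mp r ^ 2 * (profileDensity 1 W mp r * (r ^ 2 * Ap r)))
        + ENNReal.ofReal (truncFactor δ mm r ^ 2 * (profileDensity (-1) W mm r * (r ^ 2 * Am r))))
      ≤ ENNReal.ofReal X) ∧ 0 ≤ X := by
  have hE := h.integrableOn_energy hWm hWpos
  have hR : 0 < R := (ha.trans_le hab).trans hb
  have hc0 : 0 < c := hR.trans hc
  obtain ⟨p1, q1⟩ := h.lintegral_Ioc_le hmp hmm hWpos hδ ha hab (fun h => by linarith [h.2])
    hE hyp hym hyp0 hym0 hyp1 hym1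
  obtain ⟨p2, q2⟩ := h.lintegral_Ioc_le hmp hmm hWpos hδ hc0 hcd (fun h => by linarith [h.1])
    hE hyp hym hyp0 hym0 hyp1 hym1
  set g : ℝ → ℝ := fun r => r ^ 2 * (S r / (1 + W r / r)) + yp r + ym r with hg
  have hgi : IntegrableOn g (Ioi 0) := (hE.add hyp).add hym
  have hg0 : 0 ≤ᵐ[volume.restrict (Ioi 0)] g := by
    filter_upwards [ae_restrict_mem measurableSet_Ioi] with r hr
    have hr0 : 0 < r := hr
    have := div_pos (hWpos r hr0) hr0
    have h1 := h.energy_nonneg r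
    have h2 := hyp0 r
    have h3 := hym0 r
    simp only [hg, Pi.zero_apply]
    positivity
  have s1 : Ioc a b ⊆ Ioi 0 := fun r hr => ha.trans hr.1
  have s2 : Ioc c d ⊆ Ioi 0 := fun r hr => hc0.trans hr.1
  have hdisj : Disjoint (Ioc a b) (Ioc c d) := by
    rw [Set.disjoint_left]
    exact fun r h1 h2 => by linarith [h1.2, h2.1]
  have hint : (∫ r in Ioc a b, g r) + ∫ r in Ioc c d, g r ≤ ∫ r in Ioi 0, g r := by
    rw [← setIntegral_union hdisj measurableSet_Ioc (hgi.mono_set s1) (hgi.mono_set s2)]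
    exact setIntegral_mono_set hgi hg0 (union_subset s1 s2).eventuallyLE
  have hU : ∀ {m A : ℝ → ℝ} {r : ℝ}, IsProfile R m → (∀ r, 0 < r → 0 ≤ A r) → 0 < r → r ≠ R →
      0 ≤ boundaryTerm δ m A r ∧ boundaryTerm δ m A r ≤ δ⁻¹ * (r * (r ^ 2 * A r)) := by
    intro m A r hm hA hr hrR
    have t1 := truncQuot_nonneg hδ (hm.quot_nonneg hr hrR)
    have t2 := truncQuot_le hδ (hm.quot_nonneg hr hrR)
    have t3 := hA r hr
    rw [boundaryTerm]
    refine ⟨by positivity, ?_⟩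
    calc r ^ 3 * truncQuot δ m r * A r ≤ r ^ 3 * δ⁻¹ * A r := by gcongr
      _ = _ := by ring
  have u1 := hU hmp h.pos_nonneg ha (by linarith : a < R).ne
  have u2 := hU hmm h.neg_nonneg ha (by linarith : a < R).ne
  have u3 := hU hmp h.pos_nonneg (hc0.trans_le hcd) (by linarith : R < d).ne'
  have u4 := hU hmm h.neg_nonneg (hc0.trans_le hcd) (by linarith : R < d).ne'
  have hsum := add_nonneg q1 q2
  have hle : (∫ r in Ioc a b, g r) + (boundaryTerm δ mp Ap b - boundaryTerm δ mp Ap a)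
        - (boundaryTerm δ mm Am b - boundaryTerm δ mm Am a)
      + ((∫ r in Ioc c d, g r) + (boundaryTerm δ mp Ap d - boundaryTerm δ mp Ap c)
        - (boundaryTerm δ mm Am d - boundaryTerm δ mm Am c)) ≤ X := by
    rw [hX]
    linarith [u1.1, u2.2, u3.2, u4.1]
  refine ⟨(lintegral_union_le _ _ _).trans ((add_le_add p1 p2).trans ?_), hsum.trans hle⟩
  rw [← ENNReal.ofReal_add q1 q2]
  exact ENNReal.ofReal_le_ofReal hle

/-- The one-dimensional inequality: integrating the radial inequality with the profiles as
multipliers, only the jumps at `R` are left of the boundary terms. -/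
theorem RadialData.lintegral_le (h : RadialData S Ap Am Bp Bm) (hR : 0 < R)
    (hmp : IsProfile R mp) (hmm : IsProfile R mm) (hWm : Measurable W)
    (hWpos : ∀ s, 0 < s → 0 < W s)
    (hNp : ∫⁻ r in Ioi 0, ENNReal.ofReal (-(profileDensity 1 W mp r * (r ^ 2 * Ap r))) ≠ ⊤)
    (hNm : ∫⁻ r in Ioi 0, ENNReal.ofReal (-(profileDensity (-1) W mm r * (r ^ 2 * Am r))) ≠ ⊤)
    {X : ℝ} (hX : X = (∫ r in Ioi 0, r ^ 2 * (S r / (1 + W r / r)))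
      - jump R mp * (R ^ 2 * Ap R) + jump R mm * (R ^ 2 * Am R)
      + (∫⁻ r in Ioi 0,
          ENNReal.ofReal (-(profileDensity 1 W mp r * (r ^ 2 * Ap r)))).toReal
      + (∫⁻ r in Ioi 0,
          ENNReal.ofReal (-(profileDensity (-1) W mm r * (r ^ 2 * Am r)))).toReal) :
    0 ≤ X ∧ (∫⁻ r in Ioi 0, ENNReal.ofReal (profileDensity 1 W mp r * (r ^ 2 * Ap r)))
      + (∫⁻ r in Ioi 0, ENNReal.ofReal (profileDensity (-1) W mm r * (r ^ 2 * Am r)))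
      ≤ ENNReal.ofReal X := by
  have mAp := (integrable_radialMeasure_iff.1 h.integrable_pos).1.aemeasurable
  have mAm := (integrable_radialMeasure_iff.1 h.integrable_neg).1.aemeasurable
  have mp1 : AEMeasurable (fun r => profileDensity 1 W mp r * (r ^ 2 * Ap r))
    (volume.restrict (Ioi 0)) := (hmp.aemeasurable_profileDensity hWm 1).mul mAp
  have mm1 : AEMeasurable (fun r => profileDensity (-1) W mm r * (r ^ 2 * Am r))
    (volume.restrict (Ioi 0)) := (hmm.aemeasurable_profileDensity hWm (-1)).mul mAm
  obtain ⟨ip, vp⟩ := integrable_negPart mp1 hNp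
  obtain ⟨im, vm⟩ := integrable_negPart mm1 hNm
  have hE := h.integrableOn_energy hWm hWpos
  have iF : IntegrableOn (fun r => r ^ 2 * Ap r + r ^ 2 * Am r) (Ioi 0) :=
    (integrable_radialMeasure_iff.1 h.integrable_pos).add
      (integrable_radialMeasure_iff.1 h.integrable_neg)
  -- The truncation parameter and the distances to the sphere, to the origin and to infinity.
  set δ : ℕ → ℝ := fun k => 1 / ((k : ℝ) + 1) with hδdef
  have hδ : ∀ k, 0 < δ k := fun k => by positivity
  have hδlim : Tendsto δ atTop (𝓝 0) := tendsto_one_div_add_atTop_nhds_zero_nat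
  set η : ℕ → ℝ := fun k => R / 2 * δ k with hηdef
  have hη : ∀ k, 0 < η k := fun k => by have := hδ k; positivity
  have hδ1 : ∀ k, δ k ≤ 1 := fun k => by
    rw [hδdef, div_le_one (by positivity)]; linarith [Nat.cast_nonneg (α := ℝ) k]
  have hη1 : ∀ k, η k ≤ R / 2 := fun k => mul_le_of_le_one_right (by linarith) (hδ1 k)
  have hηlim : Tendsto η atTop (𝓝 0) := by simpa using hδlim.const_mul (R / 2)
  choose a ha0 ha1 ha2 using fun k =>
    (exists_mul_le_of_integrableOn iF (pow_pos (hδ k) 2) (hη k)).1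
  choose b hb1 hb2 using fun k : ℕ =>
    (exists_mul_le_of_integrableOn iF (pow_pos (hδ k) 2)
      (by positivity : 0 < 2 * R + (k : ℝ))).2
  have hab : ∀ k, a k ≤ R - η k := fun k => by linarith [ha1 k, hη1 k]
  have hcd : ∀ k, R + η k ≤ b k := fun k => by
    linarith [hb1 k, hη1 k, Nat.cast_nonneg (α := ℝ) k]
  have hb0 : ∀ k, 0 < b k := fun k => by linarith [hcd k, hη k]
  set yp : ℝ → ℝ := fun r => max (-(profileDensity 1 W mp r * (r ^ 2 * Ap r))) 0 with hyp
  set ym : ℝ → ℝ := fun r => max (-(profileDensity (-1) W mm r * (r ^ 2 * Am r))) 0 with hym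
  have hbound := fun k => h.lintegral_two_Ioc_le hmp hmm hWm hWpos (hδ k) (ha0 k) (hab k)
    (by linarith [hη k]) (by linarith [hη k]) (hcd k) ip im (fun r => le_max_right _ _)
    (fun r => le_max_right _ _) (fun r => le_max_left _ _) (fun r => le_max_left _ _) rfl
  set I : ℝ := ∫ r in Ioi 0, (r ^ 2 * (S r / (1 + W r / r)) + yp r + ym r) with hI
  set Y : ℕ → ℝ := fun k => I + (boundaryTerm (δ k) mp Ap (R - η k)
      - boundaryTerm (δ k) mm Am (R - η k))
    - (boundaryTerm (δ k) mp Ap (R + η k) - boundaryTerm (δ k) mm Am (R + η k)) + δ k + δ k with hY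
  have hYle : ∀ k, (∫⁻ r in Ioc (a k) (R - η k) ∪ Ioc (R + η k) (b k),
      (ENNReal.ofReal (truncFactor (δ k) mp r ^ 2 * (profileDensity 1 W mp r * (r ^ 2 * Ap r)))
        + ENNReal.ofReal
          (truncFactor (δ k) mm r ^ 2 * (profileDensity (-1) W mm r * (r ^ 2 * Am r))))
      ≤ ENNReal.ofReal (Y k)) ∧ 0 ≤ Y k := by
    intro k
    have hk := hδ k
    have t : ∀ {x}, x ≤ δ k ^ 2 → (δ k)⁻¹ * x ≤ δ k := fun {x} hx => by
      rw [inv_mul_le_iff₀ hk, ← sq]; exact hx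
    -- At `a` only the boundary term of `m₋` has the wrong sign, at `b` only that of `m₊`; each is
    -- at most `δ⁻¹ r³ A`, which is at most `δ` by the choice of `a` and `b`.
    have t1 := t (x := a k * (a k ^ 2 * Am (a k))) (le_trans (mul_le_mul_of_nonneg_left
      (by
        have := h.pos_nonneg _ (ha0 k)
        nlinarith [sq_nonneg (a k), mul_nonneg (sq_nonneg (a k)) this])
      (ha0 k).le) (ha2 k))
    have t2 := t (x := b k * (b k ^ 2 * Ap (b k))) (le_trans (mul_le_mul_of_nonneg_left
      (by
        have := h.neg_nonneg _ (hb0 k)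
        nlinarith [sq_nonneg (b k), mul_nonneg (sq_nonneg (b k)) this])
      (hb0 k).le) (hb2 k))
    have hle := add_le_add (add_le_add_right t1 (I + (boundaryTerm (δ k) mp Ap (R - η k)
      - boundaryTerm (δ k) mm Am (R - η k))
      - (boundaryTerm (δ k) mp Ap (R + η k) - boundaryTerm (δ k) mm Am (R + η k)))) t2
    exact ⟨(hbound k).1.trans (ENNReal.ofReal_le_ofReal hle), (hbound k).2.trans hle⟩
  have hYlim : Tendsto Y atTop (𝓝 X) := by
    obtain ⟨hcp, hcm⟩ := h.continuousAt hR
    have rl : Tendsto (fun k => R - η k) atTop (𝓝[<] R) := by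
      refine tendsto_nhdsWithin_iff.2
        ⟨by simpa using hηlim.const_sub R, Eventually.of_forall fun k => ?_⟩
      simpa using hη k
    have rr : Tendsto (fun k => R + η k) atTop (𝓝[>] R) := by
      refine tendsto_nhdsWithin_iff.2
        ⟨by simpa using hηlim.const_add R, Eventually.of_forall fun k => ?_⟩
      simpa using hη k
    obtain ⟨lp, hlp⟩ := hmp.leftLimit
    obtain ⟨lm, hlm⟩ := hmm.leftLimit
    obtain ⟨kp, hkp⟩ := hmp.rightLimit
    obtain ⟨km, hkm⟩ := hmm.rightLimit
    have b1 :=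
      tendsto_boundaryTerm hR hcp hδlim (tendsto_nhds_of_tendsto_nhdsWithin rl) (hlp.comp rl)
    have b2 :=
      tendsto_boundaryTerm hR hcm hδlim (tendsto_nhds_of_tendsto_nhdsWithin rl) (hlm.comp rl)
    have b3 :=
      tendsto_boundaryTerm hR hcp hδlim (tendsto_nhds_of_tendsto_nhdsWithin rr) (hkp.comp rr)
    have b4 :=
      tendsto_boundaryTerm hR hcm hδlim (tendsto_nhds_of_tendsto_nhdsWithin rr) (hkm.comp rr)
    have hlim := ((((b1.sub b2).const_add I).sub (b3.sub b4)).add hδlim).add hδlim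
    have hIv : I = (∫ r in Ioi 0, r ^ 2 * (S r / (1 + W r / r))) + (∫ r in Ioi 0, yp r)
        + ∫ r in Ioi 0, ym r := by
      have i2 : IntegrableOn (fun r => r ^ 2 * (S r / (1 + W r / r)) + yp r) (Ioi 0) := hE.add ip
      rw [hI, integral_add i2 im, integral_add hE ip]
    have e : I + (lp * (R ^ 2 * Ap R) - lm * (R ^ 2 * Am R))
        - (kp * (R ^ 2 * Ap R) - km * (R ^ 2 * Am R)) + 0 + 0 = X := by
      rw [hX, hIv, ← vp, ← vm, jump, jump, leftLim_eq_of_tendsto hlp, rightLim_eq_of_tendsto hkp,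
        leftLim_eq_of_tendsto hlm, rightLim_eq_of_tendsto hkm]
      ring
    rw [e] at hlim
    exact hlim
  refine ⟨ge_of_tendsto' hYlim fun k => (hYle k).2, ?_⟩
  -- Fatou's lemma removes the truncation and the cutoffs at once.
  set f : ℕ → ℝ → ℝ≥0∞ := fun k => (Ioc (a k) (R - η k) ∪ Ioc (R + η k) (b k)).indicator fun r =>
      ENNReal.ofReal (truncFactor (δ k) mp r ^ 2 * (profileDensity 1 W mp r * (r ^ 2 * Ap r)))
        + ENNReal.ofReal
          (truncFactor (δ k) mm r ^ 2 * (profileDensity (-1) W mm r * (r ^ 2 * Am r))) with hf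
  have hfm : ∀ k, AEMeasurable (f k) (volume.restrict (Ioi 0)) := fun k => by
    refine AEMeasurable.indicator ?_ (measurableSet_Ioc.union measurableSet_Ioc)
    exact (((hmp.aemeasurable_truncFactor (δ k)).pow_const 2).mul mp1).ennreal_ofReal.add
      (((hmm.aemeasurable_truncFactor (δ k)).pow_const 2).mul mm1).ennreal_ofReal
  have hfle : ∀ k, ∫⁻ r in Ioi 0, f k r ≤ ENNReal.ofReal (Y k) := fun k => by
    refine le_trans (setLIntegral_le_lintegral _ _) ?_
    rw [hf, lintegral_indicator (measurableSet_Ioc.union measurableSet_Ioc)]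
    exact (hYle k).1
  have hflim : ∀ᵐ r ∂(volume.restrict (Ioi (0 : ℝ))), liminf (fun k => f k r) atTop
      = ENNReal.ofReal (profileDensity 1 W mp r * (r ^ 2 * Ap r))
        + ENNReal.ofReal (profileDensity (-1) W mm r * (r ^ 2 * Am r)) := by
    have hne : ∀ᵐ r ∂(volume.restrict (Ioi (0 : ℝ))), r ≠ R :=
      ae_restrict_of_ae (by simp [ae_iff, measure_singleton])
    filter_upwards [hne, ae_restrict_mem measurableSet_Ioi] with r hrR hr
    have hr0 : 0 < r := hr
    refine Tendsto.liminf_eq ?_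
    have h1 : Tendsto (fun k => ENNReal.ofReal
        (truncFactor (δ k) mp r ^ 2 * (profileDensity 1 W mp r * (r ^ 2 * Ap r)))
        + ENNReal.ofReal
          (truncFactor (δ k) mm r ^ 2 * (profileDensity (-1) W mm r * (r ^ 2 * Am r)))) atTop
        (𝓝 (ENNReal.ofReal (profileDensity 1 W mp r * (r ^ 2 * Ap r))
        + ENNReal.ofReal (profileDensity (-1) W mm r * (r ^ 2 * Am r)))) := by
      have l1 := ((tendsto_truncFactor mp r hδlim).pow 2).mul_const
        (profileDensity 1 W mp r * (r ^ 2 * Ap r))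
      have l2 := ((tendsto_truncFactor mm r hδlim).pow 2).mul_const
        (profileDensity (-1) W mm r * (r ^ 2 * Am r))
      rw [one_pow, one_mul] at l1 l2
      exact (ENNReal.tendsto_ofReal l1).add (ENNReal.tendsto_ofReal l2)
    refine h1.congr' ?_
    have hmem : ∀ᶠ k in atTop, r ∈ Ioc (a k) (R - η k) ∪ Ioc (R + η k) (b k) := by
      rcases lt_or_gt_of_ne hrR with hlt | hgt
      · filter_upwards [hηlim.eventually_lt_const hr0,
          hηlim.eventually_lt_const (sub_pos.2 hlt)] with k k1 k2
        exact Or.inl ⟨by linarith [ha1 k], by linarith⟩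
      · filter_upwards [hηlim.eventually_lt_const (sub_pos.2 hgt),
          tendsto_natCast_atTop_atTop.eventually_gt_atTop r] with k k1 k2
        exact Or.inr ⟨by linarith, by linarith [hb1 k]⟩
    filter_upwards [hmem] with k hk
    simp only [hf]
    rw [indicator_of_mem hk]
  calc (∫⁻ r in Ioi 0, ENNReal.ofReal (profileDensity 1 W mp r * (r ^ 2 * Ap r)))
      + (∫⁻ r in Ioi 0, ENNReal.ofReal (profileDensity (-1) W mm r * (r ^ 2 * Am r)))
      = ∫⁻ r in Ioi 0, liminf (fun k => f k r) atTop := by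
        rw [← lintegral_add_left' mp1.ennreal_ofReal]
        exact (lintegral_congr_ae hflim).symm
    _ ≤ liminf (fun k => ∫⁻ r in Ioi 0, f k r) atTop := lintegral_liminf_le' hfm
    _ ≤ liminf (fun k => ENNReal.ofReal (Y k)) atTop :=
        liminf_le_liminf (Eventually.of_forall hfle)
    _ = ENNReal.ofReal X := (ENNReal.tendsto_ofReal hYlim).liminf_eq

end

/-! ### Radial weights -/

lemma aemeasurable_comp_norm {d : ℝ → ℝ} (hd : AEMeasurable d (volume.restrict (Ioi (0 : ℝ)))) :
    AEMeasurable fun x : Space => d ‖x‖ :=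
  ⟨fun x => hd.mk d ‖x‖, hd.measurable_mk.comp measurable_norm, ae_norm_of_ae hd.ae_eq_mk⟩

/-- The integral of a radial weight of any sign against `g ≥ 0`, in polar coordinates. -/
lemma lintegral_radial_mul {d : ℝ → ℝ} (hd : AEMeasurable d (volume.restrict (Ioi (0 : ℝ))))
    {g : Space → ℝ} (hg : Integrable g) (hg0 : ∀ x, 0 ≤ g x) {A : ℝ → ℝ}
    (hA : ∀ᵐ r ∂(volume.restrict (Ioi (0 : ℝ))), A r = sphereInt g r) :
    ∫⁻ x, ENNReal.ofReal (d ‖x‖ * g x)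
      = ∫⁻ r in Ioi 0, ENNReal.ofReal (d r * (r ^ 2 * A r)) := by
  have hm : AEMeasurable fun x : Space => ENNReal.ofReal (d ‖x‖ * g x) :=
    ((aemeasurable_comp_norm hd).mul hg.aemeasurable).ennreal_ofReal
  rw [lintegral_polar hm, lintegral_radialMeasure]
  refine lintegral_congr_ae ?_
  filter_upwards [hA, ae_radialMeasure_iff.1 (ae_integrable_sphere hg),
    ae_restrict_mem measurableSet_Ioi] with r h1 h2 h3
  have hr : 0 < r := h3
  have hn : ∀ θ : UnitSphere, ‖r • (θ : Space)‖ = r := fun θ => by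
    rw [norm_smul, norm_unitSphere, mul_one, Real.norm_of_nonneg hr.le]
  simp only [hn]
  have hS : 0 ≤ sphereInt g r := integral_nonneg fun θ => hg0 _
  rw [h1]
  rcases le_total 0 (d r) with hdr | hdr
  · simp only [ENNReal.ofReal_mul hdr, lintegral_const_mul' _ _ ENNReal.ofReal_ne_top]
    rw [← ofReal_integral_eq_lintegral_ofReal h2 (ae_of_all _ fun θ => hg0 _),
      ENNReal.ofReal_mul (sq_nonneg r)]
    exact mul_left_comm _ _ _
  · rw [ENNReal.ofReal_of_nonpos (mul_nonpos_of_nonpos_of_nonneg hdr (mul_nonneg (sq_nonneg r) hS)),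
      lintegral_congr fun θ => ENNReal.ofReal_of_nonpos
        (mul_nonpos_of_nonpos_of_nonneg hdr (hg0 _))]
    simp

lemma integrable_energy {W : ℝ → ℝ} (hW : Measurable W) (hWpos : ∀ s, 0 < s → 0 < W s)
    {g : Space → ℝ} (hg : Integrable g) :
    Integrable fun x => g x / (1 + W ‖x‖ / ‖x‖) := by
  have hm : AEStronglyMeasurable (fun x => g x / (1 + W ‖x‖ / ‖x‖)) volume := by
    have : Measurable fun x : Space => (1 + W ‖x‖ / ‖x‖)⁻¹ := by fun_prop
    exact (hg.1.mul this.aestronglyMeasurable).congr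
        (ae_of_all _ fun x => (div_eq_mul_inv _ _).symm)
  refine hg.mono hm (ae_of_all _ fun x => ?_)
  have hw : 1 ≤ 1 + W ‖x‖ / ‖x‖ := by
    rcases eq_or_ne x 0 with rfl | hx
    · simp
    · linarith [div_pos (hWpos _ (norm_pos_iff.2 hx)) (norm_pos_iff.2 hx)]
  rw [norm_div, Real.norm_of_nonneg (by linarith : 0 ≤ 1 + W ‖x‖ / ‖x‖)]
  exact div_le_self (norm_nonneg _) hw

lemma integral_energy {W : ℝ → ℝ} (hW : Measurable W) (hWpos : ∀ s, 0 < s → 0 < W s)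
    {g : Space → ℝ} (hg : Integrable g) :
    ∫ x, g x / (1 + W ‖x‖ / ‖x‖) = ∫ r in Ioi 0, r ^ 2 * (sphereInt g r / (1 + W r / r)) := by
  rw [← integral_sphereInt (integrable_energy hW hWpos hg), integral_radialMeasure]
  refine setIntegral_congr_fun measurableSet_Ioi fun r hr => ?_
  have hr : 0 < r := hr
  have hn : ∀ θ : UnitSphere, ‖r • (θ : Space)‖ = r := fun θ => by
    rw [norm_smul, norm_unitSphere, mul_one, Real.norm_of_nonneg hr.le]
  simp only [sphereInt, hn, integral_div]

/-! ### The inequality for the given profiles -/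

/-- A comparison of extended integrals that has to be checked only when both negative parts are
finite; otherwise the left-hand side is `-∞`. -/
lemma coe_sub_add_coe_sub_le {P N P' N' : ℝ≥0∞} {L : ℝ}
    (h : N ≠ ⊤ → N' ≠ ⊤ → 0 ≤ L + N.toReal + N'.toReal ∧
      P + P' ≤ ENNReal.ofReal (L + N.toReal + N'.toReal)) :
    ((P : EReal) - (N : EReal)) + ((P' : EReal) - (N' : EReal)) ≤ (L : EReal) := by
  by_cases hN : N = ⊤
  · simp [hN]
  by_cases hN' : N' = ⊤
  · simp [hN']
  obtain ⟨h0, h1⟩ := h hN hN'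
  have hfin : P + P' ≠ ⊤ := (h1.trans_lt ENNReal.ofReal_lt_top).ne
  obtain ⟨hP, hP'⟩ := ENNReal.add_ne_top.1 hfin
  have h2 := ENNReal.toReal_mono ENNReal.ofReal_ne_top h1
  rw [ENNReal.toReal_add hP hP', ENNReal.toReal_ofReal h0] at h2
  rw [← EReal.coe_ennreal_toReal hN, ← EReal.coe_ennreal_toReal hN', ← EReal.coe_ennreal_toReal hP,
    ← EReal.coe_ennreal_toReal hP']
  norm_cast
  linarith

/-- The inequality for given profiles: the radial inequality, read in polar coordinates. -/
theorem extIntegral_le_of_isWeakGradient {R : ℝ} (hR : 0 < R) {W mp mm : ℝ → ℝ} (hW : Measurable W)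
    (hWpos : ∀ s, 0 < s → 0 < W s) (hmp : IsProfile R mp) (hmm : IsProfile R mm) {φ : L2Spinor}
    {D : Fin 3 → L2Spinor} (hD : IsWeakGradient φ D) :
    ∃ Tp Tm : Space → Spinor, IsSphereTrace R (projPos φ) Tp ∧ IsSphereTrace R (projNeg φ) Tm ∧
      extIntegral (fun x => profileDensity 1 W mp ‖x‖ * ‖projPos φ x‖ ^ 2)
        + extIntegral (fun x => profileDensity (-1) W mm ‖x‖ * ‖projNeg φ x‖ ^ 2)
      ≤ (((∫ x, ‖pauliDot (fun j => D j x)‖ ^ 2 / (1 + W ‖x‖ / ‖x‖))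
          - jump R mp * ∫ x, ‖Tp x‖ ^ 2 ∂(surfaceMeasure R)
          + jump R mm * ∫ x, ‖Tm x‖ ^ 2 ∂(surfaceMeasure R) : ℝ) : EReal) := by
  obtain ⟨Tp, Tm, Ap, Am, Bp, Bm, hTp, hTm, -, h, eTp, eTm, -, hAp, hAm, -⟩ :=
    exists_radialData hD hR
  refine ⟨Tp, Tm, hTp, hTm, ?_⟩
  have dp := hmp.aemeasurable_profileDensity hW 1
  have dm := hmm.aemeasurable_profileDensity hW (-1)
  simp only [extIntegral, ← neg_mul]
  rw [lintegral_radial_mul dp (integrable_norm_sq_Lp _) (fun x => sq_nonneg _) hAp,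
    lintegral_radial_mul dm (integrable_norm_sq_Lp _) (fun x => sq_nonneg _) hAm,
    lintegral_radial_mul (d := fun r => -profileDensity 1 W mp r) dp.neg (integrable_norm_sq_Lp _)
      (fun x => sq_nonneg _) hAp,
    lintegral_radial_mul (d := fun r => -profileDensity (-1) W mm r) dm.neg
      (integrable_norm_sq_Lp _) (fun x => sq_nonneg _) hAm,
    integral_energy hW hWpos (integrable_norm_sq_pauliDot D), ← eTp, ← eTm]
  refine coe_sub_add_coe_sub_le fun hNp hNm => ?_
  simp only [neg_mul] at hNp hNm ⊢
  exact h.lintegral_le hR hmp hmm hW hWpos hNp hNm rfl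

/-! ### The Hardy-type inequality -/

lemma integral_eq_toReal_sub_toReal {X : Type*} [MeasurableSpace X] {μ : Measure X} {y : X → ℝ}
    (hy : AEMeasurable y μ) (hP : ∫⁻ r, ENNReal.ofReal (y r) ∂μ ≠ ⊤)
    (hN : ∫⁻ r, ENNReal.ofReal (-y r) ∂μ ≠ ⊤) :
    Integrable y μ ∧ ∫ r, y r ∂μ
      = (∫⁻ r, ENNReal.ofReal (y r) ∂μ).toReal - (∫⁻ r, ENNReal.ofReal (-y r) ∂μ).toReal := by
  have i1 := (integrable_negPart hy hN).1
  have i2 := (integrable_negPart (y := fun r => -y r) hy.neg (by simpa only [neg_neg] using hP)).1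
  have hyi : Integrable y μ := (i2.sub i1).congr (ae_of_all _ fun r => by
    simp only [Pi.sub_apply, neg_neg]
    rcases le_total 0 (y r) with h | h
    · rw [max_eq_left h, max_eq_right (by linarith), sub_zero]
    · rw [max_eq_right h, max_eq_left (by linarith), zero_sub, neg_neg])
  exact ⟨hyi, integral_eq_lintegral_pos_part_sub_lintegral_neg_part hyi⟩

/-- The bound `W ≤ W^{±,m}` says that the density is at least `W / s - 1`. -/
lemma le_profileDensity {ε : ℝ} {W m : ℝ → ℝ} {s : ℝ} (hs : 0 < s)
    (h : W s ≤ profileBound ε m s) : W s / s - 1 ≤ profileDensity ε W m s := by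
  rw [profileBound, le_div_iff₀ (by positivity)] at h
  rw [profileDensity, div_sub_one hs.ne', one_div, inv_mul_eq_div]
  exact div_le_div_of_nonneg_right (by linarith) hs.le

/-- The radial form of the Hardy-type inequality. -/
lemma RadialData.integral_weight_le {R : ℝ} {W mp mm S Ap Am Bp Bm : ℝ → ℝ}
    (h : RadialData S Ap Am Bp Bm) (hR : 0 < R) (hmp : IsProfile R mp) (hmm : IsProfile R mm)
    (hWm : Measurable W) (hWpos : ∀ s, 0 < s → 0 < W s)
    (hb : ∀ᵐ s ∂(volume.restrict (Ioi (0 : ℝ))),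
      W s ≤ profileBound 1 mp s ∧ W s ≤ profileBound (-1) mm s) :
    IntegrableOn (fun r => W r / r * (r ^ 2 * (Ap r + Am r))) (Ioi 0) ∧
      (∫ r in Ioi 0, W r / r * (r ^ 2 * (Ap r + Am r)))
        + min (jump R mp) (-jump R mm) * (R ^ 2 * (Ap R + Am R))
      ≤ (∫ r in Ioi 0, r ^ 2 * (S r / (1 + W r / r))) + ∫ r in Ioi 0, r ^ 2 * (Ap r + Am r) := by
  have iAp := integrable_radialMeasure_iff.1 h.integrable_pos
  have iAm := integrable_radialMeasure_iff.1 h.integrable_neg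
  set yp : ℝ → ℝ := fun r => profileDensity 1 W mp r * (r ^ 2 * Ap r) with hyp
  set ym : ℝ → ℝ := fun r => profileDensity (-1) W mm r * (r ^ 2 * Am r) with hym
  have myp : AEMeasurable yp (volume.restrict (Ioi 0)) :=
    (hmp.aemeasurable_profileDensity hWm 1).mul iAp.1.aemeasurable
  have mym : AEMeasurable ym (volume.restrict (Ioi 0)) :=
    (hmm.aemeasurable_profileDensity hWm (-1)).mul iAm.1.aemeasurable
  have hle : ∀ᵐ r ∂(volume.restrict (Ioi (0 : ℝ))),
      (W r / r - 1) * (r ^ 2 * Ap r) ≤ yp r ∧ (W r / r - 1) * (r ^ 2 * Am r) ≤ ym r := by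
    filter_upwards [hb, ae_restrict_mem measurableSet_Ioi] with r hr hr0
    exact ⟨mul_le_mul_of_nonneg_right (le_profileDensity hr0 hr.1)
        (mul_nonneg (sq_nonneg r) (h.pos_nonneg r hr0)),
      mul_le_mul_of_nonneg_right (le_profileDensity hr0 hr.2)
        (mul_nonneg (sq_nonneg r) (h.neg_nonneg r hr0))⟩
  -- As `W > 0`, the densities are at least `-1`, so their negative parts are integrable.
  have hfin : ∀ {y A : ℝ → ℝ}, IntegrableOn (fun r => r ^ 2 * A r) (Ioi 0) →
      (∀ r, 0 < r → 0 ≤ A r) →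
      (∀ᵐ r ∂(volume.restrict (Ioi (0 : ℝ))), (W r / r - 1) * (r ^ 2 * A r) ≤ y r) →
      ∫⁻ r in Ioi 0, ENNReal.ofReal (-y r) ≠ ⊤ := by
    intro y A hA hA0 hy
    refine ((lintegral_mono_ae ?_).trans_lt
      ((hasFiniteIntegral_iff_norm _).1 hA.2)).ne
    filter_upwards [hy, ae_restrict_mem measurableSet_Ioi] with r hr hr0
    have hr0 : 0 < r := hr0
    refine ENNReal.ofReal_le_ofReal (le_trans ?_ (le_abs_self _))
    have h1 : 0 ≤ W r / r * (r ^ 2 * A r) :=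
      mul_nonneg (div_pos (hWpos r hr0) hr0).le (mul_nonneg (sq_nonneg r) (hA0 r hr0))
    linarith
  have hNp := hfin iAp h.pos_nonneg (hle.mono fun r hr => hr.1)
  have hNm := hfin iAm h.neg_nonneg (hle.mono fun r hr => hr.2)
  obtain ⟨hX0, hX⟩ := h.lintegral_le hR hmp hmm hWm hWpos hNp hNm rfl
  have hPfin := (hX.trans_lt ENNReal.ofReal_lt_top).ne
  obtain ⟨hPp, hPm⟩ := ENNReal.add_ne_top.1 hPfin
  have hX2 := ENNReal.toReal_mono ENNReal.ofReal_ne_top hX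
  rw [ENNReal.toReal_add hPp hPm, ENNReal.toReal_ofReal hX0] at hX2
  obtain ⟨iyp, vyp⟩ := integral_eq_toReal_sub_toReal myp hPp hNp
  obtain ⟨iym, vym⟩ := integral_eq_toReal_sub_toReal mym hPm hNm
  have iA : IntegrableOn (fun r => r ^ 2 * (Ap r + Am r)) (Ioi 0) := by
    exact (iAp.add iAm).congr (ae_of_all _ fun r => (mul_add _ _ _).symm)
  have iy : IntegrableOn (fun r => yp r + ym r) (Ioi 0) := iyp.add iym
  have iG : IntegrableOn (fun r => yp r + ym r + r ^ 2 * (Ap r + Am r)) (Ioi 0) := iy.add iA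
  have hle2 : ∀ᵐ r ∂(volume.restrict (Ioi (0 : ℝ))),
      0 ≤ W r / r * (r ^ 2 * (Ap r + Am r)) ∧
      W r / r * (r ^ 2 * (Ap r + Am r)) ≤ yp r + ym r + r ^ 2 * (Ap r + Am r) := by
    filter_upwards [hle, ae_restrict_mem measurableSet_Ioi] with r hr hr0
    have hr0 : 0 < r := hr0
    exact ⟨mul_nonneg (div_pos (hWpos r hr0) hr0).le (mul_nonneg (sq_nonneg r)
      (add_nonneg (h.pos_nonneg r hr0) (h.neg_nonneg r hr0))), by linarith [hr.1, hr.2]⟩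
  have iK : IntegrableOn (fun r => W r / r * (r ^ 2 * (Ap r + Am r))) (Ioi 0) := by
    refine iG.mono' ((by fun_prop : Measurable fun r => W r / r).aestronglyMeasurable.mul iA.1) ?_
    filter_upwards [hle2] with r hr
    rw [Real.norm_of_nonneg hr.1]
    exact hr.2
  refine ⟨iK, ?_⟩
  have h1 := integral_mono_ae iK iG (hle2.mono fun r hr => hr.2)
  rw [integral_add iy iA, integral_add iyp iym, vyp, vym] at h1
  have h2 : min (jump R mp) (-jump R mm) * (R ^ 2 * Ap R) ≤ jump R mp * (R ^ 2 * Ap R) :=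
    mul_le_mul_of_nonneg_right (min_le_left _ _) (mul_nonneg (sq_nonneg R) (h.pos_nonneg R hR))
  have h3 : min (jump R mp) (-jump R mm) * (R ^ 2 * Am R) ≤ -jump R mm * (R ^ 2 * Am R) :=
    mul_le_mul_of_nonneg_right (min_le_right _ _) (mul_nonneg (sq_nonneg R) (h.neg_nonneg R hR))
  linarith

/-- The Hardy-type inequality for weights below both `W^{+,m₊}` and `W^{-,m₋}`. The trace of `φ` is
the sum of the traces of its two channels, which are orthogonal on the sphere. -/
theorem hardy_of_le_profileBound {R : ℝ} (hR : 0 < R) {W mp mm : ℝ → ℝ} (hW : Measurable W)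
    (hWpos : ∀ s, 0 < s → 0 < W s) (hmp : IsProfile R mp) (hmm : IsProfile R mm)
    (hb : ∀ᵐ s ∂(volume.restrict (Ioi (0 : ℝ))),
      W s ≤ profileBound 1 mp s ∧ W s ≤ profileBound (-1) mm s) {φ : L2Spinor}
    {D : Fin 3 → L2Spinor} (hD : IsWeakGradient φ D) :
    ∃ T : Space → Spinor, IsSphereTrace R φ T ∧
      Integrable (fun x : Space => W ‖x‖ / ‖x‖ * ‖φ x‖ ^ 2) ∧
      (∫ x : Space, W ‖x‖ / ‖x‖ * ‖φ x‖ ^ 2)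
        + min (jump R mp) (-jump R mm) * ∫ x, ‖T x‖ ^ 2 ∂(surfaceMeasure R)
      ≤ ∫ x : Space, (‖pauliDot (fun j => D j x)‖ ^ 2 / (1 + W ‖x‖ / ‖x‖) + ‖φ x‖ ^ 2) := by
  obtain ⟨Tp, Tm, Ap, Am, Bp, Bm, -, -, hT, h, -, -, eT, -, -, hA⟩ := exists_radialData hD hR
  obtain ⟨iK, hK⟩ := h.integral_weight_le hR hmp hmm hW hWpos hb
  have hφ := integrable_norm_sq_Lp φ
  have hWd : Measurable fun r : ℝ => W r / r := by fun_prop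
  have hw0 : ∀ x : Space, 0 ≤ W ‖x‖ / ‖x‖ * ‖φ x‖ ^ 2 := fun x => by
    rcases eq_or_ne x 0 with rfl | hx
    · simp
    · exact mul_nonneg (div_pos (hWpos _ (norm_pos_iff.2 hx)) (norm_pos_iff.2 hx)).le (sq_nonneg _)
  have hlin := lintegral_radial_mul (d := fun r => W r / r) hWd.aemeasurable hφ
    (fun x => sq_nonneg _) hA
  have hK0 : 0 ≤ᵐ[volume.restrict (Ioi 0)] fun r => W r / r * (r ^ 2 * (Ap r + Am r)) := by
    filter_upwards [ae_restrict_mem measurableSet_Ioi] with r hr0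
    have hr0 : 0 < r := hr0
    exact mul_nonneg (div_pos (hWpos r hr0) hr0).le (mul_nonneg (sq_nonneg r)
      (add_nonneg (h.pos_nonneg r hr0) (h.neg_nonneg r hr0)))
  rw [← ofReal_integral_eq_lintegral_ofReal iK hK0] at hlin
  have hmeas : AEStronglyMeasurable (fun x : Space => W ‖x‖ / ‖x‖ * ‖φ x‖ ^ 2) volume :=
    (hWd.comp measurable_norm).aestronglyMeasurable.mul hφ.1
  have hint : ∫ x : Space, W ‖x‖ / ‖x‖ * ‖φ x‖ ^ 2
      = ∫ r in Ioi 0, W r / r * (r ^ 2 * (Ap r + Am r)) := by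
    rw [integral_eq_lintegral_of_nonneg_ae (ae_of_all _ hw0) hmeas, hlin,
      ENNReal.toReal_ofReal (integral_nonneg_of_ae hK0)]
  have hφint : ∫ x : Space, ‖φ x‖ ^ 2 = ∫ r in Ioi 0, r ^ 2 * (Ap r + Am r) := by
    rw [← integral_sphereInt hφ, integral_radialMeasure]
    refine integral_congr_ae ?_
    filter_upwards [hA] with r hr
    rw [hr]
  refine ⟨fun x => Tp x + Tm x, hT, ⟨hmeas, ?_⟩, ?_⟩
  · rw [hasFiniteIntegral_iff_ofReal (ae_of_all _ hw0), hlin]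
    exact ENNReal.ofReal_lt_top
  · have hD2 := integrable_norm_sq_pauliDot D
    rw [integral_add (integrable_energy hW hWpos hD2) hφ, integral_energy hW hWpos hD2, hint, hφint,
      ← eT]
    exact hK

end DiracHardy

end

theorem proposition1 (R : ℝ) (hR : 0 < R)
    (W : ℝ → ℝ) (hWmeas : Measurable W) (hWpos : ∀ s, 0 < s → 0 < W s)
    (mp mm : ℝ → ℝ) (hmp : DiracHardy.IsProfile R mp) (hmm : DiracHardy.IsProfile R mm) :
    -- the inequality for the given profiles
    (∀ (φ : DiracHardy.L2Spinor) (D : Fin 3 → DiracHardy.L2Spinor),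
      DiracHardy.IsWeakGradient φ D →
      ∃ Tp Tm : DiracHardy.Space → DiracHardy.Spinor,
        DiracHardy.IsSphereTrace R (DiracHardy.projPos φ) Tp ∧
        DiracHardy.IsSphereTrace R (DiracHardy.projNeg φ) Tm ∧
        DiracHardy.extIntegral
            (fun x => DiracHardy.profileDensity 1 W mp ‖x‖ * ‖DiracHardy.projPos φ x‖ ^ 2)
          + DiracHardy.extIntegral
            (fun x => DiracHardy.profileDensity (-1) W mm ‖x‖ * ‖DiracHardy.projNeg φ x‖ ^ 2)
        ≤ (((∫ x : DiracHardy.Space,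
                ‖DiracHardy.pauliDot (fun j => D j x)‖ ^ 2 / (1 + W ‖x‖ / ‖x‖))
              - DiracHardy.jump R mp * ∫ x, ‖Tp x‖ ^ 2 ∂(DiracHardy.surfaceMeasure R)
              + DiracHardy.jump R mm * ∫ x, ‖Tm x‖ ^ 2 ∂(DiracHardy.surfaceMeasure R) : ℝ)
            : EReal)) ∧
    -- the Hardy-type inequality when `W` lies below both `W^{+,m₊}` and `W^{-,m₋}`
    ((∀ᵐ s ∂(volume.restrict (Ioi (0 : ℝ))),
        W s ≤ DiracHardy.profileBound 1 mp s ∧ W s ≤ DiracHardy.profileBound (-1) mm s) →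
      ∀ (φ : DiracHardy.L2Spinor) (D : Fin 3 → DiracHardy.L2Spinor),
        DiracHardy.IsWeakGradient φ D →
        ∃ T : DiracHardy.Space → DiracHardy.Spinor,
          DiracHardy.IsSphereTrace R φ T ∧
          Integrable (fun x : DiracHardy.Space => W ‖x‖ / ‖x‖ * ‖φ x‖ ^ 2) ∧
          (∫ x : DiracHardy.Space, W ‖x‖ / ‖x‖ * ‖φ x‖ ^ 2)
            + min (DiracHardy.jump R mp) (-DiracHardy.jump R mm)
              * ∫ x, ‖T x‖ ^ 2 ∂(DiracHardy.surfaceMeasure R)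
          ≤ ∫ x : DiracHardy.Space,
              (‖DiracHardy.pauliDot (fun j => D j x)‖ ^ 2 / (1 + W ‖x‖ / ‖x‖) + ‖φ x‖ ^ 2)) :=
  ⟨fun _ _ hD => DiracHardy.extIntegral_le_of_isWeakGradient hR hWmeas hWpos hmp hmm hD,
    fun hb _ _ hD => DiracHardy.hardy_of_le_profileBound hR hWmeas hWpos hmp hmm hb hD⟩
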